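/- **Definitions.** A *simplicial tessellation* is a collection $\mathcal T$ of compact subsets (tiles) of $\mathbb R^2$ which cover $\mathbb R^2$, have pairwise disjoint interiors, and satisfy: (i) if $t_1,\dots,t_k$ and $t'_1,\dots,t'_m$ ($k,m\ge 1$) are tiles with $\bigcap_i t_i=\bigcap_j t'_j\neq\emptyset$, then $\{t_1,\dots,t_k\}=\{t'_1,\dots,t'_m\}$; (ii) if $t_1,\dots,t_k$ ($k\ge 1$) are tiles with $t_i\cap t_j\ne\emptyset$ for all $i,j$, then $\bigcap_i t_i\neq\emptyset$. It has *capacity* $C>0$ if each tile contains a ball of radius $C$; it is *$K$-separated* if $d(t,t')\ge K$ for any two disjoint tiles $t,t'$, where $d(t,t')$ is the infimum of the distances between points of $t$ and of $t'$; its *diameter* $\operatorname{diam}\mathcal T$ is the supremum of the diameters of its tiles. For $k=2,3$, $\mathcal T^k$ is the set of $k$-tuples of pairwise distinct tiles of $\mathcal T$ with non-empty common intersection. For $u\in\mathbb R^2$ and $t\subset\mathbb R^2$ write $u\in' t$ if $u+(\varepsilon,\varepsilon^2)\in t$ for all sufficiently small $\varepsilon>0$, and $\mathbb Z^2\cap'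 t=\{n\in\mathbb Z^2: n\in' t\}$. A *polygonal region* is a finite union of convex polygons with non-empty interior (it may be disconnected). Let $\varphi$ be an action of $\mathbb Z^2$ by homeomorphisms on a space $X$. A family $\mathcal T(x)$, $x\in X$, of tessellations is *$\varphi$-regular* if $\mathcal T(\varphi^n(x))=\mathcal T(x)+n$ for all $x\in X$, $n\in\mathbb Z^2$, and if for all $x\in X$ and $a\in\mathcal T(x)$ there is a neighbourhood $U$ of $x$ with $a\in\mathcal T(x')$ for all $x'\in U$. **Theorem.** There is an absolute integer $E_0\ge 3$ such that for every integer $E\ge E_0$ and every free minimal action $\varphi$ of $\mathbb Z^2$ on a Cantor set $X$ the following holds. There is a sequence of $\varphi$-regular families of simplicial tessellations $\mathcal T_l(x)$, $x\in X$, $l\ge 0$, by polygonal regions, each of finite diameter, such that for all $l\ge 0$ and $x\in X$: 1. $\mathcal T_l(x)$ has capacity $\max\{l,E\}$; 2. $\mathcal T_{l+1}(x)$ is $(l+\operatorname{diam}\mathcal T_l(x))$-separated; 3. each tile of $\mathcal T_l(x)$ meets at most $E$ other tiles of $\mathcal T_l(x)$; 4. if two distinct tiles of $\mathcal T_l(x)$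 meet, then there are exactly two others which meet both of them; 5. each tile of $\mathcal T_l(x)$ is contained in a tile of $\mathcal T_{l+1}(x)$; 6. if $(t_1,t_2,t_3)$ and $(t_1,t_2,t_3')$ are in $\mathcal T_{l+1}^3(x)$ with $t_3\ne t_3'$, then $\#\mathcal N^3<\#\mathcal N^2$, where $\mathcal N^3$ is the set of all $(t,t',t'')\in\mathcal T_l^3(x)$ with $t\subset t_1$, $t'\subset t_2$, $t''\subset t_3$, and $\mathcal N^2$ is the set of all $t\in\mathcal T_l(x)$ with $t\subset t_1$ such that (a) there is $t'\subset t_2$ with $(t,t')\in\mathcal T_l^2(x)$, (b) for all $(t,t')\in\mathcal T_l^2(x)$, $t'\subset t_1\cup t_2$, and (c) $d(t,t_3)<d(t,t_3')-\operatorname{diam}\mathcal T_l(x)$; 7. for all $t$ and $s$ in $\mathcal T_{l+1}(x)$, $$2^l\,\#\{n\in\mathbb Z^2\cap' t : d(n,\mathbb R^2\setminus t)\le l\}\le \#(\mathbb Z^2\cap' s).$$ -/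

import Mathlib

universe u

open Set Filter Topology

noncomputable section

namespace PlaneTess

/-- The Euclidean plane. -/
abbrev Plane := EuclideanSpace ℝ (Fin 2)

/-- The inclusion of the integer lattice `ℤ²` into the plane. -/
def latticePoint (n : ℤ × ℤ) : Plane := !₂[(n.1 : ℝ), (n.2 : ℝ)]

/-- The translate `t + n` of a subset of the plane by a lattice vector. -/
def translate (n : ℤ × ℤ) (t : Set Plane) : Set Plane := (fun p => p + latticePoint n) '' t

/-- A simplicial tessellation: compact sets covering the plane, with pairwise disjoint interiors,
such that a non-empty finite intersection of tiles determines the tiles that take part in it, and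
finitely many tiles which meet pairwise have a common point. -/
structure IsSimplicialTessellation (T : Set (Set Plane)) : Prop where
  isCompact : ∀ t ∈ T, IsCompact t
  cover : ⋃₀ T = univ
  disjoint_interior : ∀ t ∈ T, ∀ s ∈ T, t ≠ s → Disjoint (interior t) (interior s)
  eq_of_sInter_eq : ∀ S S' : Set (Set Plane), S ⊆ T → S' ⊆ T → S.Finite → S'.Finite →
    S.Nonempty → S'.Nonempty → ⋂₀ S = ⋂₀ S' → (⋂₀ S).Nonempty → S = S'
  sInter_nonempty : ∀ S : Set (Set Plane), S ⊆ T → S.Finite → S.Nonempty →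
    (∀ s ∈ S, ∀ t ∈ S, (s ∩ t).Nonempty) → (⋂₀ S).Nonempty

/-- A polygonal region: a finite union of non-degenerate convex polygons. It may be non-convex,
and it may be disconnected. -/
def IsPolygonalRegion (t : Set Plane) : Prop :=
  ∃ F : Set (Set Plane), F.Finite ∧ t = ⋃₀ F ∧
    ∀ c ∈ F, (interior c).Nonempty ∧ ∃ v : Set Plane, v.Finite ∧ c = convexHull ℝ v

/-- Every tile contains a ball of radius `C`. -/
def HasCapacity (T : Set (Set Plane)) (C : ℝ) : Prop :=
  ∀ t ∈ T, ∃ p : Plane, Metric.ball p C ⊆ t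

/-- The distance between two (non-empty) sets: the infimum of the distances of their points. -/
def setDist (s t : Set Plane) : ℝ := sInf (Set.image2 dist s t)

/-- Any two disjoint tiles are at distance at least `K`. -/
def IsSeparated (T : Set (Set Plane)) (K : ℝ) : Prop :=
  ∀ t ∈ T, ∀ s ∈ T, Disjoint t s → K ≤ setDist t s

/-- The diameters of the tiles are bounded. -/
def BoundedDiam (T : Set (Set Plane)) : Prop := BddAbove (Metric.diam '' T)

/-- The diameter of a tessellation: the supremum of the diameters of its tiles (a meaningful
number when `BoundedDiam T` holds). -/
def tessDiam (T : Set (Set Plane)) : ℝ := sSup (Metric.diam '' T)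

/-- The ordered pairs of distinct tiles with non-empty intersection. -/
def pairs (T : Set (Set Plane)) : Set (Set Plane × Set Plane) :=
  {q | q.1 ∈ T ∧ q.2 ∈ T ∧ q.1 ≠ q.2 ∧ (q.1 ∩ q.2).Nonempty}

/-- The ordered triples of pairwise distinct tiles with non-empty common intersection. -/
def triples (T : Set (Set Plane)) : Set (Set Plane × Set Plane × Set Plane) :=
  {q | q.1 ∈ T ∧ q.2.1 ∈ T ∧ q.2.2 ∈ T ∧ q.1 ≠ q.2.1 ∧ q.1 ≠ q.2.2 ∧ q.2.1 ≠ q.2.2 ∧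
    (q.1 ∩ q.2.1 ∩ q.2.2).Nonempty}

/-- The tiles other than `t` which meet `t`. -/
def neighbours (T : Set (Set Plane)) (t : Set Plane) : Set (Set Plane) :=
  {s | s ∈ T ∧ s ≠ t ∧ (s ∩ t).Nonempty}

/-- The set `𝒩³`: triples `(t, t', t'')` of tiles of `T` with non-empty common intersection and
`t ⊆ t₁`, `t' ⊆ t₂`, `t'' ⊆ t₃`. -/
def N3 (T : Set (Set Plane)) (t₁ t₂ t₃ : Set Plane) : Set (Set Plane × Set Plane × Set Plane) :=
  {q | q ∈ triples T ∧ q.1 ⊆ t₁ ∧ q.2.1 ⊆ t₂ ∧ q.2.2 ⊆ t₃}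

/-- The set `𝒩²`: tiles `t ⊆ t₁` of `T` which meet a tile contained in `t₂`, all of whose
neighbours are contained in `t₁ ∪ t₂`, and with `d(t, t₃) < d(t, t₃') - diam T`. -/
def N2 (T : Set (Set Plane)) (t₁ t₂ t₃ t₃' : Set Plane) : Set (Set Plane) :=
  {t | t ∈ T ∧ t ⊆ t₁ ∧
    (∃ t', t' ⊆ t₂ ∧ (t, t') ∈ pairs T) ∧
    (∀ t', (t, t') ∈ pairs T → t' ⊆ t₁ ∪ t₂) ∧
    setDist t t₃ < setDist t t₃' - tessDiam T}

/-- The relation `u ∈' t`: the point `u + (ε, ε²)` is in `t` for all sufficiently small `ε > 0`. -/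
def MemPrime (u : Plane) (t : Set Plane) : Prop :=
  ∀ᶠ ε : ℝ in 𝓝[>] 0, u + !₂[ε, ε ^ 2] ∈ t

/-- The set `ℤ² ∩' t` of lattice points `n` with `n ∈' t`. -/
def latticeIn (t : Set Plane) : Set (ℤ × ℤ) := {n | MemPrime (latticePoint n) t}

/-- A family of collections of plane sets indexed by a `ℤ²`-space is regular for the action if it
is equivariant and every tile of `T x` is also a tile of `T x'` for all `x'` near `x`. -/
structure IsRegularFamily {X : Type u} [TopologicalSpace X] [AddAction (ℤ × ℤ) X]
    (T : X → Set (Set Plane)) : Prop where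
  equivariant : ∀ (x : X) (n : ℤ × ℤ), T (n +ᵥ x) = translate n '' T x
  locally_constant : ∀ (x : X), ∀ a ∈ T x, ∃ U ∈ 𝓝 x, ∀ x' ∈ U, a ∈ T x'

end PlaneTess

end

open PlaneTess

/-! Every tile is a finite union of unit lattice squares, and each level is built from the one
before. A level is encoded by an equivariant, locally constant map `q` that sends each lattice
square to a reference point at distance at most `D` (`LatticeAssignment`); squares with equal
reference points form a tile. For the next level, take a triangulation of the plane at a much larger
scale `1 / L` and label each square by the vertex whose barycentric coordinate is largest at its
reference point. This vertex is the new reference point. The new label depends only on the old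
reference point, so old tiles lie inside new ones.

A new tile is therefore the region where one coordinate dominates, up to an error of order `L * (D +
2)`. If the error is small, a tile stays in the open star of its vertex, so tiles meet only when
their vertices are adjacent. Conversely the three tiles of a triangle have a common point by the
Knaster–Kuratowski–Mazurkiewicz lemma (`exists_mem_inter_of_triangle`), which does not care that
tiles may be disconnected. The nerve of the tiling is thus the triangulation, and the conditions on
intersections and neighbours become combinatorial: flag complex, three ranks, bounded degree, two
triangles on each edge (`FatTriangulation`).

The metric conditions follow by letting `L` tend to `0` with `D` fixed. Capacity and separation grow
like `1 / L`. The small triples near the centre of a triangle stay bounded in number, while the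
small tiles along a boundary arc number about `1 / L`. A tile has about `1 / L ^ 2` lattice points,
of which `O(1 / L)` are near its boundary.

The triangulation is the barycentric subdivision of the Delaunay triangulation of an `R`-separated,
`2 * R`-dense net in general position (`IsNet.triangulation`). Separation and density make its
triangles fat; subdividing makes the complex flag and ranks its vertices by dimension; the degree
bound does not depend on `R`, hence an absolute `E₀`. The nets come from clopen marker sets of the
free action, displaced by generic shifts that depend on a locally constant colour (`exists_nets`).
The vertex chosen at a point is canonical and depends only on the net within `4 * R`, so the new map
is again equivariant and locally constant. -/

namespace PlaneTess

/-! ### Sperner's lemma on a grid and the Knaster–Kuratowski–Mazurkiewicz lemma. -/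

/-- The signed step from label `a` to label `b` on the circle `0 → 1 → 2 → 0`. -/
def labelStep (a b : Fin 3) : ℤ :=
  if b = a + 1 then 1 else if a = b + 1 then -1 else 0

/-- Omitting a label cuts the circle open to an arc, where the total of signed steps depends only on
the end points of a path. -/
theorem labelStep_square (a b c d : Fin 3)
    (h : ¬ ∀ k : Fin 3, k = a ∨ k = b ∨ k = c ∨ k = d) :
    labelStep a b + labelStep b d = labelStep a c + labelStep c d := by
  revert a b c d; decide

theorem sum_labelStep_of_ne (m : Fin 3) (f : ℕ → Fin 3) (N : ℕ) (h : ∀ i ≤ N, f i ≠ m) :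
    ∑ i ∈ Finset.range N, labelStep (f i) (f (i + 1)) = labelStep (f 0) (f N) := by
  have key : ∀ m a b c : Fin 3, a ≠ m → b ≠ m → c ≠ m →
      labelStep a b + labelStep b c = labelStep a c := by decide
  induction N with
  | zero => simpa using (by decide : ∀ a : Fin 3, 0 = labelStep a a) (f 0)
  | succ n ih =>
    rw [Finset.sum_range_succ, ih fun i hi => h i (by omega)]
    exact key m _ _ _ (h 0 (by omega)) (h n (by omega)) (h (n + 1) le_rfl)

/-- A combinatorial Sperner lemma on the square grid. -/
theorem exists_square_of_labelling (N : ℕ) (f : ℕ → ℕ → Fin 3)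
    (left : ∀ j ≤ N, f 0 j = 0) (right : ∀ j ≤ N, f N j ≠ 0)
    (bottom : ∀ i ≤ N, f i 0 ≠ 2) (top : ∀ i ≤ N, f i N ≠ 1) :
    ∃ i < N, ∃ j < N, ∀ k : Fin 3, k = f i j ∨ k = f (i + 1) j ∨ k = f i (j + 1) ∨
      k = f (i + 1) (j + 1) := by
  by_contra hcon
  push Not at hcon
  have hcell : ∀ i < N, ∀ j < N,
      labelStep (f i j) (f (i + 1) j) + labelStep (f (i + 1) j) (f (i + 1) (j + 1)) =
      labelStep (f i j) (f i (j + 1)) + labelStep (f i (j + 1)) (f (i + 1) (j + 1)) := by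
    intro i hi j hj
    apply labelStep_square
    obtain ⟨k, hk⟩ := hcon i hi j hj
    intro h
    rcases h k with h | h | h | h <;> tauto
  have hrow : ∀ j < N, ∑ i ∈ Finset.range N, labelStep (f i j) (f (i + 1) j) +
      labelStep (f N j) (f N (j + 1)) = labelStep (f 0 j) (f 0 (j + 1)) +
      ∑ i ∈ Finset.range N, labelStep (f i (j + 1)) (f (i + 1) (j + 1)) := by
    intro j hj
    have : ∀ n ≤ N, ∑ i ∈ Finset.range n, labelStep (f i j) (f (i + 1) j) +
      labelStep (f n j) (f n (j + 1)) = labelStep (f 0 j) (f 0 (j + 1)) +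
      ∑ i ∈ Finset.range n, labelStep (f i (j + 1)) (f (i + 1) (j + 1)) := by
      intro n hn
      induction n with
      | zero => simp
      | succ n ih =>
        rw [Finset.sum_range_succ, Finset.sum_range_succ]
        linarith [ih (by omega), hcell n (by omega) j hj]
    exact this N le_rfl
  have htot : ∀ m ≤ N, ∑ i ∈ Finset.range N, labelStep (f i 0) (f (i + 1) 0) +
      ∑ j ∈ Finset.range m, labelStep (f N j) (f N (j + 1)) =
      ∑ j ∈ Finset.range m, labelStep (f 0 j) (f 0 (j + 1)) +
      ∑ i ∈ Finset.range N, labelStep (f i m) (f (i + 1) m) := by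
    intro m hm
    induction m with
    | zero => simp
    | succ m ih =>
      rw [Finset.sum_range_succ, Finset.sum_range_succ]
      linarith [ih (by omega), hrow m (by omega)]
  -- The two boundary paths from corner `(0, 0)` to corner `(N, N)` now have the same total step.
  -- The corner labels `0, 1, 2` force `2` along bottom and right but `-1` along left and top: the
  -- boundary winds once around the circle.
  have h := htot N le_rfl
  rw [sum_labelStep_of_ne 2 (fun i => f i 0) N bottom, sum_labelStep_of_ne 0 (f N) N right,
    sum_labelStep_of_ne 1 (f 0) N (fun i hi => by rw [left i hi]; decide),
    sum_labelStep_of_ne 1 (fun i => f i N) N top] at h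
  have a1 := right 0 (by omega)
  have a2 := right N le_rfl
  have a3 := bottom N le_rfl
  have a4 := top N le_rfl
  simp only [left 0 (by omega), left N le_rfl] at h
  revert h a1 a2 a3 a4
  generalize f N 0 = x
  generalize f N N = y
  revert x y
  decide

/-- The Knaster–Kuratowski–Mazurkiewicz lemma for a triangle. -/
theorem exists_mem_inter_of_triangle {E : Type*} [NormedAddCommGroup E] [NormedSpace ℝ E]
    {A B C : Set E} (hA : IsClosed A) (hB : IsClosed B) (hC : IsClosed C) (a b c : E)
    (hcov : ∀ u v w : ℝ, 0 ≤ u → 0 ≤ v → 0 ≤ w → u + v + w = 1 →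
      u • a + v • b + w • c ∈ A ∪ B ∪ C)
    (hoppA : ∀ v w : ℝ, 0 ≤ v → 0 ≤ w → v + w = 1 → v • b + w • c ∉ A)
    (hoppB : ∀ u w : ℝ, 0 ≤ u → 0 ≤ w → u + w = 1 → u • a + w • c ∉ B)
    (hoppC : ∀ u v : ℝ, 0 ≤ u → 0 ≤ v → u + v = 1 → u • a + v • b ∉ C) :
    (A ∩ B ∩ C).Nonempty := by
  classical
  by_contra hne
  rw [Set.not_nonempty_iff_eq_empty] at hne
  have hA0 : A.Nonempty := by
    refine ⟨a, ?_⟩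
    have h1 := hcov 1 0 0 (by norm_num) (by norm_num) (by norm_num) (by norm_num)
    have h2 := hoppB 1 0 (by norm_num) (by norm_num) (by norm_num)
    have h3 := hoppC 1 0 (by norm_num) (by norm_num) (by norm_num)
    simp only [one_smul, zero_smul, add_zero] at h1 h2 h3
    simpa [h2, h3] using h1
  have hB0 : B.Nonempty := by
    refine ⟨b, ?_⟩
    have h1 := hcov 0 1 0 (by norm_num) (by norm_num) (by norm_num) (by norm_num)
    have h2 := hoppA 1 0 (by norm_num) (by norm_num) (by norm_num)
    have h3 := hoppC 0 1 (by norm_num) (by norm_num) (by norm_num)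
    simp only [one_smul, zero_smul, add_zero, zero_add] at h1 h2 h3
    simpa [h2, h3] using h1
  have hC0 : C.Nonempty := by
    refine ⟨c, ?_⟩
    have h1 := hcov 0 0 1 (by norm_num) (by norm_num) (by norm_num) (by norm_num)
    have h2 := hoppA 0 1 (by norm_num) (by norm_num) (by norm_num)
    have h3 := hoppB 0 1 (by norm_num) (by norm_num) (by norm_num)
    simp only [one_smul, zero_smul, add_zero, zero_add] at h1 h2 h3
    simpa [h2, h3] using h1
  -- `P` collapses the left side of the square to `a` and maps the bottom, right and top sides onto
  -- the edges `ab`, `bc` and `ac`, so the hypotheses on opposite edges become the boundary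
  -- conditions of the grid labelling.
  let P : ℝ × ℝ → E := fun p => (1 - p.1) • a + (p.1 * (1 - p.2)) • b + (p.1 * p.2) • c
  have hP : Continuous P := by fun_prop
  let Q : Set (ℝ × ℝ) := Icc 0 1 ×ˢ Icc 0 1
  have hQ : IsCompact Q := isCompact_Icc.prod isCompact_Icc
  -- If the closed sets have no common point, `g` has a positive minimum on the square. A grid so
  -- fine that `P` varies by less than this minimum within a grid square has a square with all three
  -- labels, and there `g` is too small.
  let g : ℝ × ℝ → ℝ := fun p =>
    max (Metric.infDist (P p) A) (max (Metric.infDist (P p) B) (Metric.infDist (P p) C))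
  have hg : Continuous g := by
    have := Metric.continuous_infDist_pt A
    have := Metric.continuous_infDist_pt B
    have := Metric.continuous_infDist_pt C
    fun_prop
  have hgpos : ∀ p, 0 < g p := by
    intro p
    by_contra h
    push Not at h
    simp only [g, max_le_iff] at h
    have : P p ∈ A ∩ B ∩ C := ⟨⟨(hA.mem_iff_infDist_zero hA0).2 (le_antisymm h.1 Metric.infDist_nonneg),
      (hB.mem_iff_infDist_zero hB0).2 (le_antisymm h.2.1 Metric.infDist_nonneg)⟩,
      (hC.mem_iff_infDist_zero hC0).2 (le_antisymm h.2.2 Metric.infDist_nonneg)⟩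
    rw [hne] at this
    exact this
  obtain ⟨p0, -, hp0⟩ := hQ.exists_isMinOn ⟨(0, 0), by simp [Q]⟩ hg.continuousOn
  have huc := hQ.uniformContinuousOn_of_continuous hP.continuousOn
  rw [Metric.uniformContinuousOn_iff] at huc
  obtain ⟨δ, hδ, huc⟩ := huc (g p0) (hgpos p0)
  obtain ⟨n, hn⟩ := exists_nat_one_div_lt hδ
  set N := n + 1 with hN
  have hNpos : (0 : ℝ) < N := by positivity
  let pt : ℕ → ℕ → ℝ × ℝ := fun i j => ((i : ℝ) / N, (j : ℝ) / N)
  have hfrac : ∀ i ≤ N, 0 ≤ (i : ℝ) / N ∧ (i : ℝ) / N ≤ 1 := fun i hi =>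
    ⟨by positivity, by rw [div_le_one hNpos]; exact_mod_cast hi⟩
  have hptQ : ∀ i ≤ N, ∀ j ≤ N, pt i j ∈ Q := fun i hi j hj => ⟨hfrac i hi, hfrac j hj⟩
  let f : ℕ → ℕ → Fin 3 := fun i j => if P (pt i j) ∈ A then 0 else if P (pt i j) ∈ B then 1 else 2
  let S : Fin 3 → Set E := ![A, B, C]
  have hfS : ∀ i ≤ N, ∀ j ≤ N, P (pt i j) ∈ S (f i j) := by
    intro i hi j hj
    obtain ⟨⟨h1, h2⟩, h3, h4⟩ := hptQ i hi j hj
    have := hcov (1 - (pt i j).1) ((pt i j).1 * (1 - (pt i j).2)) ((pt i j).1 * (pt i j).2)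
      (by linarith) (mul_nonneg h1 (by linarith)) (mul_nonneg h1 h3) (by ring)
    change P (pt i j) ∈ _ at this
    by_cases ha : P (pt i j) ∈ A
    · simp [f, ha, S]
    · by_cases hb : P (pt i j) ∈ B
      · simp [f, ha, hb, S]
      · simp only [mem_union, ha, hb, false_or] at this
        simp [f, ha, hb, S, this]
  have h00 : ((0 : ℕ) : ℝ) / N = 0 := by simp
  have hNN : (N : ℝ) / N = 1 := div_self hNpos.ne'
  obtain ⟨i, hi, j, hj, hk⟩ := exists_square_of_labelling N f
    (fun j hj => by
      have ha : P (pt 0 j) ∈ A := by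
        have h1 := hcov 1 0 0 (by norm_num) (by norm_num) (by norm_num) (by norm_num)
        have h2 := hoppB 1 0 (by norm_num) (by norm_num) (by norm_num)
        have h3 := hoppC 1 0 (by norm_num) (by norm_num) (by norm_num)
        simp only [one_smul, zero_smul, add_zero] at h1 h2 h3
        have : P (pt 0 j) = a := by simp [P, pt]
        rw [this]
        simpa [h2, h3] using h1
      simp [f, ha])
    (fun j hj h => by
      have h1 := hfS N le_rfl j hj
      rw [h] at h1
      refine hoppA (1 - j / N) (j / N) (by linarith [(hfrac j hj).2]) (hfrac j hj).1 (by ring) ?_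
      simpa [P, pt, hNN, S] using h1)
    (fun i hi h => by
      have h1 := hfS i hi 0 (by omega)
      rw [h] at h1
      refine hoppC (1 - i / N) (i / N) (by linarith [(hfrac i hi).2]) (hfrac i hi).1 (by ring) ?_
      simpa [P, pt, S] using h1)
    (fun i hi h => by
      have h1 := hfS i hi N le_rfl
      rw [h] at h1
      refine hoppB (1 - i / N) (i / N) (by linarith [(hfrac i hi).2]) (hfrac i hi).1 (by ring) ?_
      simpa [P, pt, S, hNN] using h1)
  have hclose : ∀ i' j', (i' = i ∨ i' = i + 1) → (j' = j ∨ j' = j + 1) →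
      dist (P (pt i j)) (P (pt i' j')) < g p0 := by
    intro i' j' hi' hj'
    apply huc _ (hptQ i hi.le j hj.le) _ (hptQ i' (by omega) j' (by omega))
    have aux : ∀ m m' : ℕ, (m' = m ∨ m' = m + 1) → dist ((m : ℝ) / N) ((m' : ℝ) / N) < δ := by
      intro m m' hm
      rcases hm with rfl | rfl
      · simpa using hδ
      · rw [Real.dist_eq, ← sub_div, abs_div]
        push_cast
        have : |(n : ℝ) + 1| = n + 1 := abs_of_pos (by positivity)
        simpa [hN, this] using hn
    rw [Prod.dist_eq]
    exact max_lt (aux i i' hi') (aux j j' hj')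
  have hS : ∀ k, Metric.infDist (P (pt i j)) (S k) < g p0 := by
    intro k
    obtain ⟨i', j', hi', hj', hk'⟩ : ∃ i' j', (i' = i ∨ i' = i + 1) ∧ (j' = j ∨ j' = j + 1) ∧
        k = f i' j' := by
      rcases hk k with h | h | h | h
      exacts [⟨i, j, by simp, by simp, h⟩, ⟨i + 1, j, by simp, by simp, h⟩,
        ⟨i, j + 1, by simp, by simp, h⟩, ⟨i + 1, j + 1, by simp, by simp, h⟩]
    rw [hk']
    exact (Metric.infDist_le_dist_of_mem (hfS i' (by omega) j' (by omega))).trans_lt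
      (hclose i' j' hi' hj')
  have hmin := hp0 (hptQ i hi.le j hj.le)
  have : g (pt i j) < g p0 := max_lt (hS 0) (max_lt (hS 1) (hS 2))
  exact absurd hmin (not_le.2 this)

/-! ### Plane coordinates, unit cells, and tiles made of cells. -/

theorem Plane.norm_le (p : Plane) : ‖p‖ ≤ |p 0| + |p 1| := by
  rw [EuclideanSpace.norm_eq, Fin.sum_univ_two, Real.sqrt_le_left (by positivity)]
  simp only [Real.norm_eq_abs]
  nlinarith [abs_nonneg (p 0), abs_nonneg (p 1)]

theorem Plane.abs_apply_le (p : Plane) (i : Fin 2) : |p i| ≤ ‖p‖ := by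
  simpa using PiLp.norm_apply_le p i

theorem Plane.ext_coord {p q : Plane} (h0 : p 0 = q 0) (h1 : p 1 = q 1) : p = q := by
  ext i; fin_cases i <;> assumption

theorem Plane.dist_le (p q : Plane) : dist p q ≤ |p 0 - q 0| + |p 1 - q 1| := by
  simpa [dist_eq_norm] using Plane.norm_le (p - q)

theorem Plane.abs_sub_apply_le (p q : Plane) (i : Fin 2) : |p i - q i| ≤ dist p q := by
  simpa [dist_eq_norm] using Plane.abs_apply_le (p - q) i

@[simp] theorem latticePoint_zero (n : ℤ × ℤ) : latticePoint n 0 = n.1 := by simp [latticePoint]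
@[simp] theorem latticePoint_one (n : ℤ × ℤ) : latticePoint n 1 = n.2 := by simp [latticePoint]

theorem latticePoint_add (m n : ℤ × ℤ) :
    latticePoint (m + n) = latticePoint m + latticePoint n := by
  apply Plane.ext_coord <;> simp

theorem latticePoint_neg (n : ℤ × ℤ) : latticePoint (-n) = -latticePoint n := by
  apply Plane.ext_coord <;> simp

/-- The unit square with lower left corner `n`. -/
def cell (n : ℤ × ℤ) : Set Plane :=
  {p | (n.1 : ℝ) ≤ p 0 ∧ p 0 ≤ n.1 + 1 ∧ (n.2 : ℝ) ≤ p 1 ∧ p 1 ≤ n.2 + 1}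

theorem isClosed_cell (n : ℤ × ℤ) : IsClosed (cell n) := by
  have h0 : Continuous fun p : Plane => p 0 := by fun_prop
  have h1 : Continuous fun p : Plane => p 1 := by fun_prop
  exact (isClosed_le continuous_const h0).inter ((isClosed_le h0 continuous_const).inter
    ((isClosed_le continuous_const h1).inter (isClosed_le h1 continuous_const)))

theorem dist_latticePoint_le_of_mem_cell {n : ℤ × ℤ} {p : Plane} (h : p ∈ cell n) :
    dist p (latticePoint n) ≤ 2 := by
  obtain ⟨h1, h2, h3, h4⟩ := h
  refine (Plane.dist_le _ _).trans ?_
  rw [latticePoint_zero, latticePoint_one, abs_of_nonneg (by linarith), abs_of_nonneg (by linarith)]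
  linarith

theorem isCompact_cell (n : ℤ × ℤ) : IsCompact (cell n) :=
  Metric.isCompact_of_isClosed_isBounded (isClosed_cell n)
    (Metric.isBounded_closedBall.subset fun _ h => dist_latticePoint_le_of_mem_cell h)

theorem latticePoint_mem_cell (n : ℤ × ℤ) : latticePoint n ∈ cell n := by
  simp [cell]

theorem exists_mem_cell (p : Plane) : ∃ n, p ∈ cell n :=
  ⟨(⌊p 0⌋, ⌊p 1⌋), Int.floor_le _, (Int.lt_floor_add_one _).le, Int.floor_le _,
    (Int.lt_floor_add_one _).le⟩

theorem add_mem_cell_iff (m n : ℤ × ℤ) (p : Plane) :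
    p + latticePoint m ∈ cell (m + n) ↔ p ∈ cell n := by
  simp only [cell, mem_ofPred_eq, PiLp.add_apply, latticePoint_zero, latticePoint_one,
    Prod.fst_add, Prod.snd_add, Int.cast_add]
  constructor <;> rintro ⟨h1, h2, h3, h4⟩ <;> refine ⟨?_, ?_, ?_, ?_⟩ <;> linarith

/-- Every point is moved by the germ of the parabola into the interior of exactly one cell. -/
theorem eventually_mem_cell_iff (p : Plane) :
    ∀ᶠ ε : ℝ in 𝓝[>] 0, ∀ n : ℤ × ℤ, p + !₂[ε, ε ^ 2] ∈ cell n ↔ n = (⌊p 0⌋, ⌊p 1⌋) := by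
  have h0 : 0 < ⌊p 0⌋ + 1 - p 0 := by linarith [Int.lt_floor_add_one (p 0)]
  have h1 : 0 < ⌊p 1⌋ + 1 - p 1 := by linarith [Int.lt_floor_add_one (p 1)]
  have hmem : Ioo (0 : ℝ) (min (min (⌊p 0⌋ + 1 - p 0) (⌊p 1⌋ + 1 - p 1)) 1) ∈ 𝓝[>] (0 : ℝ) :=
    Ioo_mem_nhdsGT (by positivity)
  filter_upwards [hmem] with ε hε
  obtain ⟨hε0, hε1⟩ := hε
  simp only [lt_min_iff] at hε1
  obtain ⟨⟨ha, hb⟩, hc⟩ := hε1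
  have hsq : ε ^ 2 < ε := by nlinarith
  have hsq0 : 0 < ε ^ 2 := by positivity
  have e0 := Int.floor_le (p 0)
  have e1 := Int.floor_le (p 1)
  intro n
  simp only [cell, mem_ofPred_eq, PiLp.add_apply]
  simp only [Matrix.cons_val_zero, Matrix.cons_val_one, Prod.ext_iff]
  constructor
  · rintro ⟨q1, q2, q3, q4⟩
    refine ⟨?_, ?_⟩
    · apply le_antisymm
      · have : (n.1 : ℝ) < ⌊p 0⌋ + 1 := by linarith
        exact Int.lt_add_one_iff.1 (by exact_mod_cast this)
      · have : (⌊p 0⌋ : ℝ) < n.1 + 1 := by linarith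
        exact Int.lt_add_one_iff.1 (by exact_mod_cast this)
    · apply le_antisymm
      · have : (n.2 : ℝ) < ⌊p 1⌋ + 1 := by linarith
        exact Int.lt_add_one_iff.1 (by exact_mod_cast this)
      · have : (⌊p 1⌋ : ℝ) < n.2 + 1 := by linarith
        exact Int.lt_add_one_iff.1 (by exact_mod_cast this)
  · rintro ⟨q1, q2⟩
    rw [q1, q2]
    refine ⟨?_, ?_, ?_, ?_⟩ <;> linarith

theorem interior_cell_nonempty (n : ℤ × ℤ) : (interior (cell n)).Nonempty := by
  refine ⟨latticePoint n + !₂[1 / 2, 1 / 2], mem_interior.2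
    ⟨Metric.ball (latticePoint n + !₂[1 / 2, 1 / 2]) (1 / 2), ?_, Metric.isOpen_ball, by simp⟩⟩
  intro p hp
  rw [Metric.mem_ball] at hp
  have h0 := (Plane.abs_sub_apply_le p (latticePoint n + !₂[1 / 2, 1 / 2]) 0).trans hp.le
  have h1 := (Plane.abs_sub_apply_le p (latticePoint n + !₂[1 / 2, 1 / 2]) 1).trans hp.le
  rw [abs_le] at h0 h1
  simp at h0 h1
  refine ⟨?_, ?_, ?_, ?_⟩ <;> linarith

theorem convex_cell (n : ℤ × ℤ) : Convex ℝ (cell n) := by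
  rintro p ⟨a1, a2, a3, a4⟩ q ⟨b1, b2, b3, b4⟩ s t hs ht hst
  simp only [cell, mem_ofPred_eq, PiLp.add_apply, PiLp.smul_apply, smul_eq_mul]
  obtain rfl : s = 1 - t := by linarith
  refine ⟨?_, ?_, ?_, ?_⟩ <;> nlinarith

theorem cell_eq_convexHull (n : ℤ × ℤ) : ∃ v : Set Plane, v.Finite ∧ cell n = convexHull ℝ v := by
  set v : Set Plane := {!₂[(n.1 : ℝ), (n.2 : ℝ)], !₂[(n.1 : ℝ) + 1, (n.2 : ℝ)],
    !₂[(n.1 : ℝ), (n.2 : ℝ) + 1], !₂[(n.1 : ℝ) + 1, (n.2 : ℝ) + 1]} with hv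
  refine ⟨v, by simp [hv], subset_antisymm ?_ (convexHull_min ?_ (convex_cell n))⟩
  · rintro p ⟨h1, h2, h3, h4⟩
    have hc := convex_convexHull ℝ v
    have e1 : !₂[(n.1 : ℝ), (n.2 : ℝ)] ∈ convexHull ℝ v := subset_convexHull _ _ (by simp [hv])
    have e2 : !₂[(n.1 : ℝ) + 1, (n.2 : ℝ)] ∈ convexHull ℝ v := subset_convexHull _ _ (by simp [hv])
    have e3 : !₂[(n.1 : ℝ), (n.2 : ℝ) + 1] ∈ convexHull ℝ v := subset_convexHull _ _ (by simp [hv])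
    have e4 : !₂[(n.1 : ℝ) + 1, (n.2 : ℝ) + 1] ∈ convexHull ℝ v :=
      subset_convexHull _ _ (by simp [hv])
    have f1 := hc e1 e2 (a := 1 - (p 0 - n.1)) (b := p 0 - n.1) (by linarith) (by linarith) (by ring)
    have f2 := hc e3 e4 (a := 1 - (p 0 - n.1)) (b := p 0 - n.1) (by linarith) (by linarith) (by ring)
    have f3 := hc f1 f2 (a := 1 - (p 1 - n.2)) (b := p 1 - n.2) (by linarith) (by linarith) (by ring)
    convert f3 using 1
    apply Plane.ext_coord <;> simp <;> ring
  · rintro p hp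
    simp only [hv, mem_insert_iff, mem_singleton_iff] at hp
    rcases hp with rfl | rfl | rfl | rfl <;> simp [cell]

/-- The union of the cells labelled `a`. -/
def tile {α : Type*} (f : ℤ × ℤ → α) (a : α) : Set Plane := ⋃ n ∈ f ⁻¹' {a}, cell n

/-- The collection of the tiles of a labelling of the cells. -/
def tiling {α : Type*} (f : ℤ × ℤ → α) : Set (Set Plane) := tile f '' range f

variable {α : Type*} {f : ℤ × ℤ → α}

theorem mem_tile {a : α} {p : Plane} : p ∈ tile f a ↔ ∃ n, f n = a ∧ p ∈ cell n := by
  simp [tile]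

theorem tile_mem_tiling (f : ℤ × ℤ → α) (n : ℤ × ℤ) : tile f (f n) ∈ tiling f := ⟨f n, ⟨n, rfl⟩, rfl⟩

theorem memPrime_tile_iff {a : α} {p : Plane} :
    MemPrime p (tile f a) ↔ f (⌊p 0⌋, ⌊p 1⌋) = a := by
  have h := eventually_mem_cell_iff p
  constructor
  · intro hp
    obtain ⟨ε, h1, h2⟩ := (h.and hp).exists
    obtain ⟨n, hn, hn'⟩ := mem_tile.1 h2
    rwa [← (h1 n).1 hn']
  · intro hp
    filter_upwards [h] with ε hε
    exact mem_tile.2 ⟨_, hp, (hε _).2 rfl⟩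

/-- The parabola from a lattice point enters the cell with that lower left corner, so counting
lattice points of a tile is counting its cells. -/
theorem latticeIn_tile (a : α) : latticeIn (tile f a) = f ⁻¹' {a} := by
  ext n
  simp [latticeIn, memPrime_tile_iff]

theorem MemPrime.of_isOpen {p : Plane} {O : Set Plane} (hO : IsOpen O) (hp : p ∈ O) :
    MemPrime p O := by
  have hc : Continuous fun ε : ℝ => p + !₂[ε, ε ^ 2] := by fun_prop
  have h0 : p + !₂[(0 : ℝ), (0 : ℝ) ^ 2] ∈ O := by
    convert hp
    apply Plane.ext_coord <;> simp
  exact (hc.continuousAt.eventually (hO.mem_nhds h0)).filter_mono nhdsWithin_le_nhds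

/-- A common interior point would satisfy `MemPrime` for both tiles, yet the parabola from it enters
a single cell, which has a single label. -/
theorem disjoint_interior_tile {a b : α} (hab : a ≠ b) :
    Disjoint (interior (tile f a)) (interior (tile f b)) := by
  rw [Set.disjoint_left]
  intro p ha hb
  have h1 : MemPrime p (tile f a) := (MemPrime.of_isOpen isOpen_interior ha).mono
    fun _ h => interior_subset h
  have h2 : MemPrime p (tile f b) := (MemPrime.of_isOpen isOpen_interior hb).mono
    fun _ h => interior_subset h
  exact hab ((memPrime_tile_iff.1 h1).symm.trans (memPrime_tile_iff.1 h2))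

theorem isCompact_tile {a : α} (h : (f ⁻¹' {a}).Finite) : IsCompact (tile f a) :=
  h.isCompact_biUnion fun n _ => isCompact_cell n

theorem isPolygonalRegion_tile {a : α} (h : (f ⁻¹' {a}).Finite) : IsPolygonalRegion (tile f a) :=
  ⟨cell '' (f ⁻¹' {a}), h.image _, by simp [tile, sUnion_image], by
    rintro c ⟨n, -, rfl⟩
    exact ⟨interior_cell_nonempty n, cell_eq_convexHull n⟩⟩

theorem sUnion_tiling (f : ℤ × ℤ → α) : ⋃₀ tiling f = univ := by
  refine eq_univ_of_forall fun p => ?_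
  obtain ⟨n, hn⟩ := exists_mem_cell p
  exact ⟨_, tile_mem_tiling f n, mem_tile.2 ⟨n, rfl, hn⟩⟩

theorem encard_lattice_closedBall_le (z : Plane) (C : ℕ) :
    {n : ℤ × ℤ | dist (latticePoint n) z ≤ C}.encard ≤ (((2 * C + 1) ^ 2 : ℕ) : ℕ∞) := by
  have hsub : {n : ℤ × ℤ | dist (latticePoint n) z ≤ C} ⊆
      ((Finset.Icc ⌈z 0 - C⌉ ⌊z 0 + C⌋ ×ˢ Finset.Icc ⌈z 1 - C⌉ ⌊z 1 + C⌋ : Finset (ℤ × ℤ)) :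
        Set (ℤ × ℤ)) := by
    intro n hn
    have h0 := (Plane.abs_sub_apply_le (latticePoint n) z 0).trans hn
    have h1 := (Plane.abs_sub_apply_le (latticePoint n) z 1).trans hn
    rw [abs_le, latticePoint_zero] at h0
    rw [abs_le, latticePoint_one] at h1
    simp only [Finset.coe_product, Finset.coe_Icc, mem_prod, mem_Icc, Int.ceil_le, Int.le_floor]
    refine ⟨⟨?_, ?_⟩, ?_, ?_⟩ <;> linarith
  refine (encard_le_encard hsub).trans ?_
  rw [encard_coe_eq_coe_finsetCard, Finset.card_product, sq]
  have key : ∀ t : ℝ, (Finset.Icc ⌈t - C⌉ ⌊t + C⌋).card ≤ 2 * C + 1 := by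
    intro t
    rw [Int.card_Icc, Int.toNat_le]
    have h1 := Int.le_ceil (t - C)
    have h2 := Int.floor_le (t + C)
    have : ((⌊t + C⌋ + 1 - ⌈t - C⌉ : ℤ) : ℝ) ≤ ((2 * C + 1 : ℕ) : ℤ) := by push_cast; linarith
    exact_mod_cast this
  exact_mod_cast Nat.mul_le_mul (key _) (key _)

theorem le_encard_lattice_closedBall (z : Plane) (a : ℕ) :
    ((a ^ 2 : ℕ) : ℕ∞) ≤ {n : ℤ × ℤ | dist (latticePoint n) z ≤ 2 * a + 2}.encard := by
  have hsub : ((Finset.Ico ⌊z 0⌋ (⌊z 0⌋ + a) ×ˢ Finset.Ico ⌊z 1⌋ (⌊z 1⌋ + a) : Finset (ℤ × ℤ)) :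
        Set (ℤ × ℤ)) ⊆ {n : ℤ × ℤ | dist (latticePoint n) z ≤ 2 * a + 2} := by
    intro n hn
    simp only [Finset.coe_product, Finset.coe_Ico, mem_prod, mem_Ico] at hn
    obtain ⟨⟨h1, h2⟩, h3, h4⟩ := hn
    have g1 : (⌊z 0⌋ : ℝ) ≤ n.1 := by exact_mod_cast h1
    have g2 : (n.1 : ℝ) < ⌊z 0⌋ + a := by exact_mod_cast h2
    have g3 : (⌊z 1⌋ : ℝ) ≤ n.2 := by exact_mod_cast h3
    have g4 : (n.2 : ℝ) < ⌊z 1⌋ + a := by exact_mod_cast h4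
    have e1 := Int.floor_le (z 0)
    have e2 := Int.lt_floor_add_one (z 0)
    have e3 := Int.floor_le (z 1)
    have e4 := Int.lt_floor_add_one (z 1)
    refine (Plane.dist_le _ _).trans ?_
    rw [latticePoint_zero, latticePoint_one]
    have i1 : |(n.1 : ℝ) - z 0| ≤ a + 1 := abs_le.2 ⟨by linarith, by linarith⟩
    have i2 : |(n.2 : ℝ) - z 1| ≤ a + 1 := abs_le.2 ⟨by linarith, by linarith⟩
    linarith
  refine le_trans ?_ (encard_le_encard hsub)
  rw [encard_coe_eq_coe_finsetCard, Finset.card_product]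
  simp [sq]

/-! ### Fat triangulations in abstract form. -/

/-- A triangulation of the plane with vertex positions `b`, barycentric coordinates `Λ`, triangles
`Tri` and a choice `lab` of a largest barycentric coordinate. The triangles have side lengths at
most `100 / L` and are fat, in that the coordinates are `L`-Lipschitz. The underlying complex is a
flag complex coloured by three ranks in which each edge is in exactly two triangles. -/
structure FatTriangulation (I : Type*) (L : ℝ) (E : ℕ) where
  b : I → Plane
  Λ : I → Plane → ℝ
  lab : Plane → I
  Tri : I → I → I → Prop
  rank : I → Fin 3
  swap₁₂ : ∀ {i j k}, Tri i j k → Tri j i k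
  swap₂₃ : ∀ {i j k}, Tri i j k → Tri i k j
  rank_ne : ∀ {i j k}, Tri i j k → rank i ≠ rank j
  cover : ∀ y, ∃ i j k, Tri i j k ∧ ∃ u v w : ℝ, 0 ≤ u ∧ 0 ≤ v ∧ 0 ≤ w ∧ u + v + w = 1 ∧
    y = u • b i + v • b j + w • b k
  coord_self : ∀ {i j k}, Tri i j k → ∀ {u v w : ℝ}, 0 ≤ u → 0 ≤ v → 0 ≤ w → u + v + w = 1 →
    Λ i (u • b i + v • b j + w • b k) = u
  coord_other : ∀ {i j k}, Tri i j k → ∀ {u v w : ℝ}, 0 ≤ u → 0 ≤ v → 0 ≤ w → u + v + w = 1 →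
    ∀ m, m ≠ i → m ≠ j → m ≠ k → Λ m (u • b i + v • b j + w • b k) = 0
  lip : ∀ i x y, |Λ i x - Λ i y| ≤ L * dist x y
  lab_max : ∀ x i, Λ i x ≤ Λ (lab x) x
  flag : ∀ {i j k}, (∃ m, Tri i j m) → (∃ m, Tri j k m) → (∃ m, Tri i k m) → Tri i j k
  two : ∀ {i j}, (∃ k, Tri i j k) → {k | Tri i j k}.encard = 2
  deg : ∀ i, {j | ∃ k, Tri i j k}.encard ≤ E
  side : ∀ {i j k}, Tri i j k → dist (b i) (b j) ≤ 100 / L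

namespace FatTriangulation

variable {I : Type*} {L : ℝ} {E : ℕ} (𝒯 : FatTriangulation I L E) {i j k m : I} {x y : Plane}

section Static

theorem ne (h : 𝒯.Tri i j k) : i ≠ j ∧ i ≠ k ∧ j ≠ k :=
  ⟨fun e => 𝒯.rank_ne h (by rw [e]), fun e => 𝒯.rank_ne (𝒯.swap₂₃ h) (by rw [e]),
    fun e => 𝒯.rank_ne (𝒯.swap₂₃ (𝒯.swap₁₂ h)) (by rw [e])⟩

theorem rot (h : 𝒯.Tri i j k) : 𝒯.Tri j k i := 𝒯.swap₂₃ (𝒯.swap₁₂ h)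

/-- `y` has barycentric coordinates `u v w` in the triangle `i j k`. -/
structure At (i j k : I) (u v w : ℝ) (y : Plane) : Prop where
  tri : 𝒯.Tri i j k
  hu : 0 ≤ u
  hv : 0 ≤ v
  hw : 0 ≤ w
  sum : u + v + w = 1
  eq : y = u • 𝒯.b i + v • 𝒯.b j + w • 𝒯.b k

variable {𝒯} {u v w : ℝ}

theorem At.swap₁₂ (h : 𝒯.At i j k u v w y) : 𝒯.At j i k v u w y :=
  ⟨𝒯.swap₁₂ h.tri, h.hv, h.hu, h.hw, by linarith [h.sum], by rw [h.eq]; abel⟩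

theorem At.rot (h : 𝒯.At i j k u v w y) : 𝒯.At j k i v w u y :=
  ⟨𝒯.rot h.tri, h.hv, h.hw, h.hu, by linarith [h.sum], by rw [h.eq]; abel⟩

theorem At.coord₁ (h : 𝒯.At i j k u v w y) : 𝒯.Λ i y = u := by
  rw [h.eq]; exact 𝒯.coord_self h.tri h.hu h.hv h.hw h.sum

theorem At.coord₂ (h : 𝒯.At i j k u v w y) : 𝒯.Λ j y = v := h.rot.coord₁

theorem At.coord₃ (h : 𝒯.At i j k u v w y) : 𝒯.Λ k y = w := h.rot.coord₂

theorem At.coord_other (h : 𝒯.At i j k u v w y) (h1 : m ≠ i) (h2 : m ≠ j) (h3 : m ≠ k) :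
    𝒯.Λ m y = 0 := by
  rw [h.eq]; exact 𝒯.coord_other h.tri h.hu h.hv h.hw h.sum m h1 h2 h3

variable (𝒯) in
theorem exists_at (y : Plane) : ∃ i j k u v w, 𝒯.At i j k u v w y := by
  obtain ⟨i, j, k, ht, u, v, w, hu, hv, hw, hs, he⟩ := 𝒯.cover y
  exact ⟨i, j, k, u, v, w, ht, hu, hv, hw, hs, he⟩

theorem exists_at_of_pos (hi : 0 < 𝒯.Λ i y) : ∃ j k u v w, 𝒯.At i j k u v w y := by
  obtain ⟨a, b, c, u, v, w, h⟩ := 𝒯.exists_at y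
  by_cases h1 : i = a
  · exact h1 ▸ ⟨_, _, _, _, _, h⟩
  by_cases h2 : i = b
  · exact h2 ▸ ⟨_, _, _, _, _, h.rot⟩
  by_cases h3 : i = c
  · exact h3 ▸ ⟨_, _, _, _, _, h.rot.rot⟩
  rw [h.coord_other h1 h2 h3] at hi
  exact absurd hi (lt_irrefl 0)

theorem exists_at_of_pos₂ (hij : i ≠ j) (hi : 0 < 𝒯.Λ i y) (hj : 0 < 𝒯.Λ j y) :
    ∃ k u v w, 𝒯.At i j k u v w y := by
  obtain ⟨b, c, u, v, w, h⟩ := exists_at_of_pos hi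
  by_cases h2 : j = b
  · exact h2 ▸ ⟨_, _, _, _, h⟩
  by_cases h3 : j = c
  · exact h3 ▸ ⟨_, _, _, _, h.rot.rot.swap₁₂⟩
  rw [h.coord_other hij.symm h2 h3] at hj
  exact absurd hj (lt_irrefl 0)

theorem tri_of_pos (hij : i ≠ j) (hik : i ≠ k) (hjk : j ≠ k) (hi : 0 < 𝒯.Λ i y)
    (hj : 0 < 𝒯.Λ j y) (hk : 0 < 𝒯.Λ k y) : 𝒯.Tri i j k := by
  obtain ⟨c, u, v, w, h⟩ := exists_at_of_pos₂ hij hi hj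
  by_cases h3 : k = c
  · exact h3 ▸ h.tri
  rw [h.coord_other hik.symm hjk.symm h3] at hk
  exact absurd hk (lt_irrefl 0)

theorem eq_of_pos_of_tri (h : 𝒯.Tri i j k) (hi : 0 < 𝒯.Λ i y) (hj : 0 < 𝒯.Λ j y)
    (hk : 0 < 𝒯.Λ k y) (hm : 0 < 𝒯.Λ m y) : m = i ∨ m = j ∨ m = k := by
  obtain ⟨c, u, v, w, h'⟩ := exists_at_of_pos₂ (𝒯.ne h).1 hi hj
  by_contra hcon
  push Not at hcon
  by_cases h3 : k = c
  · subst h3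
    rw [h'.coord_other hcon.1 hcon.2.1 hcon.2.2] at hm
    exact lt_irrefl 0 hm
  · rw [h'.coord_other (𝒯.ne h).2.1.symm (𝒯.ne h).2.2.symm h3] at hk
    exact lt_irrefl 0 hk

theorem third_le_lab (y : Plane) : 1 / 3 ≤ 𝒯.Λ (𝒯.lab y) y := by
  obtain ⟨a, b, c, u, v, w, h⟩ := 𝒯.exists_at y
  have h1 := 𝒯.lab_max y a
  have h2 := 𝒯.lab_max y b
  have h3 := 𝒯.lab_max y c
  rw [h.coord₁] at h1
  rw [h.coord₂] at h2
  rw [h.coord₃] at h3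
  linarith [h.sum]

theorem norm_sub_le (h : 𝒯.Tri i j k) (β γ : ℝ) :
    ‖β • (𝒯.b i - 𝒯.b j) + γ • (𝒯.b k - 𝒯.b j)‖ ≤ (|β| + |γ|) * (100 / L) := by
  refine (norm_add_le _ _).trans ?_
  rw [norm_smul, norm_smul, Real.norm_eq_abs, Real.norm_eq_abs, add_mul, ← dist_eq_norm,
    ← dist_eq_norm]
  gcongr
  · exact 𝒯.side h
  · exact 𝒯.side (𝒯.rot (𝒯.rot (𝒯.swap₁₂ h)))

/-- Two points of a triangle are close if their coordinates are. -/
theorem At.dist_le {u' v' w' : ℝ} (h : 𝒯.At i j k u v w x) (h' : 𝒯.At i j k u' v' w' y) :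
    dist x y ≤ (|u - u'| + |w - w'|) * (100 / L) := by
  have e : x - y = (u - u') • (𝒯.b i - 𝒯.b j) + (w - w') • (𝒯.b k - 𝒯.b j) := by
    rw [h.eq, h'.eq]
    obtain rfl : v = 1 - u - w := by linarith [h.sum]
    obtain rfl : v' = 1 - u' - w' := by linarith [h'.sum]
    module
  rw [dist_eq_norm, e]
  exact norm_sub_le h.tri _ _

theorem at_vertex (h : 𝒯.Tri i j k) : 𝒯.At i j k 1 0 0 (𝒯.b i) :=
  ⟨h, by norm_num, by norm_num, by norm_num, by norm_num, by simp⟩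

theorem at_mk (h : 𝒯.Tri i j k) (hu : 0 ≤ u) (hv : 0 ≤ v) (hw : 0 ≤ w) (hs : u + v + w = 1) :
    𝒯.At i j k u v w (u • 𝒯.b i + v • 𝒯.b j + w • 𝒯.b k) := ⟨h, hu, hv, hw, hs, rfl⟩

theorem dist_vertex_le (hL : 0 < L) (hi : 0 < 𝒯.Λ i y) : dist y (𝒯.b i) ≤ 100 / L := by
  obtain ⟨j, k, u, v, w, h⟩ := exists_at_of_pos hi
  have hc : y ∈ Metric.closedBall (𝒯.b i) (100 / L) := by
    have hcv := convex_closedBall (𝒯.b i) (100 / L)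
    rw [h.eq]
    refine hcv.sum_mem (t := Finset.univ) (w := ![u, v, w]) (z := ![𝒯.b i, 𝒯.b j, 𝒯.b k])
      ?_ ?_ ?_ |> fun H => by simpa [Fin.sum_univ_three, add_assoc] using H
    · intro a _; fin_cases a <;> simp [h.hu, h.hv, h.hw]
    · simpa [Fin.sum_univ_three] using h.sum
    · intro a _
      have h1 := 𝒯.side (𝒯.swap₁₂ h.tri)
      have h2 := 𝒯.side (𝒯.swap₁₂ (𝒯.swap₂₃ h.tri))
      fin_cases a
      · simp; positivity
      · simpa using h1
      · simpa using h2
  exact hc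

/-- Of four vertices, two are not adjacent. -/
theorem not_four {i j k m : I} (hij : ∃ a, 𝒯.Tri i j a) (hik : ∃ a, 𝒯.Tri i k a)
    (him : ∃ a, 𝒯.Tri i m a) (hjk : ∃ a, 𝒯.Tri j k a) (hjm : ∃ a, 𝒯.Tri j m a)
    (hkm : ∃ a, 𝒯.Tri k m a) : False := by
  have h1 := 𝒯.rank_ne hij.choose_spec
  have h2 := 𝒯.rank_ne hik.choose_spec
  have h3 := 𝒯.rank_ne him.choose_spec
  have h4 := 𝒯.rank_ne hjk.choose_spec
  have h5 := 𝒯.rank_ne hjm.choose_spec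
  have h6 := 𝒯.rank_ne hkm.choose_spec
  generalize 𝒯.rank i = a at *
  generalize 𝒯.rank j = b at *
  generalize 𝒯.rank k = c at *
  generalize 𝒯.rank m = d at *
  omega

end Static

/-! ### The tiles of a labelling as perturbed regions of largest coordinate. -/

/-- A labelling of the cells by the vertices of the triangulation, obtained from displaced
reference points of the cells. -/
def label (𝒯 : FatTriangulation I L E) (q : ℤ × ℤ → Plane) (n : ℤ × ℤ) : I := 𝒯.lab (q n)

section Label

variable {𝒯} {q : ℤ × ℤ → Plane} {D : ℝ} {u v w : ℝ}

theorem dist_ref_le (hq : ∀ n, dist (q n) (latticePoint n) ≤ D) {n : ℤ × ℤ} (hy : y ∈ cell n) :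
    dist y (q n) ≤ D + 2 := by
  have h1 := dist_triangle_right y (q n) (latticePoint n)
  linarith [dist_latticePoint_le_of_mem_cell hy, hq n]

variable (hL : 0 < L) (hq : ∀ n, dist (q n) (latticePoint n) ≤ D)
include hL hq

theorem abs_coord_sub_le (m : I) {n : ℤ × ℤ} (hy : y ∈ cell n) :
    |𝒯.Λ m y - 𝒯.Λ m (q n)| ≤ L * (D + 2) :=
  (𝒯.lip m y (q n)).trans (mul_le_mul_of_nonneg_left (dist_ref_le hq hy) hL.le)

/-- At the reference point of the cell the inequality has no error; moving to `y` costs `L * (D +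
2)` for each of the two coordinates. All later thresholds are measured against this error. -/
theorem coord_le_of_mem_tile (hy : y ∈ tile (𝒯.label q) i) (m : I) :
    𝒯.Λ m y ≤ 𝒯.Λ i y + 2 * (L * (D + 2)) := by
  obtain ⟨n, rfl, hn⟩ := mem_tile.1 hy
  have h1 := abs_le.1 (abs_coord_sub_le (𝒯 := 𝒯) hL hq m hn)
  have h2 := abs_le.1 (abs_coord_sub_le (𝒯 := 𝒯) hL hq (𝒯.label q n) hn)
  have h3 := 𝒯.lab_max (q n) m
  change _ ≤ 𝒯.Λ (𝒯.label q n) _ at h3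
  linarith

theorem third_sub_le_of_mem_tile (hy : y ∈ tile (𝒯.label q) i) :
    1 / 3 - L * (D + 2) ≤ 𝒯.Λ i y := by
  obtain ⟨n, rfl, hn⟩ := mem_tile.1 hy
  have h2 := abs_le.1 (abs_coord_sub_le (𝒯 := 𝒯) hL hq (𝒯.label q n) hn)
  have h3 := 𝒯.third_le_lab (q n)
  change _ ≤ 𝒯.Λ (𝒯.label q n) _ at h3
  linarith

theorem label_eq_of_forall_lt (h : ∀ m, m ≠ i → 𝒯.Λ m y + 2 * (L * (D + 2)) < 𝒯.Λ i y)
    {n : ℤ × ℤ} (hy : y ∈ cell n) : 𝒯.label q n = i := by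
  by_contra hne
  have := coord_le_of_mem_tile (𝒯 := 𝒯) hL hq (mem_tile.2 ⟨n, rfl, hy⟩) i
  linarith [h _ hne]

theorem mem_tile_of_forall_lt (h : ∀ m, m ≠ i → 𝒯.Λ m y + 2 * (L * (D + 2)) < 𝒯.Λ i y) :
    y ∈ tile (𝒯.label q) i := by
  obtain ⟨n, hn⟩ := exists_mem_cell y
  exact mem_tile.2 ⟨n, label_eq_of_forall_lt hL hq h hn, hn⟩

variable (hs : L * (D + 2) ≤ 1 / 1000)

omit hL hq in
theorem coord_pos_label (n : ℤ × ℤ) : 0 < 𝒯.Λ (𝒯.label q n) (q n) := by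
  have := 𝒯.third_le_lab (q n)
  change _ ≤ 𝒯.Λ (𝒯.label q n) _ at this
  linarith

theorem dist_latticePoint_le_of_label {n : ℤ × ℤ} (h : 𝒯.label q n = i) :
    dist (latticePoint n) (𝒯.b i) ≤ D + 100 / L := by
  have h1 := dist_vertex_le hL (h ▸ coord_pos_label (𝒯 := 𝒯) (q := q) n)
  have h2 := dist_triangle_left (latticePoint n) (𝒯.b i) (q n)
  linarith [hq n]

theorem finite_label (i : I) : (𝒯.label q ⁻¹' {i}).Finite := by
  obtain ⟨C, hC⟩ := exists_nat_ge (D + 100 / L)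
  refine (finite_of_encard_le_coe (encard_lattice_closedBall_le (𝒯.b i) C)).subset ?_
  intro n hn
  exact (dist_latticePoint_le_of_label hL hq hn).trans hC

theorem isClosed_tile (i : I) : IsClosed (tile (𝒯.label q) i) :=
  (isCompact_tile (finite_label hL hq i)).isClosed

include hs

theorem pos_of_mem_tile (hy : y ∈ tile (𝒯.label q) i) : 0 < 𝒯.Λ i y := by
  linarith [third_sub_le_of_mem_tile hL hq hy]

-- At the vertex the coordinates are `1` and `0`. Within distance `1 / (8 * L)` they remain at least
-- `7 / 8` and at most `1 / 8`, a gap well beyond the error `2 / 1000`.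
omit hL hq in
theorem coord_lt_of_dist_vertex (h : ∃ j k, 𝒯.Tri i j k) (hy : L * dist y (𝒯.b i) ≤ 1 / 8) :
    ∀ m, m ≠ i → 𝒯.Λ m y + 2 * (L * (D + 2)) < 𝒯.Λ i y := by
  intro m hm
  obtain ⟨j, k, h⟩ := h
  have h1 := abs_le.1 (𝒯.lip i y (𝒯.b i))
  have h2 := abs_le.1 (𝒯.lip m y (𝒯.b i))
  have ha := at_vertex h
  rw [ha.coord₁] at h1
  have h0 : 𝒯.Λ m (𝒯.b i) = 0 := by
    by_cases e2 : m = j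
    · rw [e2, ha.coord₂]
    by_cases e3 : m = k
    · rw [e3, ha.coord₃]
    exact ha.coord_other hm e2 e3
  rw [h0] at h2
  linarith

theorem mem_tile_vertex (h : 𝒯.Tri i j k) : 𝒯.b i ∈ tile (𝒯.label q) i := by
  exact mem_tile_of_forall_lt hL hq (coord_lt_of_dist_vertex hs ⟨j, k, h⟩ (by simp))

theorem eq_of_vertex_mem_tile (h : 𝒯.Tri i j k) (hm : 𝒯.b i ∈ tile (𝒯.label q) m) : m = i := by
  have hp := pos_of_mem_tile hL hq hs hm
  have ha := at_vertex h
  by_contra hmi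
  by_cases h2 : m = j
  · rw [h2, ha.coord₂] at hp; exact lt_irrefl _ hp
  by_cases h3 : m = k
  · rw [h3, ha.coord₃] at hp; exact lt_irrefl _ hp
  rw [ha.coord_other hmi h2 h3] at hp; exact lt_irrefl _ hp

omit hL hq hs in
theorem vertex_label (n : ℤ × ℤ) : ∃ j k, 𝒯.Tri (𝒯.label q n) j k := by
  obtain ⟨j, k, u, v, w, h⟩ := exists_at_of_pos (coord_pos_label (𝒯 := 𝒯) (q := q) n)
  exact ⟨j, k, h.tri⟩

theorem tri_of_mem_tile (hij : i ≠ j) (hik : i ≠ k) (hjk : j ≠ k)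
    (h1 : y ∈ tile (𝒯.label q) i) (h2 : y ∈ tile (𝒯.label q) j) (h3 : y ∈ tile (𝒯.label q) k) :
    𝒯.Tri i j k :=
  tri_of_pos hij hik hjk (pos_of_mem_tile hL hq hs h1) (pos_of_mem_tile hL hq hs h2)
    (pos_of_mem_tile hL hq hs h3)

theorem adj_of_mem_tile (hij : i ≠ j)
    (h1 : y ∈ tile (𝒯.label q) i) (h2 : y ∈ tile (𝒯.label q) j) : ∃ k, 𝒯.Tri i j k := by
  obtain ⟨k, u, v, w, h⟩ := exists_at_of_pos₂ hij (pos_of_mem_tile hL hq hs h1)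
    (pos_of_mem_tile hL hq hs h2)
  exact ⟨k, h.tri⟩

/-- A tile lies in the open star of its vertex. Hence on a triangle only the three tiles of its
vertices occur, and none of them reaches the opposite edge: the situation of
`exists_mem_inter_of_triangle`. -/
theorem exists_mem_tile_inter (h : 𝒯.Tri i j k) :
    (tile (𝒯.label q) i ∩ tile (𝒯.label q) j ∩ tile (𝒯.label q) k).Nonempty := by
  have hcov : ∀ {a b c u v w y}, 𝒯.At a b c u v w y → 
      y ∈ tile (𝒯.label q) a ∪ tile (𝒯.label q) b ∪ tile (𝒯.label q) c := by
    intro a b c u v w y hy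
    obtain ⟨n, hn⟩ := exists_mem_cell y
    have hmem : y ∈ tile (𝒯.label q) (𝒯.label q n) := mem_tile.2 ⟨n, rfl, hn⟩
    have hpos := pos_of_mem_tile hL hq hs hmem
    by_cases h1 : 𝒯.label q n = a
    · exact .inl (.inl (h1 ▸ hmem))
    by_cases h2 : 𝒯.label q n = b
    · exact .inl (.inr (h2 ▸ hmem))
    by_cases h3 : 𝒯.label q n = c
    · exact .inr (h3 ▸ hmem)
    rw [hy.coord_other h1 h2 h3] at hpos
    exact absurd hpos (lt_irrefl 0)
  have hopp : ∀ {a b c v w y}, 𝒯.At a b c 0 v w y → y ∉ tile (𝒯.label q) a := by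
    intro a b c v w y hy hmem
    have hpos := pos_of_mem_tile hL hq hs hmem
    rw [hy.coord₁] at hpos
    exact lt_irrefl 0 hpos
  refine exists_mem_inter_of_triangle (isClosed_tile hL hq i) (isClosed_tile hL hq j)
    (isClosed_tile hL hq k) (𝒯.b i) (𝒯.b j) (𝒯.b k) ?_ ?_ ?_ ?_
  · intro u v w hu hv hw hsum
    exact hcov (at_mk h hu hv hw hsum)
  · intro v w hv hw hsum
    exact hopp ⟨h, le_rfl, hv, hw, by linarith, by simp⟩
  · intro u w hu hw hsum
    exact hopp ⟨𝒯.rot h, le_rfl, hw, hu, by linarith, by simp; abel⟩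
  · intro u v hu hv hsum
    exact hopp ⟨𝒯.rot (𝒯.rot h), le_rfl, hu, hv, by linarith, by simp⟩

theorem tile_injective (h : 𝒯.Tri i j k) (he : tile (𝒯.label q) i = tile (𝒯.label q) m) :
    m = i :=
  eq_of_vertex_mem_tile hL hq hs h (he ▸ mem_tile_vertex hL hq hs h)

theorem tile_mem (h : 𝒯.Tri i j k) : tile (𝒯.label q) i ∈ tiling (𝒯.label q) := by
  obtain ⟨n, hn, -⟩ := mem_tile.1 (mem_tile_vertex (q := q) hL hq hs h)
  exact hn ▸ tile_mem_tiling _ _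

omit hL hq hs in
theorem exists_eq_tile {t : Set Plane} (ht : t ∈ tiling (𝒯.label q)) :
    ∃ i, t = tile (𝒯.label q) i ∧ ∃ j k, 𝒯.Tri i j k := by
  obtain ⟨_, ⟨n, rfl⟩, rfl⟩ := ht
  exact ⟨_, rfl, vertex_label n⟩

end Label

end FatTriangulation
-- The nerve of the tiling is the triangulation.
namespace FatTriangulation

variable {I : Type*} {L : ℝ} {E : ℕ} {𝒯 : FatTriangulation I L E} {i j k m : I} {x y : Plane}
  {q : ℤ × ℤ → Plane} {D : ℝ} {u v w : ℝ}
variable (hL : 0 < L) (hq : ∀ n, dist (q n) (latticePoint n) ≤ D) (hs : L * (D + 2) ≤ 1 / 1000)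
include hL hq hs

/-- Suppose `s₀` is a tile outside `S`. If `S` is one tile, its vertex lies in no other tile.
Otherwise `S` consists of the two tiles of an edge, since four tiles never meet; the edge lies in a
second triangle, and the common point of the tiles of that triangle would also be in `s₀`, which
again makes four. -/
theorem eq_of_sInter_subset {S : Set (Set Plane)} {s₀ : Set Plane} (hS : S ⊆ tiling (𝒯.label q))
    (h₀ : s₀ ∈ tiling (𝒯.label q)) (hne : S.Nonempty) (hi : (⋂₀ S).Nonempty) (hsub : ⋂₀ S ⊆ s₀) :
    s₀ ∈ S := by
  by_contra hnot
  obtain ⟨y, hy⟩ := hi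
  obtain ⟨t, ht⟩ := hne
  obtain ⟨i, rfl, ji, ki, hti⟩ := exists_eq_tile (hS ht)
  obtain ⟨m, rfl, jm, km, htm⟩ := exists_eq_tile h₀
  have him : i ≠ m := fun e => hnot (e ▸ ht)
  by_cases hall : ∀ s ∈ S, s = tile (𝒯.label q) i
  · have hmem : 𝒯.b i ∈ ⋂₀ S := fun s hs' => hall s hs' ▸ mem_tile_vertex hL hq hs hti
    exact him (eq_of_vertex_mem_tile hL hq hs hti (hsub hmem)).symm
  · push Not at hall
    obtain ⟨s, hsS, hsi⟩ := hall
    obtain ⟨j, rfl, jj, kj, htj⟩ := exists_eq_tile (hS hsS)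
    have hij : i ≠ j := fun e => hsi (e ▸ rfl)
    have hjm : j ≠ m := fun e => hnot (e ▸ hsS)
    have htri := tri_of_mem_tile hL hq hs hij him hjm (hy _ ht) (hy _ hsS) (hsub hy)
    have hall : ∀ s ∈ S, s = tile (𝒯.label q) i ∨ s = tile (𝒯.label q) j := by
      intro s hs'
      obtain ⟨a, rfl, -⟩ := exists_eq_tile (hS hs')
      rcases eq_of_pos_of_tri htri (pos_of_mem_tile hL hq hs (hy _ ht))
        (pos_of_mem_tile hL hq hs (hy _ hsS)) (pos_of_mem_tile hL hq hs (hsub hy))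
        (pos_of_mem_tile hL hq hs (hy _ hs')) with h | h | h
      · exact .inl (h ▸ rfl)
      · exact .inr (h ▸ rfl)
      · exact absurd (h ▸ hs') hnot
    have h2 := 𝒯.two ⟨m, htri⟩
    obtain ⟨m', hm', hmm'⟩ : ∃ m', 𝒯.Tri i j m' ∧ m' ≠ m := by
      by_contra hcon
      push Not at hcon
      have : {k | 𝒯.Tri i j k} ⊆ {m} := fun k hk => hcon k hk
      have := encard_le_encard this
      rw [h2, encard_singleton] at this
      exact absurd this (by decide)
    obtain ⟨z, ⟨hz1, hz2⟩, hz3⟩ := exists_mem_tile_inter (q := q) hL hq hs hm'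
    have hz : z ∈ ⋂₀ S := fun s hs' => by
      rcases hall s hs' with h | h
      · exact h ▸ hz1
      · exact h ▸ hz2
    rcases eq_of_pos_of_tri htri (pos_of_mem_tile hL hq hs hz1)
      (pos_of_mem_tile hL hq hs hz2) (pos_of_mem_tile hL hq hs (hsub hz))
      (pos_of_mem_tile hL hq hs hz3) with h | h | h
    · exact (𝒯.ne hm').2.1 h.symm
    · exact (𝒯.ne hm').2.2 h.symm
    · exact hmm' h

theorem isSimplicialTessellation : IsSimplicialTessellation (tiling (𝒯.label q)) where
  isCompact := by
    rintro _ ⟨i, -, rfl⟩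
    exact isCompact_tile (finite_label hL hq i)
  cover := sUnion_tiling _
  disjoint_interior := by
    rintro _ ⟨i, -, rfl⟩ _ ⟨j, -, rfl⟩ hne
    exact disjoint_interior_tile fun e => hne (e ▸ rfl)
  eq_of_sInter_eq := by
    intro S S' hS hS' _ _ hne hne' he hi
    apply subset_antisymm
    · intro s hs'
      exact eq_of_sInter_subset hL hq hs hS' (hS hs') hne' (he ▸ hi)
        (he ▸ sInter_subset_of_mem hs')
    · intro s hs'
      exact eq_of_sInter_subset hL hq hs hS (hS' hs') hne hi (he ▸ sInter_subset_of_mem hs')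
  sInter_nonempty := by
    intro S hS _ hne hpair
    obtain ⟨t, ht⟩ := hne
    obtain ⟨i, rfl, ji, ki, hti⟩ := exists_eq_tile (hS ht)
    have hadj : ∀ {i j : I}, tile (𝒯.label q) i ∈ S → tile (𝒯.label q) j ∈ S → i ≠ j →
        ∃ k, 𝒯.Tri i j k := by
      intro i j hi hj hij
      obtain ⟨y, hy⟩ := hpair _ hi _ hj
      exact adj_of_mem_tile hL hq hs hij hy.1 hy.2
    by_cases h1 : ∀ s ∈ S, s = tile (𝒯.label q) i
    · exact ⟨𝒯.b i, fun s hs' => h1 s hs' ▸ mem_tile_vertex hL hq hs hti⟩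
    push Not at h1
    obtain ⟨s, hsS, hsi⟩ := h1
    obtain ⟨j, rfl, -⟩ := exists_eq_tile (hS hsS)
    have hij : i ≠ j := fun e => hsi (e ▸ rfl)
    obtain ⟨k₀, hk₀⟩ := hadj ht hsS hij
    by_cases h2 : ∀ s ∈ S, s = tile (𝒯.label q) i ∨ s = tile (𝒯.label q) j
    · obtain ⟨z, ⟨hz1, hz2⟩, -⟩ := exists_mem_tile_inter (q := q) hL hq hs hk₀
      refine ⟨z, fun s hs' => ?_⟩
      rcases h2 s hs' with h | h
      · exact h ▸ hz1
      · exact h ▸ hz2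
    push Not at h2
    obtain ⟨r, hrS, hri, hrj⟩ := h2
    obtain ⟨k, rfl, -⟩ := exists_eq_tile (hS hrS)
    have hik : i ≠ k := fun e => hri (e ▸ rfl)
    have hjk : j ≠ k := fun e => hrj (e ▸ rfl)
    -- Pairwise adjacent vertices span a triangle by flagness, and the three ranks exclude a fourth,
    -- so `S` has no further tile.
    have htri := 𝒯.flag (hadj ht hsS hij) (hadj hsS hrS hjk) (hadj ht hrS hik)
    obtain ⟨z, ⟨hz1, hz2⟩, hz3⟩ := exists_mem_tile_inter (q := q) hL hq hs htri
    refine ⟨z, fun s hs' => ?_⟩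
    obtain ⟨m, rfl, -⟩ := exists_eq_tile (hS hs')
    by_cases e1 : m = i
    · exact e1 ▸ hz1
    by_cases e2 : m = j
    · exact e2 ▸ hz2
    by_cases e3 : m = k
    · exact e3 ▸ hz3
    exact (not_four (hadj ht hsS hij) (hadj ht hrS hik) (hadj ht hs' (Ne.symm e1))
      (hadj hsS hrS hjk) (hadj hsS hs' (Ne.symm e2)) (hadj hrS hs' (Ne.symm e3))).elim

theorem hasCapacity {r : ℝ} (hr : L * r ≤ 1 / 8) : HasCapacity (tiling (𝒯.label q)) r := by
  intro t ht
  obtain ⟨i, rfl, j, k, h⟩ := exists_eq_tile ht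
  refine ⟨𝒯.b i, fun y hy => mem_tile_of_forall_lt hL hq
    (coord_lt_of_dist_vertex hs ⟨j, k, h⟩ ?_)⟩
  exact (mul_le_mul_of_nonneg_left (Metric.mem_ball.1 hy).le hL.le).trans hr

/-- At distance less than `K` from tile `j`, the coordinate of `j` is still at least `1/3 - 1/1000 -
1/8 > 0`. So both coordinates are positive at `x`, and `i`, `j` are adjacent. -/
theorem le_dist_of_mem_tile {K : ℝ} (hK : L * K ≤ 1 / 8) (hij : i ≠ j)
    (hadj : ¬ ∃ k, 𝒯.Tri i j k) (hx : x ∈ tile (𝒯.label q) i) (hy : y ∈ tile (𝒯.label q) j) :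
    K ≤ dist x y := by
  by_contra hlt
  push Not at hlt
  have h1 := third_sub_le_of_mem_tile hL hq hy
  have h2 := abs_le.1 (𝒯.lip j x y)
  have hd : L * dist x y ≤ 1 / 8 := (mul_le_mul_of_nonneg_left hlt.le hL.le).trans hK
  obtain ⟨k, u, v, w, h⟩ := exists_at_of_pos₂ hij (pos_of_mem_tile hL hq hs hx)
    (by linarith : 0 < 𝒯.Λ j x)
  exact hadj ⟨k, h.tri⟩

theorem isSeparated {K : ℝ} (hK : L * K ≤ 1 / 8) : IsSeparated (tiling (𝒯.label q)) K := by
  intro t ht s hs' hdis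
  obtain ⟨i, rfl, ji, ki, hi⟩ := exists_eq_tile ht
  obtain ⟨j, rfl, jj, kj, hj⟩ := exists_eq_tile hs'
  have hi' := mem_tile_vertex (q := q) hL hq hs hi
  have hj' := mem_tile_vertex (q := q) hL hq hs hj
  refine le_csInf ⟨_, mem_image2_of_mem hi' hj'⟩ ?_
  rintro _ ⟨x, hx, y, hy, rfl⟩
  refine le_dist_of_mem_tile hL hq hs hK ?_ ?_ hx hy
  · rintro rfl
    exact Set.disjoint_left.1 hdis hi' hi'
  · rintro ⟨k, hk⟩
    obtain ⟨z, ⟨hz1, hz2⟩, -⟩ := exists_mem_tile_inter (q := q) hL hq hs hk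
    exact Set.disjoint_left.1 hdis hz1 hz2

theorem encard_neighbours_le {t : Set Plane} (ht : t ∈ tiling (𝒯.label q)) :
    (neighbours (tiling (𝒯.label q)) t).encard ≤ E := by
  obtain ⟨i, rfl, -⟩ := exists_eq_tile ht
  refine le_trans (encard_le_encard (t := tile (𝒯.label q) '' {j | ∃ k, 𝒯.Tri i j k}) ?_)
    ((encard_image_le _ _).trans (𝒯.deg i))
  rintro s ⟨hs', hne, y, hy1, hy2⟩
  obtain ⟨j, rfl, -⟩ := exists_eq_tile hs'
  exact ⟨j, adj_of_mem_tile hL hq hs (fun e => hne (e ▸ rfl)) hy2 hy1, rfl⟩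

theorem encard_common_neighbours {t s : Set Plane} (hts : (t, s) ∈ pairs (tiling (𝒯.label q))) :
    (neighbours (tiling (𝒯.label q)) t ∩ neighbours (tiling (𝒯.label q)) s).encard = 2 := by
  obtain ⟨ht, hs', hne, y, hy1, hy2⟩ := hts
  dsimp only at ht hs' hne hy1 hy2
  obtain ⟨i, rfl, -⟩ := exists_eq_tile ht
  obtain ⟨j, rfl, -⟩ := exists_eq_tile hs'
  have hadj := adj_of_mem_tile hL hq hs (fun e : i = j => hne (e ▸ rfl)) hy1 hy2
  rw [← 𝒯.two hadj, ← InjOn.encard_image (f := tile (𝒯.label q))]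
  · congr 1
    ext r
    constructor
    · rintro ⟨⟨hr, hri, z, hz1, hz2⟩, -, hrj, z', hz1', hz2'⟩
      obtain ⟨k, rfl, -⟩ := exists_eq_tile hr
      exact ⟨k, 𝒯.flag hadj
        (adj_of_mem_tile hL hq hs (fun e => hrj (e ▸ rfl)) hz2' hz1')
        (adj_of_mem_tile hL hq hs (fun e => hri (e ▸ rfl)) hz2 hz1), rfl⟩
    · rintro ⟨k, hk, rfl⟩
      have hk' : 𝒯.Tri k i j := 𝒯.rot (𝒯.rot hk)
      obtain ⟨z, ⟨hz1, hz2⟩, hz3⟩ := exists_mem_tile_inter (q := q) hL hq hs hk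
      have hm := tile_mem (q := q) hL hq hs hk'
      exact ⟨⟨hm, fun e => (𝒯.ne hk).2.1 (tile_injective hL hq hs hk' e), z, hz3, hz1⟩,
        hm, fun e => (𝒯.ne hk).2.2 (tile_injective hL hq hs hk' e), z, hz3, hz2⟩
  · intro k hk k' _ he
    exact (tile_injective hL hq hs (𝒯.rot (𝒯.rot hk)) he).symm

end FatTriangulation

/-! ### Nesting, diameters, and lattice points near the boundary of a tile. -/

theorem tile_ref_subset {I : Type*} {L : ℝ} {E : ℕ} {𝒯 : FatTriangulation I L E}
    {q : ℤ × ℤ → Plane} {t : Set Plane} (ht : t ∈ tiling q) :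
    ∃ t' ∈ tiling (𝒯.label q), t ⊆ t' := by
  obtain ⟨_, ⟨n, rfl⟩, rfl⟩ := ht
  refine ⟨_, tile_mem_tiling (𝒯.label q) n, fun y hy => ?_⟩
  obtain ⟨n', hn', hy'⟩ := mem_tile.1 hy
  exact mem_tile.2 ⟨n', by simp [FatTriangulation.label, hn'], hy'⟩

section Ref
variable {q : ℤ × ℤ → Plane} {D : ℝ} (hq : ∀ n, dist (q n) (latticePoint n) ≤ D)
include hq

theorem dist_le_of_mem_tile_ref {v y : Plane} (hy : y ∈ tile q v) : dist y v ≤ D + 2 := by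
  obtain ⟨n, rfl, hn⟩ := mem_tile.1 hy
  exact FatTriangulation.dist_ref_le hq hn

theorem diam_tile_ref_le {t : Set Plane} (ht : t ∈ tiling q) : Metric.diam t ≤ 2 * (D + 2) := by
  obtain ⟨_, ⟨n, rfl⟩, rfl⟩ := ht
  have hD : 0 ≤ D := dist_nonneg.trans (hq n)
  refine Metric.diam_le_of_forall_dist_le (by linarith) fun y hy z hz => ?_
  have := dist_triangle_right y z (q n)
  linarith [dist_le_of_mem_tile_ref hq hy, dist_le_of_mem_tile_ref hq hz]

theorem boundedDiam_tiling_ref : BoundedDiam (tiling q) :=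
  ⟨2 * (D + 2), by rintro _ ⟨t, ht, rfl⟩; exact diam_tile_ref_le hq ht⟩

theorem tessDiam_tiling_ref_le : tessDiam (tiling q) ≤ 2 * (D + 2) :=
  csSup_le ⟨_, mem_image_of_mem _ (tile_mem_tiling q 0)⟩
    (by rintro _ ⟨t, ht, rfl⟩; exact diam_tile_ref_le hq ht)

end Ref

theorem encard_biUnion_le {α β : Type*} (s : Finset α) (f : α → Set β) (c : ℕ)
    (h : ∀ a ∈ s, (f a).encard ≤ c) : (⋃ a ∈ s, f a).encard ≤ ((s.card * c : ℕ) : ℕ∞) := by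
  classical
  induction s using Finset.induction_on with
  | empty => simp
  | insert a s ha ih =>
    rw [Finset.set_biUnion_insert, Finset.card_insert_of_notMem ha]
    refine (encard_union_le _ _).trans ?_
    have h1 := h a (Finset.mem_insert_self _ _)
    have h2 := ih fun b hb => h b (Finset.mem_insert_of_mem hb)
    calc _ ≤ (c : ℕ∞) + ((s.card * c : ℕ) : ℕ∞) := add_le_add h1 h2
      _ = _ := by push_cast; ring

namespace FatTriangulation

variable {I : Type*} {L : ℝ} {E : ℕ} {𝒯 : FatTriangulation I L E} {i j k m : I} {x y : Plane}
  {q : ℤ × ℤ → Plane} {D : ℝ} {u v w : ℝ}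

/-- The border between the tiles of `i` and `j` follows the median `u = v`; this locates a border
point by its third coordinate alone. -/
theorem At.abs_sub_mid_le (h : 𝒯.At i j k u v w y) {δ τ : ℝ} (hδ : |u - v| ≤ 2 * δ)
    (hτ : |w - τ| ≤ δ) :
    dist y (((1 - τ) / 2) • 𝒯.b i + ((1 - τ) / 2) • 𝒯.b j + τ • 𝒯.b k) ≤ 3 * δ * (100 / L) := by
  have hL : 0 ≤ 100 / L := dist_nonneg.trans (𝒯.side h.tri)
  have e : y - (((1 - τ) / 2) • 𝒯.b i + ((1 - τ) / 2) • 𝒯.b j + τ • 𝒯.b k) =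
      (u - (1 - τ) / 2) • (𝒯.b i - 𝒯.b j) + (w - τ) • (𝒯.b k - 𝒯.b j) := by
    rw [h.eq]
    obtain rfl : v = 1 - u - w := by linarith [h.sum]
    module
  rw [dist_eq_norm, e]
  refine (norm_sub_le h.tri _ _).trans (mul_le_mul_of_nonneg_right ?_ hL)
  rw [abs_le] at hδ hτ
  have : |u - (1 - τ) / 2| ≤ 2 * δ := abs_le.2 ⟨by linarith [h.sum], by linarith [h.sum]⟩
  have : |w - τ| ≤ δ := abs_le.2 hτ
  linarith

section
variable (hL : 0 < L) (hq : ∀ n, dist (q n) (latticePoint n) ≤ D) (hs : L * (D + 2) ≤ 1 / 1000)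
include hL hq hs

theorem sq_le_encard_latticeIn {t : Set Plane} (ht : t ∈ tiling (𝒯.label q)) {a : ℕ}
    (ha : L * (2 * a + 2) ≤ 1 / 8) : ((a ^ 2 : ℕ) : ℕ∞) ≤ (latticeIn t).encard := by
  obtain ⟨i, rfl, h⟩ := exists_eq_tile ht
  rw [latticeIn_tile]
  refine (le_encard_lattice_closedBall (𝒯.b i) a).trans (encard_le_encard fun n hn => ?_)
  exact label_eq_of_forall_lt hL hq (coord_lt_of_dist_vertex hs h
    ((mul_le_mul_of_nonneg_left hn hL.le).trans ha)) (latticePoint_mem_cell n)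

-- A lattice point of tile `i` near another tile `j` has reference point where the coordinates of
-- `i` and `j` almost agree, so near a median of a triangle `i j k`. Sampling each median at `N + 1`
-- points, with at most `E` choices for each of `j` and `k`, covers these lattice points by
-- boundedly large balls. The bound is linear in `1 / L` when `N` is.
omit hs in
theorem encard_boundary_le {t : Set Plane} (ht : t ∈ tiling (𝒯.label q)) {l β : ℝ}
    (hβ : 2 * (D + 2) + l + 1 ≤ β) (hLβ : L * β ≤ 1 / 8) {N C : ℕ} (hN : 1 / L ≤ N)
    (hN0 : 0 < N) (hC : 300 * β + 300 + D ≤ C) :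
    {n : ℤ × ℤ | n ∈ latticeIn t ∧ Metric.infDist (latticePoint n) tᶜ ≤ l}.encard ≤
      ((E * (E * (N + 1)) * (2 * C + 1) ^ 2 : ℕ) : ℕ∞) := by
  classical
  obtain ⟨i, rfl, -⟩ := exists_eq_tile ht
  have hfin : {j | ∃ k, 𝒯.Tri i j k}.Finite := finite_of_encard_le_coe (𝒯.deg i)
  set A := hfin.toFinset with hA
  have hAcard : A.card ≤ E := by
    have := 𝒯.deg i
    rw [hfin.encard_eq_coe_toFinset_card] at this
    exact_mod_cast this
  let z : I × I × ℕ → Plane := fun p =>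
    ((1 - (p.2.2 : ℝ) / N) / 2) • 𝒯.b i + ((1 - (p.2.2 : ℝ) / N) / 2) • 𝒯.b p.1 +
      ((p.2.2 : ℝ) / N) • 𝒯.b p.2.1
  have hNpos : (0 : ℝ) < N := by exact_mod_cast hN0
  have hsub : {n : ℤ × ℤ | n ∈ latticeIn (tile (𝒯.label q) i) ∧
      Metric.infDist (latticePoint n) (tile (𝒯.label q) i)ᶜ ≤ l} ⊆
      ⋃ p ∈ A ×ˢ A ×ˢ Finset.range (N + 1), {n | dist (latticePoint n) (z p) ≤ C} := by
    rintro n ⟨hn, hd⟩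
    rw [latticeIn_tile] at hn
    have hn : 𝒯.label q n = i := hn
    have hcne : ((tile (𝒯.label q) i)ᶜ).Nonempty := by
      rw [nonempty_compl]
      intro he
      exact (isCompact_tile (finite_label (𝒯 := 𝒯) hL hq i)).ne_univ he
    -- The complement of a tile is open, so the infimum need not be attained; passing to a point at
    -- distance less than `l + 1` accounts for the `+ 1` in `β`.
    obtain ⟨y, hyc, hy⟩ := (Metric.infDist_lt_iff hcne).1 (hd.trans_lt (lt_add_one l))
    obtain ⟨n', hn'⟩ := exists_mem_cell y
    set j := 𝒯.label q n' with hj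
    have hij : i ≠ j := fun e => hyc (mem_tile.2 ⟨n', e.symm, hn'⟩)
    have hdist : dist (q n) (q n') ≤ β := by
      have h1 := dist_triangle4 (q n) (latticePoint n) y (q n')
      linarith [hq n, dist_ref_le hq hn']
    have hLd : L * dist (q n) (q n') ≤ L * β := mul_le_mul_of_nonneg_left hdist hL.le
    have h1 := abs_le.1 (𝒯.lip j (q n) (q n'))
    have h2 := abs_le.1 (𝒯.lip i (q n) (q n'))
    have h3 := 𝒯.lab_max (q n') i
    have h4 := 𝒯.lab_max (q n) j
    have h5 := 𝒯.third_le_lab (q n)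
    change _ ≤ 𝒯.Λ (𝒯.label q n') _ at h3
    change _ ≤ 𝒯.Λ (𝒯.label q n) _ at h4 h5
    rw [← hj] at h3
    rw [hn] at h4 h5
    obtain ⟨k, u, v, w, h⟩ := exists_at_of_pos₂ (y := q n) hij (by linarith) (by linarith)
    have hu := h.coord₁
    have hv := h.coord₂
    have hw1 : w ≤ 1 := by linarith [h.hu, h.hv, h.sum]
    -- Rounding `w` to a multiple of `1 / N ≤ L` shifts the point by a bounded distance, since
    -- lengths are coordinates times `100 / L`.
    obtain ⟨p, hp⟩ : ∃ p : ℕ, p = ⌊w * N⌋₊ := ⟨_, rfl⟩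
    have hp1 : (p : ℝ) ≤ w * N := hp ▸ Nat.floor_le (mul_nonneg h.hw hNpos.le)
    have hp2 : w * N < p + 1 := hp ▸ Nat.lt_floor_add_one _
    have hpN : p ≤ N := by
      have : (p : ℝ) ≤ N := by nlinarith
      exact_mod_cast this
    simp only [mem_iUnion]
    refine ⟨(j, k, p), ?_, ?_⟩
    · simp only [Finset.mem_product, Finset.mem_range, hA, Finite.mem_toFinset, mem_ofPred_eq]
      exact ⟨⟨k, h.tri⟩, ⟨j, 𝒯.swap₂₃ h.tri⟩, by omega⟩
    · change dist (latticePoint n) (z (j, k, p)) ≤ C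
      have hNL : 1 / (N : ℝ) ≤ L := by
        rw [div_le_iff₀ hL] at hN
        rw [div_le_iff₀ hNpos]; linarith
      have hβ0 : 0 ≤ β := dist_nonneg.trans hdist
      have hmid := h.abs_sub_mid_le (δ := L * (β + 1)) (τ := (p : ℝ) / N)
        (abs_le.2 ⟨by nlinarith, by nlinarith⟩)
        (by
          rw [abs_of_nonneg (by rw [sub_nonneg, div_le_iff₀ hNpos]; exact hp1)]
          have : w < (p : ℝ) / N + 1 / N := by rw [← add_div, lt_div_iff₀ hNpos]; exact hp2
          nlinarith [mul_nonneg hL.le hβ0])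
      have he : 3 * (L * (β + 1)) * (100 / L) = 300 * β + 300 := by field_simp; ring
      rw [he] at hmid
      have h6 := dist_triangle_left (latticePoint n) (z (j, k, p)) (q n)
      change dist (q n) (z (j, k, p)) ≤ _ at hmid
      linarith [hq n]
  refine (encard_le_encard hsub).trans ((encard_biUnion_le _ _ ((2 * C + 1) ^ 2)
    fun p _ => encard_lattice_closedBall_le _ _).trans ?_)
  rw [Finset.card_product, Finset.card_product, Finset.card_range]
  gcongr

/-- The lattice points near the boundary of a tile are few. -/
theorem boundary_le_latticeIn {t s : Set Plane} (ht : t ∈ tiling (𝒯.label q))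
    (hs' : s ∈ tiling (𝒯.label q)) {l : ℕ} {β : ℝ}
    (hβ : 2 * (D + 2) + l + 1 ≤ β) (hLβ : L * β ≤ 1 / 8) {N C a : ℕ} (hN : 1 / L ≤ N)
    (hN0 : 0 < N) (hC : 300 * β + 300 + D ≤ C) (ha : L * (2 * a + 2) ≤ 1 / 8)
    (hcount : 2 ^ l * (E * (E * (N + 1)) * (2 * C + 1) ^ 2) ≤ a ^ 2) :
    (2 : ℕ∞) ^ l * {n : ℤ × ℤ | n ∈ latticeIn t ∧
      Metric.infDist (latticePoint n) tᶜ ≤ (l : ℝ)}.encard ≤ (latticeIn s).encard :=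
  calc _ ≤ (2 : ℕ∞) ^ l * ((E * (E * (N + 1)) * (2 * C + 1) ^ 2 : ℕ) : ℕ∞) := by
        gcongr
        exact encard_boundary_le hL hq ht hβ hLβ hN hN0 hC
    _ = ((2 ^ l * (E * (E * (N + 1)) * (2 * C + 1) ^ 2) : ℕ) : ℕ∞) := by push_cast; ring
    _ ≤ ((a ^ 2 : ℕ) : ℕ∞) := by exact_mod_cast hcount
    _ ≤ _ := sq_le_encard_latticeIn hL hq hs hs' ha

end
end FatTriangulation

/-! ### Small triples near the centre of a triangle against small tiles along an edge. -/

theorem tile_ref_injective {α : Type*} {f : ℤ × ℤ → α} {n : ℤ × ℤ} {a : α}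
    (h : tile f (f n) = tile f a) : f n = a := by
  have h1 : n ∈ f ⁻¹' {f n} := rfl
  rw [← latticeIn_tile, h, latticeIn_tile] at h1
  exact h1

theorem exists_eq_tile_of_mem {α : Type*} {f : ℤ × ℤ → α} {t : Set Plane} {y : Plane}
    (ht : t ∈ tiling f) (hy : y ∈ t) : ∃ n, t = tile f (f n) ∧ y ∈ cell n := by
  obtain ⟨_, ⟨n, rfl⟩, rfl⟩ := ht
  obtain ⟨n', hn', hy'⟩ := mem_tile.1 hy
  exact ⟨n', by rw [hn'], hy'⟩

theorem setDist_le {s t : Set Plane} {x y : Plane} (hx : x ∈ s) (hy : y ∈ t) :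
    setDist s t ≤ dist x y :=
  csInf_le ⟨0, by rintro _ ⟨a, -, b, -, rfl⟩; exact dist_nonneg⟩ (mem_image2_of_mem hx hy)

theorem le_setDist {s t : Set Plane} (hs : s.Nonempty) (ht : t.Nonempty) {K : ℝ}
    (h : ∀ x ∈ s, ∀ y ∈ t, K ≤ dist x y) : K ≤ setDist s t :=
  le_csInf (hs.image2 ht) (by rintro _ ⟨a, ha, b, hb, rfl⟩; exact h a ha b hb)

namespace FatTriangulation

variable {I : Type*} {L : ℝ} {E : ℕ} {𝒯 : FatTriangulation I L E} {i j k k' m : I} {x y : Plane}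
  {q : ℤ × ℤ → Plane} {D : ℝ} {u v w : ℝ}

theorem tile_ref_subset_tile (n : ℤ × ℤ) :
    tile q (q n) ⊆ tile (𝒯.label q) (𝒯.label q n) := by
  intro y hy
  obtain ⟨n', hn', hy'⟩ := mem_tile.1 hy
  exact mem_tile.2 ⟨n', by simp [label, hn'], hy'⟩

variable (hL : 0 < L) (hq : ∀ n, dist (q n) (latticePoint n) ≤ D)
  (hs : L * (D + 2) ≤ 1 / 100000)
include hL hq hs

/-- At a common point of the three large tiles all coordinates are within `2 * (L * (D + 2))` of `1
/ 3`. The factor `100 / L` turns this into distance `400 * (D + 2)` from the barycentre, free of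
`L`; a small tile through the point is determined by a cell containing it. -/
theorem encard_N3_le (h : 𝒯.Tri i j k) {C : ℕ} (hC : 402 * (D + 2) ≤ C) :
    (N3 (tiling q) (tile (𝒯.label q) i) (tile (𝒯.label q) j) (tile (𝒯.label q) k)).encard ≤
      ((((2 * C + 1) ^ 2) ^ 3 : ℕ) : ℕ∞) := by
  classical
  have hs' : L * (D + 2) ≤ 1 / 1000 := hs.trans (by norm_num)
  have hD : 0 ≤ D := dist_nonneg.trans (hq 0)
  set z := (1 / 3 : ℝ) • 𝒯.b i + (1 / 3 : ℝ) • 𝒯.b j + (1 / 3 : ℝ) • 𝒯.b k with hz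
  have hzat : 𝒯.At i j k (1 / 3) (1 / 3) (1 / 3) z :=
    ⟨h, by norm_num, by norm_num, by norm_num, by norm_num, hz⟩
  have hfin : {n | dist (latticePoint n) z ≤ C}.Finite :=
    finite_of_encard_le_coe (encard_lattice_closedBall_le z C)
  set A := hfin.toFinset with hA
  have hAcard : A.card ≤ (2 * C + 1) ^ 2 := by
    have := encard_lattice_closedBall_le z C
    rw [hfin.encard_eq_coe_toFinset_card] at this
    exact_mod_cast this
  have hsub : N3 (tiling q) (tile (𝒯.label q) i) (tile (𝒯.label q) j) (tile (𝒯.label q) k) ⊆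
      (((A ×ˢ A ×ˢ A).image fun p => (tile q (q p.1), tile q (q p.2.1), tile q (q p.2.2)) :
        Finset (Set Plane × Set Plane × Set Plane)) : Set _) := by
    rintro ⟨t, t', t''⟩ ⟨⟨ht, ht', ht'', -, -, -, y, ⟨hy, hy'⟩, hy''⟩, hsub, hsub', hsub''⟩
    dsimp only at *
    obtain ⟨u, v, w, hat⟩ : ∃ u v w, 𝒯.At i j k u v w y := by
      obtain ⟨c, u, v, w, hat⟩ := exists_at_of_pos₂ (𝒯.ne h).1
        (pos_of_mem_tile hL hq hs' (hsub hy)) (pos_of_mem_tile hL hq hs' (hsub' hy'))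
      have hk := pos_of_mem_tile hL hq hs' (hsub'' hy'')
      by_cases e : k = c
      · exact e ▸ ⟨u, v, w, hat⟩
      · rw [hat.coord_other (𝒯.ne h).2.1.symm (𝒯.ne h).2.2.symm e] at hk
        exact absurd hk (lt_irrefl 0)
    have c1 := coord_le_of_mem_tile hL hq (hsub hy) j
    have c2 := coord_le_of_mem_tile hL hq (hsub hy) k
    have c3 := coord_le_of_mem_tile hL hq (hsub' hy') i
    have c4 := coord_le_of_mem_tile hL hq (hsub' hy') k
    have c5 := coord_le_of_mem_tile hL hq (hsub'' hy'') i
    have c6 := coord_le_of_mem_tile hL hq (hsub'' hy'') j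
    rw [hat.coord₁, hat.coord₂] at c1 c3
    rw [hat.coord₁, hat.coord₃] at c2 c5
    rw [hat.coord₂, hat.coord₃] at c4 c6
    have hsum := hat.sum
    have hdist : dist y z ≤ 400 * (D + 2) := by
      refine (hat.dist_le hzat).trans ?_
      have e1 : |u - 1 / 3| ≤ 2 * (L * (D + 2)) := abs_le.2 ⟨by linarith, by linarith⟩
      have e2 : |w - 1 / 3| ≤ 2 * (L * (D + 2)) := abs_le.2 ⟨by linarith, by linarith⟩
      calc _ ≤ (2 * (L * (D + 2)) + 2 * (L * (D + 2))) * (100 / L) := by gcongr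
        _ = _ := by field_simp; ring
    have hcell : ∀ n, y ∈ cell n → n ∈ A := by
      intro n hn
      rw [hA, Finite.mem_toFinset]
      change dist _ _ ≤ _
      have := dist_triangle_left (latticePoint n) z y
      linarith [dist_latticePoint_le_of_mem_cell hn]
    obtain ⟨n, rfl, hn⟩ := exists_eq_tile_of_mem ht hy
    obtain ⟨n', rfl, hn'⟩ := exists_eq_tile_of_mem ht' hy'
    obtain ⟨n'', rfl, hn''⟩ := exists_eq_tile_of_mem ht'' hy''
    rw [Finset.mem_coe, Finset.mem_image]
    exact ⟨(n, n', n''), by simp [hcell n hn, hcell n' hn', hcell n'' hn''], rfl⟩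
  refine (encard_le_encard hsub).trans ?_
  rw [encard_coe_eq_coe_finsetCard]
  have : ((A ×ˢ A ×ˢ A).image fun p => (tile q (q p.1), tile q (q p.2.1), tile q (q p.2.2))).card
      ≤ ((2 * C + 1) ^ 2) ^ 3 := by
    refine Finset.card_image_le.trans ?_
    rw [Finset.card_product, Finset.card_product]
    calc _ ≤ (2 * C + 1) ^ 2 * ((2 * C + 1) ^ 2 * (2 * C + 1) ^ 2) := by gcongr
      _ = _ := by ring
  exact_mod_cast this

/-- On the line where the third coordinate is constant, the tiles of two vertices meet. -/
theorem exists_mem_inter_of_level (h : 𝒯.Tri i j k) {η : ℝ} (hη : 2 * (L * (D + 2)) < η)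
    (hη1 : η ≤ 1 / 2000) : ∃ u v, 𝒯.At i j k u v (1 / 3 - 2 * η)
      (u • 𝒯.b i + v • 𝒯.b j + (1 / 3 - 2 * η) • 𝒯.b k) ∧
      |u - (1 / 3 + η)| ≤ 2 * (L * (D + 2)) ∧
      (u • 𝒯.b i + v • 𝒯.b j + (1 / 3 - 2 * η) • 𝒯.b k) ∈
        tile (𝒯.label q) i ∩ tile (𝒯.label q) j := by
  have hs' : L * (D + 2) ≤ 1 / 1000 := hs.trans (by norm_num)
  have hD : 0 ≤ D := dist_nonneg.trans (hq 0)
  set ε := L * (D + 2) with hε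
  have hε0 : 0 < ε := by positivity
  -- Along this segment the third coordinate is too small for the tile of `k`, so the tiles of `i`
  -- and `j` cover it. At its ends the first two coordinates differ by `4 * ε > 2 * ε`, so one end
  -- is in each tile, and connectedness gives a common point.
  let γ : ℝ → Plane := fun σ =>
    (1 / 3 + η + σ) • 𝒯.b i + (1 / 3 + η - σ) • 𝒯.b j + (1 / 3 - 2 * η) • 𝒯.b k
  have hγ : Continuous γ := by fun_prop
  have hat : ∀ σ ∈ Icc (-(2 * ε)) (2 * ε),
      𝒯.At i j k (1 / 3 + η + σ) (1 / 3 + η - σ) (1 / 3 - 2 * η) (γ σ) := fun σ hσ =>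
    ⟨h, by linarith [hσ.1], by linarith [hσ.2], by linarith, by ring, rfl⟩
  have hlab : ∀ σ ∈ Icc (-(2 * ε)) (2 * ε), γ σ ∈ tile (𝒯.label q) i ∪ tile (𝒯.label q) j := by
    intro σ hσ
    obtain ⟨n, hn⟩ := exists_mem_cell (γ σ)
    have hmem : γ σ ∈ tile (𝒯.label q) (𝒯.label q n) := mem_tile.2 ⟨n, rfl, hn⟩
    by_cases e1 : 𝒯.label q n = i
    · exact .inl (e1 ▸ hmem)
    by_cases e2 : 𝒯.label q n = j
    · exact .inr (e2 ▸ hmem)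
    exfalso
    have a := hat σ hσ
    have c1 := coord_le_of_mem_tile hL hq hmem i
    have c2 := coord_le_of_mem_tile hL hq hmem j
    rw [a.coord₁] at c1
    rw [a.coord₂] at c2
    by_cases e3 : 𝒯.label q n = k
    · rw [e3, a.coord₃] at c1 c2
      linarith
    · rw [a.coord_other e1 e2 e3] at c1 c2
      linarith
  have hother : ∀ {a b : I} {u v w : ℝ} {y : Plane}, 𝒯.At a b k u v w y → v + 2 * ε < u →
      w + 2 * ε < u → y ∈ tile (𝒯.label q) a := by
    intro a b u v w y ha h1 h2
    refine mem_tile_of_forall_lt hL hq fun m hm => ?_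
    rw [ha.coord₁]
    by_cases e2 : m = b
    · rw [e2, ha.coord₂]; exact h1
    by_cases e3 : m = k
    · rw [e3, ha.coord₃]; exact h2
    rw [ha.coord_other hm e2 e3]
    linarith [ha.hv]
  have hr : (2 * ε) ∈ Icc (-(2 * ε)) (2 * ε) := ⟨by linarith, le_rfl⟩
  have hl : (-(2 * ε)) ∈ Icc (-(2 * ε)) (2 * ε) := ⟨le_rfl, by linarith⟩
  have hi := hother (hat _ hr) (by linarith) (by linarith)
  have hj := hother (hat _ hl).swap₁₂ (by linarith) (by linarith)
  obtain ⟨_, ⟨σ, hσ, rfl⟩, hmem⟩ := isPreconnected_closed_iff.1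
    (isPreconnected_Icc.image γ hγ.continuousOn) _ _ (isClosed_tile (𝒯 := 𝒯) hL hq i)
    (isClosed_tile (𝒯 := 𝒯) hL hq j) (by rintro _ ⟨σ, hσ, rfl⟩; exact hlab σ hσ)
    ⟨_, ⟨_, hr, rfl⟩, hi⟩ ⟨_, ⟨_, hl, rfl⟩, hj⟩
  refine ⟨1 / 3 + η + σ, 1 / 3 + η - σ, hat σ hσ, ?_, hmem⟩
  rw [add_sub_cancel_left]
  exact abs_le.2 hσ

/-- The small tile through a point on the border of `i` and `j`, slightly off centre, has all its
neighbours in these two large tiles. It is near the tile of `k`, but at distance about `1 / (3 * L)`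
from that of `k'`, whose coordinate vanishes at the point. -/
theorem exists_mem_N2 (h : 𝒯.Tri i j k) (h' : 𝒯.Tri i j k') (hkk' : k ≠ k') {η : ℝ}
    (hη : 2 * (L * (D + 2)) < η) (hη1 : η ≤ 1 / 2000) :
    ∃ n y, 𝒯.Λ k y = 1 / 3 - 2 * η ∧ y ∈ cell n ∧
      tile q (q n) ∈ N2 (tiling q) (tile (𝒯.label q) i) (tile (𝒯.label q) j)
        (tile (𝒯.label q) k) (tile (𝒯.label q) k') := by
  have hs' : L * (D + 2) ≤ 1 / 1000 := hs.trans (by norm_num)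
  have hD : 0 ≤ D := dist_nonneg.trans (hq 0)
  obtain ⟨u, v, hat, hu, hyi, hyj⟩ := exists_mem_inter_of_level hL hq hs h hη hη1
  set y := u • 𝒯.b i + v • 𝒯.b j + (1 / 3 - 2 * η) • 𝒯.b k
  have hε0 : 0 < L * (D + 2) := by positivity
  obtain ⟨n, hni, hn⟩ := mem_tile.1 hyi
  obtain ⟨n', hnj, hn'⟩ := mem_tile.1 hyj
  have hsum := hat.sum
  have hu' := abs_le.1 hu
  refine ⟨n, y, hat.coord₃, hn, ⟨tile_mem_tiling q n,
    hni ▸ tile_ref_subset_tile n, ⟨tile q (q n'), hnj ▸ tile_ref_subset_tile n',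
    tile_mem_tiling q n, tile_mem_tiling q n', ?_, y, mem_tile.2 ⟨n, rfl, hn⟩,
    mem_tile.2 ⟨n', rfl, hn'⟩⟩, ?_, ?_⟩⟩
  · intro he
    have := tile_ref_injective he
    exact (𝒯.ne h).1 (by rw [← hni, ← hnj, label, label, this])
  · rintro t'' ⟨-, ht'', -, z, hz, hz''⟩
    obtain ⟨m, rfl, hm⟩ := exists_eq_tile_of_mem ht'' hz''
    have hsub := tile_ref_subset_tile (𝒯 := 𝒯) (q := q) m
    have hzm := hsub hz''
    have hzn := dist_le_of_mem_tile_ref hq hz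
    have hyn := dist_ref_le hq hn
    have hzy : L * dist z y ≤ 2 * (L * (D + 2)) := by
      have := dist_triangle_right z y (q n)
      nlinarith
    by_cases e1 : 𝒯.label q m = i
    · exact (e1 ▸ hsub).trans subset_union_left
    by_cases e2 : 𝒯.label q m = j
    · exact (e2 ▸ hsub).trans subset_union_right
    exfalso
    have c1 := coord_le_of_mem_tile hL hq hzm i
    have d1 := abs_le.1 (𝒯.lip i z y)
    have d3 := abs_le.1 (𝒯.lip (𝒯.label q m) z y)
    rw [hat.coord₁] at d1
    -- For `k`, adding the inequalities for `i` and `j` would give `η ≤ 2 * (L * (D + 2))`, exactly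
    -- what `hη` excludes; each inequality alone is too weak.
    by_cases e3 : 𝒯.label q m = k
    · rw [e3] at c1 d3
      rw [hat.coord₃] at d3
      have c2 := coord_le_of_mem_tile hL hq hzm j
      have d2 := abs_le.1 (𝒯.lip j z y)
      rw [hat.coord₂] at d2
      rw [e3] at c2
      linarith
    · rw [hat.coord_other e1 e2 e3] at d3
      linarith
  · have hyt : y ∈ tile q (q n) := mem_tile.2 ⟨n, rfl, hn⟩
    set ε := L * (D + 2) with hε
    -- A point just beyond the barycentre towards `k`: its third coordinate leads by `6 * ε > 2 *
    -- ε`, which puts it in the tile of `k`.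
    have hz := at_mk h (u := 1 / 3 - 2 * ε) (v := 1 / 3 - 2 * ε) (w := 1 / 3 + 4 * ε)
      (by linarith) (by linarith) (by linarith) (by ring)
    set z := (1 / 3 - 2 * ε) • 𝒯.b i + (1 / 3 - 2 * ε) • 𝒯.b j + (1 / 3 + 4 * ε) • 𝒯.b k
    have hzk : z ∈ tile (𝒯.label q) k := by
      refine mem_tile_of_forall_lt hL hq fun m hm => ?_
      rw [hz.coord₃]
      by_cases e1 : m = i
      · rw [e1, hz.coord₁]; linarith
      by_cases e2 : m = j
      · rw [e2, hz.coord₂]; linarith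
      rw [hz.coord_other e1 e2 hm]; linarith
    have hyz : dist y z ≤ (3 * η + 8 * ε) * (100 / L) := by
      refine (hat.dist_le hz).trans (mul_le_mul_of_nonneg_right ?_ (by positivity))
      have a1 : |u - (1 / 3 - 2 * ε)| ≤ η + 4 * ε := abs_le.2 ⟨by linarith, by linarith⟩
      have a2 : |1 / 3 - 2 * η - (1 / 3 + 4 * ε)| ≤ 2 * η + 4 * ε :=
        abs_le.2 ⟨by linarith, by linarith⟩
      linarith
    have hlow : (1 / 3 - 3 * ε) / L ≤ setDist (tile q (q n)) (tile (𝒯.label q) k') := by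
      refine le_setDist ⟨y, hyt⟩ ⟨_, mem_tile_vertex hL hq hs' (𝒯.rot (𝒯.rot h'))⟩ fun a ha c hc => ?_
      rw [div_le_iff₀ hL]
      have c1 := third_sub_le_of_mem_tile hL hq hc
      have d1 := abs_le.1 (𝒯.lip k' a c)
      have d2 := abs_le.1 (𝒯.lip k' a y)
      rw [hat.coord_other (𝒯.ne h').2.1.symm (𝒯.ne h').2.2.symm hkk'.symm] at d2
      have han := dist_le_of_mem_tile_ref hq ha
      have hyn := dist_ref_le hq hn
      have hay : L * dist a y ≤ 2 * ε := by
        have := dist_triangle_right a y (q n)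
        rw [hε]; nlinarith
      linarith
    have hdiam := tessDiam_tiling_ref_le hq
    have hup := (setDist_le hyt hzk).trans hyz
    have hfin : (3 * η + 8 * ε) * (100 / L) + 2 * (D + 2) < (1 / 3 - 3 * ε) / L := by
      rw [lt_div_iff₀ hL]
      have : ((3 * η + 8 * ε) * (100 / L) + 2 * (D + 2)) * L = (3 * η + 8 * ε) * 100 + 2 * ε := by
        rw [hε]; field_simp
      rw [this]; linarith
    linarith

theorem le_encard_N2 (h : 𝒯.Tri i j k) (h' : 𝒯.Tri i j k') (hkk' : k ≠ k') {N : ℕ}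
    (hN : L * (D + 2) * N ≤ 1 / 6000) :
    (N : ℕ∞) ≤ (N2 (tiling q) (tile (𝒯.label q) i) (tile (𝒯.label q) j)
        (tile (𝒯.label q) k) (tile (𝒯.label q) k')).encard := by
  have hD : 0 ≤ D := dist_nonneg.trans (hq 0)
  have hε0 : 0 < L * (D + 2) := by positivity
  -- Levels spaced by `3 * ε` in `η` make the coordinates of `k` differ by at least `6 * ε`, whereas
  -- points of one small tile differ by at most `2 * ε`; so distinct levels give distinct tiles. The
  -- bound on `N` keeps all levels below `1 / 2000`.
  have hex := fun r : Fin N => exists_mem_N2 hL hq hs h h' hkk' (η := 3 * (L * (D + 2)) * (r + 1))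
    (by
      have : (0 : ℝ) ≤ (r : ℕ) := by positivity
      nlinarith)
    (by
      have : ((r : ℕ) : ℝ) + 1 ≤ N := by exact_mod_cast r.2
      nlinarith)
  choose n y hy hn hmem using hex
  have hinj : Function.Injective fun r => tile q (q (n r)) := by
    have key : ∀ r s : Fin N, r < s → tile q (q (n r)) ≠ tile q (q (n s)) := by
      intro r s hrs he
      have hqq := tile_ref_injective he
      have h1 := dist_ref_le hq (hn r)
      have h2 := dist_ref_le hq (hn s)
      rw [hqq] at h1
      have h3 := dist_triangle_right (y r) (y s) (q (n s))
      have h4 := abs_le.1 (𝒯.lip k (y r) (y s))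
      have h5 : L * dist (y r) (y s) ≤ 2 * (L * (D + 2)) := by nlinarith
      rw [hy r, hy s] at h4
      have h8 : ((r : ℕ) : ℝ) + 1 ≤ (s : ℕ) := by exact_mod_cast hrs
      nlinarith
    intro r s he
    rcases lt_trichotomy r s with hlt | heq | hgt
    · exact absurd he (key r s hlt)
    · exact heq
    · exact absurd he.symm (key s r hgt)
  calc (N : ℕ∞) = (range fun r => tile q (q (n r))).encard := by
        rw [← image_univ, hinj.encard_image, encard_univ, ENat.card_eq_coe_fintype_card,
          Fintype.card_fin]
    _ ≤ _ := encard_le_encard (by rintro _ ⟨r, rfl⟩; exact hmem r)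

/-- There are fewer triples of small tiles near a vertex than small tiles along an edge. -/
theorem encard_N3_lt_encard_N2 {t₁ t₂ t₃ t₃' : Set Plane}
    (h : (t₁, t₂, t₃) ∈ triples (tiling (𝒯.label q)))
    (h' : (t₁, t₂, t₃') ∈ triples (tiling (𝒯.label q))) (hne : t₃ ≠ t₃') {C N : ℕ}
    (hC : 402 * (D + 2) ≤ C) (hCN : ((2 * C + 1) ^ 2) ^ 3 < N)
    (hN : L * (D + 2) * N ≤ 1 / 6000) :
    (N3 (tiling q) t₁ t₂ t₃).encard < (N2 (tiling q) t₁ t₂ t₃ t₃').encard := by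
  have hs' : L * (D + 2) ≤ 1 / 1000 := hs.trans (by norm_num)
  obtain ⟨h1, h2, h3, h12, h13, h23, y, ⟨hy1, hy2⟩, hy3⟩ := h
  obtain ⟨-, -, h3', -, h13', h23', y', ⟨hy1', hy2'⟩, hy3'⟩ := h'
  dsimp only at *
  obtain ⟨i, rfl, -⟩ := exists_eq_tile h1
  obtain ⟨j, rfl, -⟩ := exists_eq_tile h2
  obtain ⟨k, rfl, -⟩ := exists_eq_tile h3
  obtain ⟨k', rfl, -⟩ := exists_eq_tile h3'
  have hij : i ≠ j := fun e => h12 (e ▸ rfl)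
  have ht := tri_of_mem_tile hL hq hs' hij (fun e : i = k => h13 (e ▸ rfl))
    (fun e : j = k => h23 (e ▸ rfl)) hy1 hy2 hy3
  have ht' := tri_of_mem_tile hL hq hs' hij (fun e : i = k' => h13' (e ▸ rfl))
    (fun e : j = k' => h23' (e ▸ rfl)) hy1' hy2' hy3'
  exact (encard_N3_le hL hq hs ht hC).trans_lt (lt_of_lt_of_le (by exact_mod_cast hCN)
    (le_encard_N2 hL hq hs ht ht' (fun e => hne (e ▸ rfl)) hN))

end FatTriangulation

/-! ### Heights of inscribed triangles, and a Lipschitz bound from local to global. -/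

theorem Plane.norm_sq (p : Plane) : ‖p‖ ^ 2 = p 0 ^ 2 + p 1 ^ 2 := by
  rw [EuclideanSpace.real_norm_sq_eq, Fin.sum_univ_two]

/-- The height of a triangle inscribed in a circle of radius at most `2 * R`, with sides of length
at least `R`, is at least `R / 4`. -/
theorem Plane.height_le {X Y C : Plane} {R : ℝ} (hR : 0 < R) (hX : R ≤ ‖X‖) (hY : R ≤ ‖Y‖)
    (hXY : R ≤ ‖X - Y‖) (hXC : ‖X - C‖ = ‖C‖) (hYC : ‖Y - C‖ = ‖C‖) (hC : ‖C‖ ≤ 2 * R)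
    (s t : ℝ) : |s| * (R / 4) ≤ ‖s • X + t • Y‖ := by
  have eXC : ‖X - C‖ ^ 2 = ‖C‖ ^ 2 := by rw [hXC]
  have eYC : ‖Y - C‖ ^ 2 = ‖C‖ ^ 2 := by rw [hYC]
  have pY : 0 < ‖Y‖ := hR.trans_le hY
  set c := X 0 * Y 1 - X 1 * Y 0 with hc
  set v := ‖s • X + t • Y‖ with hv
  have nX := Plane.norm_sq X
  have nY := Plane.norm_sq Y
  have nC := Plane.norm_sq C
  have nXY := Plane.norm_sq (X - Y)
  have nv := Plane.norm_sq (s • X + t • Y)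
  rw [Plane.norm_sq, nC] at eXC eYC
  simp only [PiLp.sub_apply, PiLp.add_apply, PiLp.smul_apply, smul_eq_mul] at eXC eYC nXY nv
  have e1 : 2 * c * C 0 = ‖X‖ ^ 2 * Y 1 - ‖Y‖ ^ 2 * X 1 := by
    rw [nX, nY, hc]; linear_combination X 1 * eYC - Y 1 * eXC
  have e2 : 2 * c * C 1 = X 0 * ‖Y‖ ^ 2 - Y 0 * ‖X‖ ^ 2 := by
    rw [nX, nY, hc]; linear_combination Y 0 * eXC - X 0 * eYC
  -- The formula for the circumradius: the product of the sides is four times the area times the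
  -- radius, with `|c|` twice the area.
  have key : 4 * c ^ 2 * ‖C‖ ^ 2 = ‖X‖ ^ 2 * ‖Y‖ ^ 2 * ‖X - Y‖ ^ 2 := by
    have : 4 * c ^ 2 * ‖C‖ ^ 2 = (2 * c * C 0) ^ 2 + (2 * c * C 1) ^ 2 := by rw [nC]; ring
    rw [this, e1, e2, nXY, nX, nY]; ring
  have cs : s ^ 2 * c ^ 2 ≤ v ^ 2 * ‖Y‖ ^ 2 := by
    rw [hv, nv, nY, hc]
    nlinarith [sq_nonneg ((s * X 0 + t * Y 0) * Y 0 + (s * X 1 + t * Y 1) * Y 1)]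
  have h1 : R ^ 2 ≤ ‖X‖ ^ 2 := by gcongr
  have h2 : R ^ 2 ≤ ‖X - Y‖ ^ 2 := by gcongr
  have h3 : ‖C‖ ^ 2 ≤ (2 * R) ^ 2 := by gcongr
  have h4 : R ^ 2 * R ^ 2 ≤ ‖X‖ ^ 2 * ‖X - Y‖ ^ 2 := by gcongr
  have h5 : s ^ 2 * (R ^ 2 * R ^ 2) * ‖Y‖ ^ 2 ≤ v ^ 2 * (16 * R ^ 2) * ‖Y‖ ^ 2 := by
    calc s ^ 2 * (R ^ 2 * R ^ 2) * ‖Y‖ ^ 2 ≤ s ^ 2 * (‖X‖ ^ 2 * ‖X - Y‖ ^ 2) * ‖Y‖ ^ 2 := by gcongr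
      _ = s ^ 2 * c ^ 2 * (4 * ‖C‖ ^ 2) := by linear_combination (-s ^ 2) * key
      _ ≤ v ^ 2 * ‖Y‖ ^ 2 * (4 * (2 * R) ^ 2) := by gcongr
      _ = _ := by ring
  have h6 : s ^ 2 * (R ^ 2 * R ^ 2) ≤ v ^ 2 * (16 * R ^ 2) :=
    le_of_mul_le_mul_right h5 (by positivity)
  have h7 : (|s| * (R / 4)) ^ 2 ≤ v ^ 2 := by
    rw [mul_pow, sq_abs]
    have : s ^ 2 * R ^ 2 * R ^ 2 ≤ v ^ 2 * 16 * R ^ 2 := by linarith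
    have := le_of_mul_le_mul_right this (by positivity)
    linarith
  exact le_of_sq_le_sq h7 (norm_nonneg _)

/-- A function which is `K`-Lipschitz to first order at every point is `K`-Lipschitz. -/
theorem abs_sub_le_of_eventually {V : Type*} [NormedAddCommGroup V] [NormedSpace ℝ V] {f : V → ℝ}
    {K : ℝ} (h : ∀ x, ∀ᶠ y in 𝓝 x, |f y - f x| ≤ K * dist y x) (x y : V) :
    |f x - f y| ≤ K * dist x y := by
  have hcont : Continuous f := by
    refine continuous_iff_continuousAt.2 fun x => ?_
    rw [ContinuousAt, tendsto_iff_dist_tendsto_zero]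
    have h0 : Tendsto (fun y => K * dist y x) (𝓝 x) (𝓝 0) := by
      have : Continuous fun y => K * dist y x := by fun_prop
      simpa using this.tendsto x
    exact squeeze_zero' (Eventually.of_forall fun _ => dist_nonneg) (by
      filter_upwards [h x] with z hz
      rwa [Real.dist_eq]) h0
  let γ : ℝ → V := fun t => x + t • (y - x)
  have hγ : Continuous γ := by fun_prop
  have hγd : ∀ s t, dist (γ s) (γ t) = |s - t| * dist x y := by
    intro s t
    rw [dist_eq_norm, dist_comm x y, dist_eq_norm, ← Real.norm_eq_abs, ← norm_smul]
    congr 1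
    simp only [γ]; module
  -- Continuous induction along the segment: the bound is a closed condition, and the first-order
  -- estimate extends it to the right.
  let S : Set ℝ := {t | |f (γ t) - f x| ≤ K * (t * dist x y)}
  have hS : IsClosed (S ∩ Icc 0 1) := by
    refine (isClosed_le ?_ ?_).inter isClosed_Icc <;> fun_prop
  have hsub := hS.Icc_subset_of_forall_exists_gt (by simp [S, γ]) (by
    rintro t ⟨ht, ht0, ht1⟩ z hz
    have hev : ∀ᶠ s in 𝓝[>] t, |f (γ s) - f (γ t)| ≤ K * dist (γ s) (γ t) :=
      (hγ.continuousAt.eventually (h (γ t))).filter_mono nhdsWithin_le_nhds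
    obtain ⟨s, hs, hs'⟩ := (hev.and (Ioc_mem_nhdsGT hz)).exists
    refine ⟨s, ?_, hs'⟩
    rw [hγd, abs_of_pos (sub_pos.2 hs'.1)] at hs
    have := abs_add_le (f (γ s) - f (γ t)) (f (γ t) - f x)
    rw [sub_add_sub_cancel] at this
    have ht' : |f (γ t) - f x| ≤ K * (t * dist x y) := ht
    change |f (γ s) - f x| ≤ K * (s * dist x y)
    linarith)
  have := hsub (right_mem_Icc.2 zero_le_one)
  simpa [S, γ, abs_sub_comm] using this

/-! ### Nets, and uniqueness of Delaunay coordinates. -/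

/-- The points of `M` nearest to `c`. -/
def nearest (M : Set Plane) (c : Plane) : Set Plane := {p ∈ M | ∀ q ∈ M, dist c p ≤ dist c q}

/-- A net in general position: an `R`-separated set, `2 * R`-dense, with no point of the plane
having four nearest points in the set. -/
structure IsNet (M : Set Plane) (R : ℝ) : Prop where
  pos : 0 < R
  sep : ∀ p ∈ M, ∀ q ∈ M, p ≠ q → R ≤ dist p q
  cov : ∀ x, ∃ p ∈ M, dist x p ≤ 2 * R
  gen : ∀ c, (nearest M c).encard ≤ 3

namespace IsNet

variable {M : Set Plane} {R : ℝ} (hM : IsNet M R)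
include hM

/-- In a grid of mesh `R / 2` two points of one cell are less than `R` apart, so a cell holds at
most one net point. -/
theorem encard_inter_closedBall_le (x : Plane) {ρ : ℝ} {C : ℕ} (hC : 2 * ρ / R + 2 ≤ C) :
    (M ∩ Metric.closedBall x ρ).encard ≤ (((2 * C + 1) ^ 2 : ℕ) : ℕ∞) := by
  have hR := hM.pos
  let g : Plane → ℤ × ℤ := fun p => (⌊2 * p 0 / R⌋, ⌊2 * p 1 / R⌋)
  have hinj : InjOn g (M ∩ Metric.closedBall x ρ) := by
    intro p hp q hq he
    by_contra hne
    have hd := hM.sep p hp.1 q hq.1 hne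
    have hlt : ∀ i : Fin 2, ⌊2 * p i / R⌋ = ⌊2 * q i / R⌋ → |p i - q i| < R / 2 := by
      intro i hi
      have := Int.abs_sub_lt_one_of_floor_eq_floor hi
      have e : 2 * p i / R - 2 * q i / R = (p i - q i) * (2 / R) := by ring
      rw [e, abs_mul, abs_of_pos (by positivity : 0 < 2 / R), ← lt_div_iff₀ (by positivity)] at this
      simpa using this
    have := Plane.dist_le p q
    linarith [hlt 0 (congrArg Prod.fst he), hlt 1 (congrArg Prod.snd he)]
  rw [← hinj.encard_image]
  refine le_trans (encard_le_encard ?_) (encard_lattice_closedBall_le ((2 / R) • x) C)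
  rintro _ ⟨p, ⟨-, hp⟩, rfl⟩
  refine le_trans ?_ hC
  have h1 : dist (latticePoint (g p)) ((2 / R) • p) ≤ 2 := by
    refine (dist_comm _ _).trans_le (dist_latticePoint_le_of_mem_cell ?_)
    have e : ∀ i, ((2 / R) • p) i = 2 * p i / R := fun i => by
      rw [PiLp.smul_apply, smul_eq_mul]; ring
    simp only [cell, mem_ofPred_eq, e]
    exact ⟨Int.floor_le _, (Int.lt_floor_add_one _).le, Int.floor_le _, (Int.lt_floor_add_one _).le⟩
  have h2 : dist ((2 / R) • p) ((2 / R) • x) ≤ 2 * ρ / R := by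
    rw [dist_smul₀, Real.norm_eq_abs, abs_of_pos (by positivity), div_mul_eq_mul_div]
    have := Metric.mem_closedBall.1 hp
    gcongr
  linarith [dist_triangle (latticePoint (g p)) ((2 / R) • p) ((2 / R) • x)]

theorem finite_inter_closedBall (x : Plane) (ρ : ℝ) : (M ∩ Metric.closedBall x ρ).Finite := by
  obtain ⟨C, hC⟩ := exists_nat_ge (2 * ρ / R + 2)
  exact finite_of_encard_le_coe (hM.encard_inter_closedBall_le x hC)

theorem dist_le_of_mem_nearest {c p : Plane} (hp : p ∈ nearest M c) : dist c p ≤ 2 * R := by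
  obtain ⟨q, hq, hq'⟩ := hM.cov c
  exact (hp.2 q hq).trans hq'

theorem nearest_nonempty (c : Plane) : (nearest M c).Nonempty := by
  obtain ⟨q, hq, hq'⟩ := hM.cov c
  obtain ⟨p, hp, hmin⟩ := exists_min_image _ (dist c) (hM.finite_inter_closedBall c (2 * R))
    ⟨q, hq, by rwa [Metric.mem_closedBall, dist_comm]⟩
  refine ⟨p, hp.1, fun r hr => ?_⟩
  by_cases h : dist c r ≤ 2 * R
  · exact hmin r ⟨hr, by rwa [Metric.mem_closedBall, dist_comm]⟩
  · exact (by simpa [dist_comm] using hp.2 : dist c p ≤ 2 * R).trans (not_le.1 h).le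

theorem finite_nearest (c : Plane) : (nearest M c).Finite :=
  finite_of_encard_le_coe (hM.gen c)

/-- Quantitative affine independence of the points of a Delaunay simplex, from the height bound for
triangles. Applied to a difference of two coordinate systems it gives both uniqueness and the
Lipschitz constant `4 / R`. -/
theorem abs_mul_le_norm_sum {c : Plane} {δ : Plane →₀ ℝ} (hδ : ∀ p ∈ δ.support, p ∈ nearest M c)
    (h0 : (δ.sum fun _ a => a) = 0) (p : Plane) :
    |δ p| * (R / 4) ≤ ‖δ.sum fun p a => a • p‖ := by
  classical
  set S := (hM.finite_nearest c).toFinset with hS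
  have hSmem : ∀ q ∈ S, q ∈ nearest M c := fun q hq => by simpa [hS] using hq
  have hcard : S.card ≤ 3 := by
    have := hM.gen c
    rw [(hM.finite_nearest c).encard_eq_coe_toFinset_card] at this
    exact_mod_cast this
  have hsub : δ.support ⊆ S := fun q hq => by simpa [hS] using hδ q hq
  by_cases hp : p ∈ S
  swap
  · have : δ p = 0 := by
      by_contra h
      exact hp (hsub (Finsupp.mem_support_iff.2 h))
    simp [this]
  rw [Finsupp.sum_of_support_subset _ hsub _ (by simp)] at h0 ⊢
  obtain ⟨S', hpS', hSS'⟩ : ∃ S', p ∉ S' ∧ insert p S' = S :=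
    ⟨S.erase p, Finset.notMem_erase _ _, Finset.insert_erase hp⟩
  rw [← hSS', Finset.card_insert_of_notMem hpS'] at hcard
  rw [← hSS', Finset.sum_insert hpS'] at h0 ⊢
  have hR := hM.pos
  have hcases : S'.card = 0 ∨ S'.card = 1 ∨ S'.card = 2 := by omega
  have hpM := hSmem p hp
  rcases hcases with h | h | h
  · rw [Finset.card_eq_zero] at h
    simp only [h, Finset.sum_empty, add_zero] at h0
    simp [h0]
  · obtain ⟨a, rfl⟩ := Finset.card_eq_one.1 h
    have haM := hSmem a (by rw [← hSS']; simp)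
    rw [Finset.sum_singleton] at h0 ⊢
    have e : δ p • p + δ a • a = δ p • (p - a) := by
      rw [show δ a = -δ p by linarith]; module
    rw [e, norm_smul, Real.norm_eq_abs, ← dist_eq_norm]
    have := hM.sep p hpM.1 a haM.1 (by rintro rfl; simp at hpS')
    gcongr
    linarith
  · obtain ⟨a, b, hab, rfl⟩ := Finset.card_eq_two.1 h
    have haM := hSmem a (by rw [← hSS']; simp)
    have hbM := hSmem b (by rw [← hSS']; simp)
    simp only [Finset.mem_insert, Finset.mem_singleton, not_or] at hpS'
    rw [Finset.sum_pair hab] at h0 ⊢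
    have e : δ p • p + (δ a • a + δ b • b) = δ p • (p - b) + δ a • (a - b) := by
      rw [show δ b = -δ p - δ a by linarith]; module
    rw [e]
    have hd : ∀ {r s}, r ∈ nearest M c → s ∈ nearest M c → dist c r = dist c s :=
      fun hr hs => le_antisymm (hr.2 _ hs.1) (hs.2 _ hr.1)
    refine Plane.height_le (C := c - b) hR ?_ ?_ ?_ ?_ ?_ ?_ _ _
    · rw [← dist_eq_norm]; exact hM.sep p hpM.1 b hbM.1 hpS'.2
    · rw [← dist_eq_norm]; exact hM.sep a haM.1 b hbM.1 hab
    · rw [sub_sub_sub_cancel_right, ← dist_eq_norm]; exact hM.sep p hpM.1 a haM.1 hpS'.1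
    · rw [sub_sub_sub_cancel_right, ← dist_eq_norm, ← dist_eq_norm, dist_comm]
      exact hd hpM hbM
    · rw [sub_sub_sub_cancel_right, ← dist_eq_norm, ← dist_eq_norm, dist_comm]
      exact hd haM hbM
    · rw [← dist_eq_norm]; exact hM.dist_le_of_mem_nearest hbM

end IsNet

/-- `κ` is a system of barycentric coordinates of `y` in a Delaunay simplex of `M`. -/
structure IsDelaunayCoord (M : Set Plane) (y : Plane) (κ : Plane →₀ ℝ) : Prop where
  nonneg : ∀ p, 0 ≤ κ p
  sum : (κ.sum fun _ a => a) = 1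
  eq : (κ.sum fun p a => a • p) = y
  supp : ∃ c, ∀ p ∈ κ.support, p ∈ nearest M c

theorem sum_affine_of_sum_eq_one {κ : Plane →₀ ℝ} (h : (κ.sum fun _ a => a) = 1) (α : ℝ) (β : Plane) :
    (κ.sum fun p a => a * (α + inner ℝ β p)) = α + inner ℝ β (κ.sum fun p a => a • p) := by
  simp only [Finsupp.sum, mul_add, Finset.sum_add_distrib, inner_sum, inner_smul_right] at *
  rw [← Finset.sum_mul, h, one_mul]

namespace IsNet

variable {M : Set Plane} {R : ℝ} (hM : IsNet M R)
include hM

-- The difference of the powers of a point with respect to the two empty circles is an affine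
-- function. It is at most `0` on the vertices of `κ` and at least `0` on those of `μ`, so its value
-- at `y` is `0`, and each vertex of positive weight in `κ` lies on the second circle too.
omit hM in
theorem mem_nearest_of_coord {y c c' : Plane} {κ μ : Plane →₀ ℝ}
    (hκ : IsDelaunayCoord M y κ) (hμ : IsDelaunayCoord M y μ)
    (hc : ∀ p ∈ κ.support, p ∈ nearest M c) (hc' : ∀ p ∈ μ.support, p ∈ nearest M c') :
    ∀ p ∈ κ.support, p ∈ nearest M c' := by
  have hne : ∀ {ν : Plane →₀ ℝ}, (ν.sum fun _ a => a) = 1 → ν.support.Nonempty := by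
    intro ν h
    by_contra hcon
    rw [Finset.not_nonempty_iff_eq_empty] at hcon
    simp [Finsupp.sum, hcon] at h
  obtain ⟨p₀, hp₀⟩ := hne hκ.sum
  obtain ⟨q₀, hq₀⟩ := hne hμ.sum
  have np := hc p₀ hp₀
  have nq := hc' q₀ hq₀
  set α : ℝ := ‖c‖ ^ 2 - ‖c'‖ ^ 2 - (dist c p₀ ^ 2 - dist c' q₀ ^ 2) with hα
  set β : Plane := (2 : ℝ) • (c' - c) with hβ
  have hg : ∀ z, α + inner ℝ β z = dist c z ^ 2 - dist c' z ^ 2 - (dist c p₀ ^ 2 - dist c' q₀ ^ 2) := by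
    intro z
    rw [dist_eq_norm c z, dist_eq_norm c' z, norm_sub_sq_real, norm_sub_sq_real, hβ, hα, inner_smul_left,
      inner_sub_left]
    simp only [conj_trivial]
    ring
  have hκ' := sum_affine_of_sum_eq_one hκ.sum α β
  have hμ' := sum_affine_of_sum_eq_one hμ.sum α β
  rw [hκ.eq] at hκ'
  rw [hμ.eq] at hμ'
  have hsq : ∀ {a b : ℝ}, 0 ≤ a → a ≤ b → a ^ 2 ≤ b ^ 2 := fun ha hab => by gcongr
  have hle : ∀ p ∈ κ.support, κ p * (α + inner ℝ β p) ≤ 0 := by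
    intro p hp
    have h1 := hc p hp
    refine mul_nonpos_of_nonneg_of_nonpos (hκ.nonneg p) ?_
    rw [hg]
    have := hsq dist_nonneg (h1.2 p₀ np.1)
    have := hsq dist_nonneg (nq.2 p h1.1)
    linarith
  have hge : 0 ≤ μ.sum fun p a => a * (α + inner ℝ β p) := by
    refine Finset.sum_nonneg fun p hp => mul_nonneg (hμ.nonneg p) ?_
    have h1 := hc' p hp
    rw [hg]
    have := hsq dist_nonneg (h1.2 q₀ nq.1)
    have := hsq dist_nonneg (np.2 p h1.1)
    linarith
  have hzero : ∑ p ∈ κ.support, κ p * (α + inner ℝ β p) = 0 :=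
    le_antisymm (Finset.sum_nonpos hle) (by
      rw [hμ', ← hκ'] at hge
      exact hge)
  intro p hp
  have h1 := hc p hp
  have h2 := (Finset.sum_eq_zero_iff_of_nonpos hle).1 hzero p hp
  rcases mul_eq_zero.1 h2 with h | h
  · exact absurd h (Finsupp.mem_support_iff.1 hp)
  · rw [hg, le_antisymm (h1.2 p₀ np.1) (np.2 p h1.1)] at h
    have h3 : dist c' p ^ 2 = dist c' q₀ ^ 2 := by linarith
    have h4 : dist c' p = dist c' q₀ := (sq_eq_sq₀ dist_nonneg dist_nonneg).1 h3
    exact ⟨h1.1, fun r hr => h4 ▸ nq.2 r hr⟩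

theorem abs_coord_sub_mul_le {x y c : Plane} {κ μ : Plane →₀ ℝ}
    (hκ : IsDelaunayCoord M x κ) (hμ : IsDelaunayCoord M y μ)
    (hc : ∀ p ∈ κ.support, p ∈ nearest M c) (hc' : ∀ p ∈ μ.support, p ∈ nearest M c) (p : Plane) :
    |κ p - μ p| * (R / 4) ≤ dist x y := by
  classical
  have h := hM.abs_mul_le_norm_sum (c := c) (δ := κ - μ) (fun p hp => by
      rcases Finset.mem_union.1 (Finsupp.support_sub hp) with h | h
      exacts [hc p h, hc' p h])
    (by rw [Finsupp.sum_sub_index (by simp), hκ.sum, hμ.sum, sub_self]) p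
  rwa [Finsupp.sum_sub_index (by simp [sub_smul]), hκ.eq, hμ.eq, ← dist_eq_norm,
    Finsupp.sub_apply] at h

theorem coord_unique {y : Plane} {κ μ : Plane →₀ ℝ}
    (hκ : IsDelaunayCoord M y κ) (hμ : IsDelaunayCoord M y μ) : κ = μ := by
  obtain ⟨c, hc⟩ := hκ.supp
  obtain ⟨c', hc'⟩ := hμ.supp
  ext p
  have h := hM.abs_coord_sub_mul_le hκ hμ (mem_nearest_of_coord hκ hμ hc hc') hc' p
  rw [dist_self] at h
  have hR := hM.pos
  have : |κ p - μ p| = 0 := le_antisymm (by nlinarith [abs_nonneg (κ p - μ p)]) (abs_nonneg _)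
  linarith [abs_eq_zero.1 this]

end IsNet

/-! ### Existence and incidences of the Delaunay triangulation. -/

theorem isDelaunayCoord_onFinset {M : Set Plane} {c : Plane} {s : Finset Plane} {f : Plane → ℝ}
    (hs : ∀ p ∈ s, p ∈ nearest M c) (hf : ∀ p ∈ s, 0 ≤ f p) (hsum : ∑ p ∈ s, f p = 1) :
    IsDelaunayCoord M (∑ p ∈ s, f p • p) (Finsupp.indicator s fun p _ => f p) := by
  classical
  have hsub := Finsupp.support_indicator_subset s fun p _ => f p
  refine ⟨fun p => ?_, ?_, ?_, c, fun p hp => hs p (hsub hp)⟩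
  · rw [Finsupp.indicator_apply]
    split_ifs with h
    exacts [hf p h, le_rfl]
  · rw [Finsupp.sum_of_support_subset _ hsub _ (by simp), ← hsum]
    exact Finset.sum_congr rfl fun p hp => by simp [hp]
  · rw [Finsupp.sum_of_support_subset _ hsub _ (by simp)]
    exact Finset.sum_congr rfl fun p hp => by simp [hp]

open scoped Classical in
/-- The barycentric coordinates of `y` in the Delaunay triangulation of `M`. -/
noncomputable def delaunayCoord (M : Set Plane) (y : Plane) : Plane →₀ ℝ :=
  if h : ∃ κ, IsDelaunayCoord M y κ then h.choose else 0

/-- The vertex sets of the triangles of the Delaunay triangulation of `M`. -/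
def IsTriangle (M : Set Plane) (τ : Finset Plane) : Prop :=
  τ.card = 3 ∧ ∃ c, (τ : Set Plane) = nearest M c

theorem Plane.inner_eq (p q : Plane) : inner ℝ p q = p 0 * q 0 + p 1 * q 1 := by
  rw [PiLp.inner_apply, Fin.sum_univ_two]
  simp [mul_comm]

theorem Plane.exists_eq_smul_add {e u : Plane} (he : e ≠ 0) (hu : u ≠ 0) (heu : inner ℝ u e = 0)
    (w : Plane) : ∃ α : ℝ, w = α • e + (inner ℝ u w / ‖u‖ ^ 2) • u := by
  have he' : 0 < ‖e‖ ^ 2 := by positivity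
  have hu' : 0 < ‖u‖ ^ 2 := by positivity
  refine ⟨inner ℝ e w / ‖e‖ ^ 2, ?_⟩
  set z : Plane := w - ((inner ℝ e w / ‖e‖ ^ 2) • e + (inner ℝ u w / ‖u‖ ^ 2) • u) with hz
  have hue : inner ℝ e u = 0 := by rw [real_inner_comm]; exact heu
  have h1 : inner ℝ e z = 0 := by
    rw [hz, inner_sub_right, inner_add_right, inner_smul_right, inner_smul_right, hue,
      real_inner_self_eq_norm_sq]
    field_simp; ring
  have h2 : inner ℝ u z = 0 := by
    rw [hz, inner_sub_right, inner_add_right, inner_smul_right, inner_smul_right, heu,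
      real_inner_self_eq_norm_sq]
    field_simp; ring
  rw [Plane.inner_eq] at h1 h2 heu
  rw [Plane.norm_sq] at he' hu'
  have hdet : e 0 * u 1 - e 1 * u 0 ≠ 0 := by
    intro h
    have : (e 0 ^ 2 + e 1 ^ 2) * (u 0 ^ 2 + u 1 ^ 2) =
      (e 0 * u 1 - e 1 * u 0) ^ 2 + (u 0 * e 0 + u 1 * e 1) ^ 2 := by ring
    rw [h, heu] at this
    have hp := mul_pos he' hu'
    rw [this] at hp
    norm_num at hp
  have z0 : z 0 = 0 := by
    have : (e 0 * u 1 - e 1 * u 0) * z 0 = 0 := by linear_combination u 1 * h1 - e 1 * h2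
    exact (mul_eq_zero.1 this).resolve_left hdet
  have z1 : z 1 = 0 := by
    have : (e 0 * u 1 - e 1 * u 0) * z 1 = 0 := by linear_combination e 0 * h2 - u 0 * h1
    exact (mul_eq_zero.1 this).resolve_left hdet
  exact sub_eq_zero.1 (Plane.ext_coord (p := z) (q := 0) (by simpa using z0) (by simpa using z1))

theorem Plane.exists_ne_zero_inner_eq_zero (e : Plane) : ∃ u : Plane, u ≠ 0 ∧ inner ℝ u e = 0 := by
  by_cases he : e = 0
  · refine ⟨!₂[1, 0], fun h => ?_, by simp [he]⟩
    simpa using congrArg (fun v : Plane => v 0) h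
  · refine ⟨!₂[-e 1, e 0], fun h => he ?_, by rw [Plane.inner_eq]; simp; ring⟩
    have h0 := congrArg (fun v : Plane => v 0) h
    have h1 := congrArg (fun v : Plane => v 1) h
    exact Plane.ext_coord (by simpa using h1) (by simpa using h0)

theorem infDist_eq_of_mem_nearest {M : Set Plane} {c p : Plane} (hp : p ∈ nearest M c) : Metric.infDist c M = dist c p :=
  le_antisymm (Metric.infDist_le_dist_of_mem hp.1)
    ((Metric.le_infDist ⟨p, hp.1⟩).2 fun {q} hq => hp.2 q hq)

theorem IsTriangle.eq_insert [DecidableEq Plane] {M : Set Plane} {τ : Finset Plane} (hτ : IsTriangle M τ)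
    {p q r : Plane} (hp : p ∈ τ) (hq : q ∈ τ) (hr : r ∈ τ) (hpq : p ≠ q) (hpr : p ≠ r)
    (hqr : q ≠ r) : τ = {p, q, r} := by
  refine (Finset.eq_of_subset_of_card_le ?_ ?_).symm
  · intro z hz
    simp only [Finset.mem_insert, Finset.mem_singleton] at hz
    rcases hz with rfl | rfl | rfl <;> assumption
  · rw [hτ.1, Finset.card_eq_three.2 ⟨p, q, r, hpq, hpr, hqr, rfl⟩]

theorem IsTriangle.mem_nearest {M : Set Plane} {τ : Finset Plane} (hτ : IsTriangle M τ) :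
    ∃ c, ∀ p ∈ τ, p ∈ nearest M c := by
  obtain ⟨-, c, hc⟩ := hτ
  exact ⟨c, fun p hp => hc ▸ hp⟩

namespace IsNet

variable {M : Set Plane} {R : ℝ} (hM : IsNet M R)
include hM

/-- The required centre maximises `φ`. If `y` were outside the hull of the points nearest to a
maximiser, moving the centre along a separating direction would increase `φ`. -/
theorem exists_mem_convexHull_nearest (y : Plane) :
    ∃ c, y ∈ convexHull ℝ (nearest M c) := by
  have hR := hM.pos
  let φ : Plane → ℝ := fun c => Metric.infDist c M ^ 2 - dist y c ^ 2
  have hφ : Continuous φ := by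
    have := Metric.continuous_infDist_pt M
    fun_prop
  obtain ⟨c, -, hc⟩ := (isCompact_closedBall y (2 * R)).exists_isMaxOn
    ⟨y, Metric.mem_closedBall_self (by positivity)⟩ hφ.continuousOn
  -- Away from the ball the distance to `M` is at most `2 * R` and the distance to `y` exceeds it,
  -- so `φ` is nonpositive there, while `φ y ≥ 0`.
  have hmax : ∀ c', φ c' ≤ φ c := by
    intro c'
    by_cases h : dist c' y ≤ 2 * R
    · exact hc h
    · push Not at h
      have h0 : φ y ≤ φ c := hc (Metric.mem_closedBall_self (by positivity))
      obtain ⟨p, hp⟩ := hM.nearest_nonempty c'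
      have h1 := hM.dist_le_of_mem_nearest hp
      rw [← infDist_eq_of_mem_nearest hp] at h1
      have h2 : φ c' ≤ 0 := by
        simp only [φ]
        rw [dist_comm y c']
        have := Metric.infDist_nonneg (x := c') (s := M)
        nlinarith
      have h3 : 0 ≤ φ y := by simp only [φ, dist_self]; linarith [sq_nonneg (Metric.infDist y M)]
      linarith
  refine ⟨c, ?_⟩
  by_contra hy
  obtain ⟨f, u, hf, hfy⟩ := geometric_hahn_banach_closed_point (convex_convexHull ℝ (nearest M c))
    ((hM.finite_nearest c).isClosed_convexHull ℝ) hy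
  set v := (InnerProductSpace.toDual ℝ Plane).symm f with hv
  have hvf : ∀ z, inner ℝ v z = f z := fun z => by
    rw [hv, InnerProductSpace.toDual_symm_apply]
  have hneg : ∀ p ∈ nearest M c, inner ℝ v (p - y) < 0 := fun p hp => by
    rw [hvf, map_sub]
    linarith [hf p (subset_convexHull ℝ _ hp)]
  -- The quadratic terms in the centre cancel: each net point contributes an affine function of `t`.
  have hexp : ∀ (p : Plane) (t : ℝ), dist (c + t • v) p ^ 2 - dist y (c + t • v) ^ 2 =
      dist c p ^ 2 - dist y c ^ 2 - 2 * t * inner ℝ v (p - y) := by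
    intro p t
    rw [dist_comm y, dist_comm y]
    simp only [dist_eq_norm]
    rw [add_sub_right_comm c _ p, norm_add_sq_real, add_sub_right_comm c _ y, norm_add_sq_real]
    simp only [inner_smul_right, inner_sub_right, real_inner_comm v]
    ring
  have hstep : ∀ p ∈ M ∩ Metric.closedBall c (2 * R + 1),
      ∀ᶠ t in 𝓝[>] (0 : ℝ), φ c < dist (c + t • v) p ^ 2 - dist y (c + t • v) ^ 2 := by
    rintro p ⟨hp, -⟩
    simp only [hexp]
    by_cases hpn : p ∈ nearest M c
    · filter_upwards [self_mem_nhdsWithin] with t ht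
      have h1 : 0 < t := ht
      have := hneg p hpn
      simp only [φ, infDist_eq_of_mem_nearest hpn]
      nlinarith
    · obtain ⟨q, hq⟩ := hM.nearest_nonempty c
      have hlt : dist c q < dist c p := by
        by_contra hcon
        push Not at hcon
        exact hpn ⟨hp, fun r hr => hcon.trans (hq.2 r hr)⟩
      have hcont : Continuous fun t : ℝ =>
          dist c p ^ 2 - dist y c ^ 2 - 2 * t * inner ℝ v (p - y) := by fun_prop
      refine (hcont.tendsto 0).eventually (lt_mem_nhds ?_) |>.filter_mono nhdsWithin_le_nhds
      simp only [φ, infDist_eq_of_mem_nearest hq]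
      have := dist_nonneg (x := c) (y := q)
      nlinarith
  have hnear : ∀ᶠ t in 𝓝[>] (0 : ℝ), dist (c + t • v) c < 1 := by
    have hcont : Continuous fun t : ℝ => dist (c + t • v) c := by fun_prop
    exact (hcont.tendsto 0).eventually (gt_mem_nhds (by simp)) |>.filter_mono nhdsWithin_le_nhds
  obtain ⟨t, ht1, ht2⟩ := (hnear.and ((eventually_all_finite
    (hM.finite_inter_closedBall c (2 * R + 1))).2 hstep)).exists
  obtain ⟨p, hp⟩ := hM.nearest_nonempty (c + t • v)
  have hpd := hM.dist_le_of_mem_nearest hp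
  have h1 := ht2 p ⟨hp.1, by
    have := dist_triangle_left p c (c + t • v)
    rw [Metric.mem_closedBall]; linarith⟩
  have h2 := hmax (c + t • v)
  simp only [φ, infDist_eq_of_mem_nearest hp] at h2 h1
  linarith

theorem isDelaunayCoord (y : Plane) : IsDelaunayCoord M y (delaunayCoord M y) := by
  classical
  have h : ∃ κ, IsDelaunayCoord M y κ := by
    obtain ⟨c, hc⟩ := hM.exists_mem_convexHull_nearest y
    rw [← (hM.finite_nearest c).coe_toFinset, Finset.mem_convexHull'] at hc
    obtain ⟨w, hw0, hw1, rfl⟩ := hc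
    exact ⟨_, isDelaunayCoord_onFinset (c := c) (by simp) hw0 hw1⟩
  rw [delaunayCoord, dif_pos h]
  exact h.choose_spec

theorem delaunayCoord_eq {y : Plane} {κ : Plane →₀ ℝ} (h : IsDelaunayCoord M y κ) :
    delaunayCoord M y = κ := hM.coord_unique (hM.isDelaunayCoord y) h

theorem delaunayCoord_sum {c : Plane} {s : Finset Plane} {f : Plane → ℝ}
    (hs : ∀ p ∈ s, p ∈ nearest M c) (hf : ∀ p ∈ s, 0 ≤ f p) (hsum : ∑ p ∈ s, f p = 1) :
    delaunayCoord M (∑ p ∈ s, f p • p) = Finsupp.indicator s fun p _ => f p :=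
  hM.delaunayCoord_eq (isDelaunayCoord_onFinset hs hf hsum)

theorem exists_support_subset (y : Plane) :
    ∃ c, dist y c ≤ 2 * R ∧ ∀ p ∈ (delaunayCoord M y).support, p ∈ nearest M c := by
  have h := hM.isDelaunayCoord y
  obtain ⟨c, hc⟩ := h.supp
  refine ⟨c, ?_, hc⟩
  have : y ∈ Metric.closedBall c (2 * R) := by
    rw [← h.eq]
    exact (convex_closedBall c (2 * R)).sum_mem (fun p _ => h.nonneg p) h.sum fun p hp => by
      rw [Metric.mem_closedBall, dist_comm]; exact hM.dist_le_of_mem_nearest (hc p hp)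
  exact this

theorem dist_le_of_mem_support {y p : Plane} (hp : p ∈ (delaunayCoord M y).support) :
    dist p y ≤ 4 * R := by
  obtain ⟨c, h1, h2⟩ := hM.exists_support_subset y
  have := hM.dist_le_of_mem_nearest (h2 p hp)
  linarith [dist_triangle_right p y c, dist_comm c p]

theorem mem_of_mem_support {y p : Plane} (hp : p ∈ (delaunayCoord M y).support) : p ∈ M := by
  obtain ⟨c, -, h2⟩ := hM.exists_support_subset y
  exact (h2 p hp).1

/-- Only finitely many simplices come near `x`, and they are closed, so the simplex of any `y` close
enough to `x` also contains `x`. Within one simplex the estimate is `abs_coord_sub_mul_le`, and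
`abs_sub_le_of_eventually` makes it global. -/
theorem abs_delaunayCoord_sub_le (p x y : Plane) :
    |delaunayCoord M x p - delaunayCoord M y p| ≤ 4 / R * dist x y := by
  classical
  have hR := hM.pos
  refine abs_sub_le_of_eventually (f := fun y => delaunayCoord M y p) (fun x => ?_) x y
  set A := (hM.finite_inter_closedBall x (4 * R + 1)).toFinset
  have hopen : ∀ F ∈ A.powerset, ∀ᶠ y in 𝓝 x,
      y ∈ convexHull ℝ (F : Set Plane) → x ∈ convexHull ℝ (F : Set Plane) := by
    intro F _
    by_cases hx : x ∈ convexHull ℝ (F : Set Plane)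
    · exact Eventually.of_forall fun _ _ => hx
    · filter_upwards [(F.finite_toSet.isClosed_convexHull ℝ).isOpen_compl.mem_nhds hx] with y hy hy'
      exact absurd hy' hy
  filter_upwards [(Filter.eventually_all_finset A.powerset).2 hopen, Metric.ball_mem_nhds x one_pos]
    with y hy hyx
  have hDy := hM.isDelaunayCoord y
  obtain ⟨c, hc⟩ := hDy.supp
  set F := (delaunayCoord M y).support with hF
  have hFA : F ∈ A.powerset := by
    rw [Finset.mem_powerset]
    intro q hq
    have h1 := hM.dist_le_of_mem_support hq
    rw [Finite.mem_toFinset]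
    refine ⟨hM.mem_of_mem_support hq, ?_⟩
    rw [Metric.mem_closedBall]
    linarith [dist_triangle q y x, Metric.mem_ball.1 hyx]
  have hyF : y ∈ convexHull ℝ (F : Set Plane) := by
    rw [Finset.mem_convexHull']
    exact ⟨_, fun q _ => hDy.nonneg q, hDy.sum, hDy.eq⟩
  have hxF := hy F hFA hyF
  rw [Finset.mem_convexHull'] at hxF
  obtain ⟨w, hw0, hw1, hw2⟩ := hxF
  have hcoord := isDelaunayCoord_onFinset hc hw0 hw1
  rw [hw2] at hcoord
  rw [hM.delaunayCoord_eq hcoord]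
  have := hM.abs_coord_sub_mul_le hDy hcoord hc
    (fun q hq => hc q (Finsupp.support_indicator_subset F (fun p _ => w p) hq)) p
  rw [div_mul_eq_mul_div, le_div_iff₀ hR]
  linarith

theorem continuous_delaunayCoord (p : Plane) : Continuous fun y => delaunayCoord M y p := by
  refine (LipschitzWith.of_dist_le_mul (K := Real.toNNReal (4 / R)) fun x y => ?_).continuous
  rw [Real.dist_eq, Real.coe_toNNReal _ (by have := hM.pos; positivity)]
  exact hM.abs_delaunayCoord_sub_le p x y

theorem sum_inner_sub {y : Plane} (u p : Plane) :
    ∑ r ∈ (delaunayCoord M y).support, delaunayCoord M y r * inner ℝ u (r - p) =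
      inner ℝ u (y - p) := by
  have h := hM.isDelaunayCoord y
  have := sum_affine_of_sum_eq_one h.sum (-inner ℝ u p) u
  rw [h.eq] at this
  rw [inner_sub_right, sub_eq_neg_add, ← this]
  exact Finset.sum_congr rfl fun r _ => by rw [inner_sub_right, sub_eq_neg_add]

theorem isTriangle_of_mem {c p q r : Plane} [DecidableEq Plane] (hp : p ∈ nearest M c)
    (hq : q ∈ nearest M c) (hr : r ∈ nearest M c) (hpq : p ≠ q) (hpr : p ≠ r) (hqr : q ≠ r) :
    IsTriangle M {p, q, r} := by
  have hcard : ({p, q, r} : Finset Plane).card = 3 := Finset.card_eq_three.2 ⟨p, q, r, hpq, hpr, hqr, rfl⟩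
  refine ⟨hcard, c, ?_⟩
  refine (Finset.finite_toSet _).eq_of_subset_of_encard_le ?_ ?_
  · intro z hz
    simp only [Finset.coe_insert, Finset.coe_singleton, mem_insert_iff, mem_singleton_iff] at hz
    rcases hz with rfl | rfl | rfl <;> assumption
  · rw [encard_coe_eq_coe_finsetCard, hcard]
    exact hM.gen c

theorem eventually_pos {y u p : Plane} (h : 0 < delaunayCoord M y p) :
    ∀ᶠ t in 𝓝[>] (0 : ℝ), 0 < delaunayCoord M (y + t • u) p := by
  have hcont : Continuous fun t : ℝ => delaunayCoord M (y + t • u) p :=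
    (hM.continuous_delaunayCoord p).comp (by fun_prop)
  exact (hcont.tendsto 0).eventually (lt_mem_nhds (by simpa using h))
    |>.filter_mono nhdsWithin_le_nhds

/-- An edge of the Delaunay triangulation is in a triangle on each of its sides. -/
theorem exists_isTriangle_side {y p q u : Plane} (hpq : p ≠ q) (hp : 0 < delaunayCoord M y p)
    (hq : 0 < delaunayCoord M y q) (hu : u ≠ 0) (huq : inner ℝ u (q - p) = 0)
    (hy : 0 ≤ inner ℝ u (y - p)) :
    ∃ τ, IsTriangle M τ ∧ p ∈ τ ∧ q ∈ τ ∧ ∃ r ∈ τ, 0 < inner ℝ u (r - p) := by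
  classical
  -- Push `y` slightly in direction `u`. The vertices `p` and `q` keep positive weight, and being
  -- strictly on the positive side of their line forces a third vertex on that side into the
  -- support.
  obtain ⟨t, ⟨hp', hq'⟩, ht⟩ := (((hM.eventually_pos (u := u) hp).and
    (hM.eventually_pos (u := u) hq)).and self_mem_nhdsWithin).exists
  have ht : 0 < t := ht
  have hz : 0 < inner ℝ u (y + t • u - p) := by
    rw [add_sub_right_comm, inner_add_right, inner_smul_right, real_inner_self_eq_norm_sq]
    have : 0 < t * ‖u‖ ^ 2 := by positivity
    linarith
  rw [← hM.sum_inner_sub] at hz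
  obtain ⟨r, hr, hr'⟩ := Finset.exists_lt_of_sum_lt (s := (delaunayCoord M (y + t • u)).support)
    (f := fun _ => (0 : ℝ))
    (g := fun r => delaunayCoord M (y + t • u) r * inner ℝ u (r - p)) (by simpa using hz)
  have hrpos := (hM.isDelaunayCoord (y + t • u)).nonneg r
  have hur : 0 < inner ℝ u (r - p) := by
    by_contra hcon
    push Not at hcon
    have := mul_nonpos_of_nonneg_of_nonpos hrpos hcon
    linarith
  obtain ⟨c, hc⟩ := (hM.isDelaunayCoord (y + t • u)).supp
  refine ⟨{p, q, r}, hM.isTriangle_of_mem (hc p (Finsupp.mem_support_iff.2 hp'.ne'))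
    (hc q (Finsupp.mem_support_iff.2 hq'.ne')) (hc r hr) hpq ?_ ?_, by simp, by simp, r, by simp, hur⟩
  · rintro rfl; simp at hur
  · rintro rfl; rw [huq] at hur; exact lt_irrefl _ hur

/-- Every Delaunay simplex is a face of a triangle. -/
theorem exists_isTriangle_support_subset (y : Plane) :
    ∃ τ, IsTriangle M τ ∧ (delaunayCoord M y).support ⊆ τ := by
  classical
  have h := hM.isDelaunayCoord y
  obtain ⟨c, hc⟩ := h.supp
  set F := (delaunayCoord M y).support with hF
  have hpos : ∀ p ∈ F, 0 < delaunayCoord M y p := fun p hp =>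
    lt_of_le_of_ne (h.nonneg p) (Finsupp.mem_support_iff.1 hp).symm
  have hFne : F.Nonempty := by
    by_contra hcon
    rw [Finset.not_nonempty_iff_eq_empty] at hcon
    have := h.sum
    simp [Finsupp.sum, ← hF, hcon] at this
  have hcard : F.card ≤ 3 := by
    have h1 : (F : Set Plane).encard ≤ 3 := (encard_le_encard fun p hp => hc p hp).trans (hM.gen c)
    rw [encard_coe_eq_coe_finsetCard] at h1
    exact_mod_cast h1
  have hcard0 : 0 < F.card := hFne.card_pos
  obtain ⟨p, hp⟩ := hFne
  have hcases : F.card = 1 ∨ F.card = 2 ∨ F.card = 3 := by omega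
  rcases hcases with h1 | h1 | h1
  · obtain ⟨a, ha⟩ := Finset.card_eq_one.1 h1
    obtain rfl : p = a := by simpa [ha] using hp
    obtain ⟨u, hu, -⟩ := Plane.exists_ne_zero_inner_eq_zero 0
    have hyp : y = p := by
      have h2 := h.sum
      have h3 := h.eq
      simp only [Finsupp.sum, ← hF, ha, Finset.sum_singleton] at h2 h3
      rw [← h3, h2, one_smul]
    -- At a lone vertex, moving a little produces a second vertex, hence an edge, which then has a
    -- triangle on the side of the moved point.
    obtain ⟨t, hpt, ht⟩ := ((hM.eventually_pos (u := u) (hpos p hp)).and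
      self_mem_nhdsWithin).exists
    have ht : 0 < t := ht
    have h' := hM.isDelaunayCoord (y + t • u)
    obtain ⟨q, hq, hqp⟩ : ∃ q ∈ (delaunayCoord M (y + t • u)).support, q ≠ p := by
      by_contra hcon
      push Not at hcon
      have hs : (delaunayCoord M (y + t • u)).support = {p} :=
        Finset.eq_singleton_iff_unique_mem.2 ⟨Finsupp.mem_support_iff.2 hpt.ne', hcon⟩
      have h2 := h'.sum
      have h3 := h'.eq
      simp only [Finsupp.sum, hs, Finset.sum_singleton] at h2 h3
      rw [h2, one_smul, hyp, left_eq_add, smul_eq_zero] at h3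
      rcases h3 with h3 | h3
      exacts [ht.ne' h3, hu h3]
    have hq0 : 0 < delaunayCoord M (y + t • u) q :=
      lt_of_le_of_ne (h'.nonneg q) (Finsupp.mem_support_iff.1 hq).symm
    obtain ⟨v, hv, hvq⟩ := Plane.exists_ne_zero_inner_eq_zero (q - p)
    obtain ⟨τ, hτ, hpτ, -⟩ : ∃ τ, IsTriangle M τ ∧ p ∈ τ ∧ True := by
      rcases le_total 0 (inner ℝ v (y + t • u - p)) with hs | hs
      · obtain ⟨τ, hτ, hpτ, -⟩ := hM.exists_isTriangle_side hqp.symm hpt hq0 hv hvq hs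
        exact ⟨τ, hτ, hpτ, trivial⟩
      · obtain ⟨τ, hτ, hpτ, -⟩ := hM.exists_isTriangle_side hqp.symm hpt hq0 (neg_ne_zero.2 hv)
          (by rw [inner_neg_left, hvq, neg_zero]) (by rw [inner_neg_left]; linarith)
        exact ⟨τ, hτ, hpτ, trivial⟩
    exact ⟨τ, hτ, by rw [ha]; simpa using hpτ⟩
  · obtain ⟨a, b, hab, hF'⟩ := Finset.card_eq_two.1 h1
    have haF : a ∈ F := by simp [hF']
    have hbF : b ∈ F := by simp [hF']
    obtain ⟨v, hv, hvb⟩ := Plane.exists_ne_zero_inner_eq_zero (b - a)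
    obtain ⟨τ, hτ, haτ, hbτ, -⟩ := hM.exists_isTriangle_side hab (hpos a haF) (hpos b hbF) hv hvb
      (by rw [← hM.sum_inner_sub, ← hF, hF', Finset.sum_pair hab, hvb]; simp)
    refine ⟨τ, hτ, ?_⟩
    rw [hF']
    intro z hz
    simp only [Finset.mem_insert, Finset.mem_singleton] at hz
    rcases hz with rfl | rfl <;> assumption
  · obtain ⟨a, b, d, hab, had, hbd, hF'⟩ := Finset.card_eq_three.1 h1
    refine ⟨F, ?_, subset_rfl⟩
    rw [hF']
    exact hM.isTriangle_of_mem (hc a (by simp [hF'])) (hc b (by simp [hF'])) (hc d (by simp [hF']))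
      hab had hbd

/-- A third vertex on the line of the edge would be an affine dependence, against
`abs_mul_le_norm_sum`. -/
theorem inner_ne_zero {τ : Finset Plane} (hτ : IsTriangle M τ) {p q r u : Plane} (hp : p ∈ τ)
    (hq : q ∈ τ) (hr : r ∈ τ) (hpq : p ≠ q) (hpr : p ≠ r) (hqr : q ≠ r) (hu : u ≠ 0)
    (huq : inner ℝ u (q - p) = 0) : inner ℝ u (r - p) ≠ 0 := by
  classical
  intro h0
  obtain ⟨α, hα⟩ := Plane.exists_eq_smul_add (sub_ne_zero.2 hpq.symm) hu huq (r - p)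
  rw [h0, zero_div, zero_smul, add_zero] at hα
  obtain ⟨c, hc⟩ := hτ.mem_nearest
  have h := hM.abs_mul_le_norm_sum (c := c)
    (δ := Finsupp.single r 1 + Finsupp.single p (α - 1) + Finsupp.single q (-α)) (fun z hz => ?_) ?_ r
  · rw [Finsupp.sum_add_index' (by simp) (by simp [add_smul]),
      Finsupp.sum_add_index' (by simp) (by simp [add_smul]), Finsupp.sum_single_index (by simp),
      Finsupp.sum_single_index (by simp), Finsupp.sum_single_index (by simp)] at h
    have e : (1 : ℝ) • r + (α - 1) • p + -α • q = 0 := by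
      have : r = p + α • (q - p) := by rw [← hα]; abel
      rw [this]; module
    rw [e, norm_zero] at h
    simp only [Finsupp.add_apply, Finsupp.single_eq_same, Finsupp.single_eq_of_ne hpr.symm,
      Finsupp.single_eq_of_ne hqr.symm] at h
    have := hM.pos
    norm_num at h
    linarith
  · have hsub := Finsupp.support_add hz
    rw [Finset.mem_union] at hsub
    rcases hsub with hsub | hsub
    · rcases Finset.mem_union.1 (Finsupp.support_add hsub) with h | h
      · rw [Finset.mem_singleton.1 (Finsupp.support_single_subset h)]; exact hc r hr
      · rw [Finset.mem_singleton.1 (Finsupp.support_single_subset h)]; exact hc p hp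
    · rw [Finset.mem_singleton.1 (Finsupp.support_single_subset hsub)]; exact hc q hq
  · rw [Finsupp.sum_add_index' (by simp) (by simp),
      Finsupp.sum_add_index' (by simp) (by simp), Finsupp.sum_single_index (by simp),
      Finsupp.sum_single_index (by simp), Finsupp.sum_single_index (by simp)]
    ring

/-- Points just off the midpoint of an edge towards the third vertex are interior to the triangle.
Since the support at a point is unique, an edge has at most one triangle on each side. -/
theorem eventually_support_eq {τ : Finset Plane} (hτ : IsTriangle M τ) {p q r u : Plane} (hp : p ∈ τ)
    (hq : q ∈ τ) (hr : r ∈ τ) (hpq : p ≠ q) (hu : u ≠ 0)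
    (huq : inner ℝ u (q - p) = 0) (hur : 0 < inner ℝ u (r - p)) :
    ∀ᶠ t in 𝓝[>] (0 : ℝ),
      (delaunayCoord M ((1 / 2 : ℝ) • p + (1 / 2 : ℝ) • q + t • u)).support = τ := by
  classical
  have hpr : p ≠ r := by rintro rfl; simp at hur
  have hqr : q ≠ r := by rintro rfl; rw [huq] at hur; exact lt_irrefl _ hur
  obtain ⟨α, hα⟩ := Plane.exists_eq_smul_add (sub_ne_zero.2 hpq.symm) hu huq (r - p)
  set β := inner ℝ u (r - p) / ‖u‖ ^ 2 with hβ
  have hβ0 : 0 < β := by positivity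
  obtain ⟨c, hc⟩ := hτ.mem_nearest
  have hτ' := hτ.eq_insert hp hq hr hpq hpr hqr
  let fp : ℝ → ℝ := fun t => 1 / 2 - t / β + t * α / β
  let fq : ℝ → ℝ := fun t => 1 / 2 - t * α / β
  have e1 : ∀ᶠ t in 𝓝[>] (0 : ℝ), 0 < fp t := by
    have : Continuous fp := by fun_prop
    exact (this.tendsto 0).eventually (lt_mem_nhds (by norm_num [fp])) |>.filter_mono nhdsWithin_le_nhds
  have e2 : ∀ᶠ t in 𝓝[>] (0 : ℝ), 0 < fq t := by
    have : Continuous fq := by fun_prop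
    exact (this.tendsto 0).eventually (lt_mem_nhds (by norm_num [fq])) |>.filter_mono nhdsWithin_le_nhds
  filter_upwards [e1, e2, self_mem_nhdsWithin] with t h1 h2 h3
  have h3 : 0 < t / β := div_pos h3 hβ0
  let f : Plane → ℝ := fun z => if z = p then fp t else if z = q then fq t else t / β
  have hfp : f p = fp t := by simp [f]
  have hfq : f q = fq t := by simp [f, hpq.symm]
  have hfr : f r = t / β := by simp [f, hpr.symm, hqr.symm]
  have hpos : ∀ z, 0 < f z := fun z => by
    simp only [f]; split_ifs <;> assumption
  have hsum3 : ∀ {A : Type} [AddCommMonoid A] (g : Plane → A), ∑ z ∈ τ, g z = g p + (g q + g r) := by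
    intro A _ g
    rw [hτ', Finset.sum_insert (by simp [hpq, hpr]), Finset.sum_pair hqr]
  have hcoord := hM.delaunayCoord_sum (c := c) (s := τ) (f := f) hc (fun z _ => (hpos z).le)
    (by rw [hsum3, hfp, hfq, hfr]; simp only [fp, fq]; ring)
  have hpt : (1 / 2 : ℝ) • p + (1 / 2 : ℝ) • q + t • u = ∑ z ∈ τ, f z • z := by
    rw [hsum3, hfp, hfq, hfr]
    have hru : u = β⁻¹ • (r - p - α • (q - p)) := by
      rw [hα, add_sub_cancel_left, smul_smul, inv_mul_cancel₀ hβ0.ne', one_smul]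
    simp only [fp, fq]
    nth_rw 1 [hru]
    module
  rw [hpt, hcoord]
  ext z
  rw [Finsupp.mem_support_iff, Finsupp.indicator_apply]
  split_ifs with hz
  · simp [hz, (hpos z).ne']
  · simp [hz]

/-- Every edge of the Delaunay triangulation is in exactly two triangles. -/
theorem exists_two_triangles {τ₀ : Finset Plane} (hτ₀ : IsTriangle M τ₀) {p q : Plane}
    (hp : p ∈ τ₀) (hq : q ∈ τ₀) (hpq : p ≠ q) :
    ∃ τ₁ τ₂, IsTriangle M τ₁ ∧ IsTriangle M τ₂ ∧ τ₁ ≠ τ₂ ∧ p ∈ τ₁ ∧ q ∈ τ₁ ∧ p ∈ τ₂ ∧ q ∈ τ₂ ∧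
      ∀ τ, IsTriangle M τ → p ∈ τ → q ∈ τ → τ = τ₁ ∨ τ = τ₂ := by
  classical
  obtain ⟨u, hu, huq⟩ := Plane.exists_ne_zero_inner_eq_zero (q - p)
  have hnu : -u ≠ 0 := neg_ne_zero.2 hu
  have hnuq : inner ℝ (-u) (q - p) = 0 := by rw [inner_neg_left, huq, neg_zero]
  obtain ⟨c, hc⟩ := hτ₀.mem_nearest
  have hm := hM.delaunayCoord_sum (c := c) (s := {p, q}) (f := fun _ => 1 / 2)
    (by simp [hc p hp, hc q hq]) (by norm_num) (by rw [Finset.sum_pair hpq]; norm_num)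
  set y := ∑ z ∈ ({p, q} : Finset Plane), (1 / 2 : ℝ) • z with hy
  have hyp : 0 < delaunayCoord M y p := by rw [hm]; simp
  have hyq : 0 < delaunayCoord M y q := by rw [hm]; simp
  have hside : ∀ v : Plane, inner ℝ v (q - p) = 0 → 0 ≤ inner ℝ v (y - p) := by
    intro v hv
    have : y - p = (1 / 2 : ℝ) • (q - p) := by rw [hy, Finset.sum_pair hpq]; module
    rw [this, inner_smul_right, hv, mul_zero]
  obtain ⟨τ₁, h₁, hp₁, hq₁, r₁, hr₁, hur₁⟩ :=
    hM.exists_isTriangle_side hpq hyp hyq hu huq (hside _ huq)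
  obtain ⟨τ₂, h₂, hp₂, hq₂, r₂, hr₂, hur₂⟩ :=
    hM.exists_isTriangle_side hpq hyp hyq hnu hnuq (hside _ hnuq)
  have hsame : ∀ {v : Plane} {τ τ' : Finset Plane}, v ≠ 0 → inner ℝ v (q - p) = 0 →
      IsTriangle M τ → IsTriangle M τ' → p ∈ τ → q ∈ τ → p ∈ τ' → q ∈ τ' →
      (∃ r ∈ τ, 0 < inner ℝ v (r - p)) → (∃ r ∈ τ', 0 < inner ℝ v (r - p)) → τ = τ' := by
    rintro v τ τ' hv hvq h h' a1 a2 a3 a4 ⟨r, hr, hvr⟩ ⟨r', hr', hvr'⟩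
    obtain ⟨t, e, e'⟩ := ((hM.eventually_support_eq h a1 a2 hr hpq hv hvq hvr).and
      (hM.eventually_support_eq h' a3 a4 hr' hpq hv hvq hvr')).exists
    rw [← e, ← e']
  refine ⟨τ₁, τ₂, h₁, h₂, ?_, hp₁, hq₁, hp₂, hq₂, ?_⟩
  · rintro rfl
    have hpr : p ≠ r₁ := by rintro rfl; simp at hur₁
    have hqr : q ≠ r₁ := by rintro rfl; rw [huq] at hur₁; exact lt_irrefl _ hur₁
    rw [h₁.eq_insert hp₁ hq₁ hr₁ hpq hpr hqr] at hr₂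
    rw [inner_neg_left] at hur₂
    simp only [Finset.mem_insert, Finset.mem_singleton] at hr₂
    rcases hr₂ with rfl | rfl | rfl
    · simp at hur₂
    · rw [huq] at hur₂; simp at hur₂
    · linarith
  · intro τ hτ hpτ hqτ
    obtain ⟨r, hr, hrp, hrq⟩ : ∃ r ∈ τ, r ≠ p ∧ r ≠ q := by
      by_contra hcon
      push Not at hcon
      have : τ ⊆ {p, q} := fun z hz => by
        by_cases hzp : z = p
        · simp [hzp]
        · simp [hcon z hz hzp]
      have := Finset.card_le_card this
      rw [hτ.1, Finset.card_pair hpq] at this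
      omega
    rcases lt_or_gt_of_ne (hM.inner_ne_zero hτ hpτ hqτ hr hpq hrp.symm hrq.symm hu huq) with h | h
    · exact .inr (hsame hnu hnuq hτ h₂ hpτ hqτ hp₂ hq₂
        ⟨r, hr, by rw [inner_neg_left]; linarith⟩ ⟨r₂, hr₂, hur₂⟩)
    · exact .inl (hsame hu huq hτ h₁ hpτ hqτ hp₁ hq₁ ⟨r, hr, h⟩ ⟨r₁, hr₁, hur₁⟩)

end IsNet

/-! ### Coordinates of the barycentric subdivision. -/

noncomputable section

open scoped Classical in
/-- The coordinate of the face `F` in the barycentric subdivision, in terms of the barycentric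
coordinates `κ` of the original complex, which is of dimension at most two. -/
def subdivCoord (κ : Plane → ℝ) (F : Finset Plane) : ℝ :=
  if h : F.Nonempty ∧ F.card ≤ 3 then
    F.card * max 0 (F.inf' h.1 κ - ⨆ q : {q // q ∉ F}, κ q)
  else 0

section Coord

variable {κ μ : Plane → ℝ} {F : Finset Plane}

theorem subdivCoord_eq (hF : F.card ≤ 3) {a b : Plane} (ha : a ∈ F)
    (hamin : ∀ x ∈ F, κ a ≤ κ x) (hb : b ∉ F) (hbmax : ∀ x ∉ F, κ x ≤ κ b) (hab : κ b ≤ κ a) :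
    subdivCoord κ F = F.card * (κ a - κ b) := by
  rw [subdivCoord, dif_pos ⟨⟨a, ha⟩, hF⟩]
  have h1 : F.inf' ⟨a, ha⟩ κ = κ a :=
    le_antisymm (Finset.inf'_le _ ha) (Finset.le_inf' _ _ hamin)
  have : Nonempty {q // q ∉ F} := ⟨⟨b, hb⟩⟩
  have h2 : ⨆ q : {q // q ∉ F}, κ q = κ b :=
    le_antisymm (ciSup_le fun q => hbmax q q.2)
      (le_ciSup (f := fun q : {q // q ∉ F} => κ q) ⟨κ b, by rintro _ ⟨q, rfl⟩; exact hbmax q q.2⟩ ⟨b, hb⟩)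
  rw [h1, h2, max_eq_right (by linarith)]

theorem subdivCoord_eq_zero {K : ℝ} (hK : ∀ x, κ x ≤ K) {a b : Plane} (ha : a ∈ F)
    (hb : b ∉ F) (hab : κ a ≤ κ b) : subdivCoord κ F = 0 := by
  rw [subdivCoord]
  split_ifs with h
  · have h1 : F.inf' h.1 κ ≤ κ a := Finset.inf'_le _ ha
    have h2 : κ b ≤ ⨆ q : {q // q ∉ F}, κ q :=
      le_ciSup (f := fun q : {q // q ∉ F} => κ q) ⟨K, by rintro _ ⟨q, rfl⟩; exact hK q⟩ ⟨b, hb⟩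
    rw [max_eq_left (by linarith), mul_zero]
  · rfl

/-- The minimum over `F` and the supremum off `F` each move by at most `ε`, and the factor `F.card`
is at most `3`. -/
theorem abs_subdivCoord_sub_le {K ε : ℝ} (hκ : ∀ x, κ x ≤ K) (hμ : ∀ x, μ x ≤ K)
    (hε : ∀ x, |κ x - μ x| ≤ ε) : |subdivCoord κ F - subdivCoord μ F| ≤ 6 * ε := by
  have hε0 : 0 ≤ ε := (abs_nonneg _).trans (hε 0)
  rw [subdivCoord, subdivCoord]
  split_ifs with h
  swap
  · simpa using hε0
  obtain ⟨b, hb⟩ := Infinite.exists_notMem_finset F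
  have : Nonempty {q // q ∉ F} := ⟨⟨b, hb⟩⟩
  have key : ∀ {κ μ : Plane → ℝ}, (∀ x, κ x ≤ K) → (∀ x, μ x ≤ K) → (∀ x, |κ x - μ x| ≤ ε) →
      F.inf' h.1 κ - (⨆ q : {q // q ∉ F}, κ q) ≤
        F.inf' h.1 μ - (⨆ q : {q // q ∉ F}, μ q) + 2 * ε := by
    intro κ μ hκ hμ hε
    have h1 : F.inf' h.1 κ - ε ≤ F.inf' h.1 μ := Finset.le_inf' _ _ fun x hx => by
      linarith [Finset.inf'_le κ hx, (abs_le.1 (hε x)).2]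
    have h2 : ⨆ q : {q // q ∉ F}, μ q ≤ (⨆ q : {q // q ∉ F}, κ q) + ε := ciSup_le fun q => by
      have := le_ciSup (f := fun q : {q // q ∉ F} => κ q)
        ⟨K, by rintro _ ⟨q, rfl⟩; exact hκ q⟩ q
      linarith [(abs_le.1 (hε q)).1]
    linarith
  have k1 := key hκ hμ hε
  have k2 := key hμ hκ fun x => by rw [abs_sub_comm]; exact hε x
  have hcard : (F.card : ℝ) ≤ 3 := by exact_mod_cast h.2
  rw [← mul_sub, abs_mul, abs_of_nonneg (by positivity : (0 : ℝ) ≤ F.card)]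
  have h3 : |max 0 (F.inf' h.1 κ - ⨆ q : {q // q ∉ F}, κ q) -
      max 0 (F.inf' h.1 μ - ⨆ q : {q // q ∉ F}, μ q)| ≤ 2 * ε := by
    rw [max_comm 0, max_comm 0]
    exact (abs_max_sub_max_le_abs _ _ _).trans (abs_le.2 ⟨by linarith, by linarith⟩)
  calc _ ≤ 3 * (2 * ε) := by gcongr
    _ = 6 * ε := by ring

variable [DecidableEq Plane]

/-- Sorting the weights selects the chain of superlevel sets. Any other `F` omits a point whose
weight is at least that of some member of `F`, so its truncated difference vanishes. -/
theorem subdivCoord_sorted {p q s : Plane} (hpq : p ≠ q) (hps : p ≠ s) (hqs : q ≠ s)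
    (h1 : κ q ≤ κ p) (h2 : κ s ≤ κ q) (h3 : 0 ≤ κ s)
    (h0 : ∀ x, x ≠ p → x ≠ q → x ≠ s → κ x = 0) :
    subdivCoord κ {p} = κ p - κ q ∧ subdivCoord κ {p, q} = 2 * (κ q - κ s) ∧
      subdivCoord κ {p, q, s} = 3 * κ s ∧
      ∀ F, F ≠ {p} → F ≠ {p, q} → F ≠ {p, q, s} → subdivCoord κ F = 0 := by
  have hle : ∀ x, κ x ≤ κ p := by
    intro x
    by_cases e1 : x = p
    · rw [e1]
    by_cases e2 : x = q
    · rw [e2]; exact h1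
    by_cases e3 : x = s
    · rw [e3]; linarith
    rw [h0 x e1 e2 e3]; linarith
  have hle2 : ∀ x, x ≠ p → κ x ≤ κ q := by
    intro x e1
    by_cases e2 : x = q
    · rw [e2]
    by_cases e3 : x = s
    · rw [e3]; linarith
    rw [h0 x e1 e2 e3]; linarith
  have hle3 : ∀ x, x ≠ p → x ≠ q → κ x ≤ κ s := by
    intro x e1 e2
    by_cases e3 : x = s
    · rw [e3]
    rw [h0 x e1 e2 e3]; linarith
  have c2 : ({p, q} : Finset Plane).card = 2 := Finset.card_pair hpq
  have c3 : ({p, q, s} : Finset Plane).card = 3 :=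
    Finset.card_eq_three.2 ⟨p, q, s, hpq, hps, hqs, rfl⟩
  refine ⟨?_, ?_, ?_, ?_⟩
  · rw [subdivCoord_eq (a := p) (b := q) (by simp) (by simp) (by simp) (by simpa using hpq.symm)
      (fun x hx => hle2 x (by simpa using hx)) h1]
    simp
  · rw [subdivCoord_eq (a := q) (b := s) (by omega) (by simp) (by simpa using h1)
      (by simp [hps.symm, hqs.symm])
      (fun x hx => by
        simp only [Finset.mem_insert, Finset.mem_singleton, not_or] at hx
        exact hle3 x hx.1 hx.2) h2, c2]
    simp
  · obtain ⟨b, hb⟩ := Infinite.exists_notMem_finset ({p, q, s} : Finset Plane)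
    have hz : ∀ x, x ∉ ({p, q, s} : Finset Plane) → κ x = 0 := fun x hx => by
      simp only [Finset.mem_insert, Finset.mem_singleton, not_or] at hx
      exact h0 x hx.1 hx.2.1 hx.2.2
    rw [subdivCoord_eq (a := s) (b := b) (by omega) (by simp) (by simp; constructor <;> linarith) hb
      (fun x hx => by rw [hz x hx, hz b hb]) (by rw [hz b hb]; exact h3), c3, hz b hb]
    simp
  · intro F e1 e2 e3
    by_cases hF : F = ∅
    · simp [hF, subdivCoord]
    obtain ⟨z, hz⟩ := Finset.nonempty_iff_ne_empty.2 hF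
    by_cases hp : p ∈ F
    swap
    · exact subdivCoord_eq_zero hle hz hp (hle z)
    obtain ⟨x, hx, hxp⟩ : ∃ x ∈ F, x ≠ p := by
      by_contra hcon
      push Not at hcon
      exact e1 (Finset.eq_singleton_iff_unique_mem.2 ⟨hp, hcon⟩)
    by_cases hq : q ∈ F
    swap
    · exact subdivCoord_eq_zero hle hx hq (hle2 x hxp)
    obtain ⟨y, hy, hyp, hyq⟩ : ∃ y ∈ F, y ≠ p ∧ y ≠ q := by
      by_contra hcon
      push Not at hcon
      refine e2 (Finset.Subset.antisymm (fun y hy => ?_) (by simp [Finset.insert_subset_iff, hp, hq]))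
      by_cases hyp : y = p
      · simp [hyp]
      · simp [hcon y hy hyp]
    by_cases hs : s ∈ F
    swap
    · exact subdivCoord_eq_zero hle hy hs (hle3 y hyp hyq)
    obtain ⟨w, hw, hwp, hwq, hws⟩ : ∃ w ∈ F, w ≠ p ∧ w ≠ q ∧ w ≠ s := by
      by_contra hcon
      push Not at hcon
      refine e3 (Finset.Subset.antisymm (fun y hy => ?_)
        (by simp [Finset.insert_subset_iff, hp, hq, hs]))
      by_cases hyp : y = p
      · simp [hyp]
      by_cases hyq : y = q
      · simp [hyq]
      · simp [hcon y hy hyp hyq]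
    obtain ⟨b, hb⟩ := Infinite.exists_notMem_finset F
    refine subdivCoord_eq_zero hle hw hb ?_
    rw [h0 w hwp hwq hws]
    by_contra hcon
    rw [h0 b (fun e => hb (e ▸ hp)) (fun e => hb (e ▸ hq)) (fun e => hb (e ▸ hs))] at hcon
    exact hcon le_rfl

end Coord

/-! ### Combinatorics of the barycentric subdivision. -/

/-- The centroid of a finite set. -/
def centroid (F : Finset Plane) : Plane := (F.card : ℝ)⁻¹ • ∑ p ∈ F, p

/-- The triangles of the barycentric subdivision of the Delaunay triangulation. -/
structure SubdivTri (M : Set Plane) (F G H : Finset Plane) : Prop where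
  ne₁ : F ≠ G
  ne₂ : F ≠ H
  ne₃ : G ≠ H
  nonempty₁ : F.Nonempty
  nonempty₂ : G.Nonempty
  nonempty₃ : H.Nonempty
  cmp₁ : F ⊆ G ∨ G ⊆ F
  cmp₂ : F ⊆ H ∨ H ⊆ F
  cmp₃ : G ⊆ H ∨ H ⊆ G
  face : ∃ τ, IsTriangle M τ ∧ F ⊆ τ ∧ G ⊆ τ ∧ H ⊆ τ

namespace SubdivTri

variable {M : Set Plane} {F G H K : Finset Plane}

theorem swap₁₂ (h : SubdivTri M F G H) : SubdivTri M G F H := by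
  obtain ⟨a1, a2, a3, a4, a5, a6, a7, a8, a9, τ, hτ, b1, b2, b3⟩ := h
  exact ⟨a1.symm, a3, a2, a5, a4, a6, a7.symm, a9, a8, τ, hτ, b2, b1, b3⟩

theorem swap₂₃ (h : SubdivTri M F G H) : SubdivTri M F H G := by
  obtain ⟨a1, a2, a3, a4, a5, a6, a7, a8, a9, τ, hτ, b1, b2, b3⟩ := h
  exact ⟨a2, a1, a3.symm, a4, a6, a5, a8, a7, a9.symm, τ, hτ, b1, b3, b2⟩

theorem card_mem (h : SubdivTri M F G H) : 1 ≤ F.card ∧ F.card ≤ 3 := by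
  obtain ⟨τ, hτ, h1, -⟩ := h.face
  exact ⟨h.nonempty₁.card_pos, hτ.1 ▸ Finset.card_le_card h1⟩

theorem card_ne (h : SubdivTri M F G H) : F.card ≠ G.card := by
  intro he
  rcases h.cmp₁ with h1 | h1
  · exact h.ne₁ (Finset.eq_of_subset_of_card_le h1 he.ge)
  · exact h.ne₁ (Finset.eq_of_subset_of_card_le h1 he.le).symm

/-- Three pairwise comparable faces form a chain, and a triangle containing the largest contains all
of them. -/
theorem flag (h₁ : SubdivTri M F G K) {K' K'' : Finset Plane} (h₂ : SubdivTri M G H K')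
    (h₃ : SubdivTri M F H K'') : SubdivTri M F G H := by
  refine ⟨h₁.ne₁, h₃.ne₁, h₂.ne₁, h₁.nonempty₁, h₁.nonempty₂, h₂.nonempty₂, h₁.cmp₁, h₃.cmp₁,
    h₂.cmp₁, ?_⟩
  obtain ⟨τ₁, hτ₁, a1, a2, -⟩ := h₁.face
  obtain ⟨τ₂, hτ₂, b1, b2, -⟩ := h₂.face
  obtain ⟨τ₃, hτ₃, c1, c2, -⟩ := h₃.face
  rcases h₁.cmp₁ with h | h
  · rcases h₂.cmp₁ with h' | h'
    · exact ⟨τ₂, hτ₂, (h.trans h').trans b2, b1, b2⟩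
    · exact ⟨τ₁, hτ₁, a1, a2, h'.trans a2⟩
  · rcases h₃.cmp₁ with h' | h'
    · exact ⟨τ₃, hτ₃, c1, (h.trans h').trans c2, c2⟩
    · exact ⟨τ₁, hτ₁, a1, a2, h'.trans a1⟩

theorem subset_of_isTriangle {τ : Finset Plane} (hτ : IsTriangle M τ) (h : SubdivTri M F τ H) : H ⊆ τ := by
  rcases h.cmp₃ with h1 | h1
  · obtain ⟨τ', hτ', -, -, a3⟩ := h.face
    have := Finset.eq_of_subset_of_card_le h1 (by rw [hτ.1, ← hτ'.1]; exact Finset.card_le_card a3)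
    exact this ▸ subset_rfl
  · exact h1

variable [DecidableEq Plane]

theorem of_chain {p q s : Plane} (hpq : p ≠ q)
    (hτ : IsTriangle M {p, q, s}) : SubdivTri M {p} {p, q} {p, q, s} := by
  have c2 : ({p, q} : Finset Plane).card = 2 := Finset.card_pair hpq
  have c3 := hτ.1
  refine ⟨?_, ?_, ?_, by simp, by simp, by simp, ?_, ?_, ?_, _, hτ, ?_, ?_, subset_rfl⟩
  · exact fun e => by rw [← e, Finset.card_singleton] at c2; omega
  · exact fun e => by rw [← e, Finset.card_singleton] at c3; omega
  · exact fun e => by rw [← e] at c3; omega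
  · left; simp
  · left; simp
  · left; intro x; simp; tauto
  · simp
  · intro x; simp; tauto

/-- A chain of faces is of the form `{p} ⊂ {p, q} ⊂ {p, q, s}`. -/
theorem exists_chain_of_subset (h : SubdivTri M F G H) (h1 : F ⊆ G) (h2 : G ⊆ H) :
    ∃ p q s, p ≠ q ∧ p ≠ s ∧ q ≠ s ∧ IsTriangle M {p, q, s} ∧ F = {p} ∧ G = {p, q} ∧
      H = {p, q, s} := by
  obtain ⟨τ, hτ, -, -, b3⟩ := h.face
  have l1 := Finset.card_lt_card (h1.ssubset_of_ne h.ne₁)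
  have l2 := Finset.card_lt_card (h2.ssubset_of_ne h.ne₃)
  have l3 := Finset.card_le_card b3
  have l0 := h.nonempty₁.card_pos
  have hτ3 := hτ.1
  have hH : H = τ := Finset.eq_of_subset_of_card_le b3 (by omega)
  obtain ⟨p, rfl⟩ := Finset.card_eq_one.1 (show F.card = 1 by omega)
  have hpG : p ∈ G := h1 (by simp)
  obtain ⟨q, hq, hqp⟩ := Finset.exists_mem_ne (show 1 < G.card by omega) p
  have hG : G = {p, q} := (Finset.eq_of_subset_of_card_le
    (by simp [Finset.insert_subset_iff, hpG, hq]) (by rw [Finset.card_pair hqp.symm]; omega)).symm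
  obtain ⟨s, hs, hsG⟩ := Finset.exists_of_ssubset (h2.ssubset_of_ne h.ne₃)
  rw [hG] at hsG
  simp only [Finset.mem_insert, Finset.mem_singleton, not_or] at hsG
  have hHe : H = {p, q, s} := by
    rw [hH]
    exact hτ.eq_insert (hH ▸ h2 hpG) (hH ▸ h2 hq) (hH ▸ hs) hqp.symm (Ne.symm hsG.1) (Ne.symm hsG.2)
  exact ⟨p, q, s, hqp.symm, Ne.symm hsG.1, Ne.symm hsG.2, by rw [← hHe, hH]; exact hτ, rfl, hG, hHe⟩

theorem exists_chain (h : SubdivTri M F G H) :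
    ∃ p q s, p ≠ q ∧ p ≠ s ∧ q ≠ s ∧ IsTriangle M {p, q, s} ∧
      ((F = {p} ∧ G = {p, q} ∧ H = {p, q, s}) ∨ (F = {p} ∧ H = {p, q} ∧ G = {p, q, s}) ∨
       (G = {p} ∧ F = {p, q} ∧ H = {p, q, s}) ∨ (G = {p} ∧ H = {p, q} ∧ F = {p, q, s}) ∨
       (H = {p} ∧ F = {p, q} ∧ G = {p, q, s}) ∨ (H = {p} ∧ G = {p, q} ∧ F = {p, q, s})) := by
  rcases h.cmp₁ with h1 | h1
  · rcases h.cmp₃ with h2 | h2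
    · obtain ⟨p, q, s, a1, a2, a3, a4, a5⟩ := h.exists_chain_of_subset h1 h2
      exact ⟨p, q, s, a1, a2, a3, a4, .inl a5⟩
    · rcases h.cmp₂ with h3 | h3
      · obtain ⟨p, q, s, a1, a2, a3, a4, a5⟩ := h.swap₂₃.exists_chain_of_subset h3 h2
        exact ⟨p, q, s, a1, a2, a3, a4, .inr (.inl a5)⟩
      · obtain ⟨p, q, s, a1, a2, a3, a4, a5⟩ := h.swap₂₃.swap₁₂.exists_chain_of_subset h3 h1
        exact ⟨p, q, s, a1, a2, a3, a4, .inr (.inr (.inr (.inr (.inl a5))))⟩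
  · rcases h.cmp₂ with h2 | h2
    · obtain ⟨p, q, s, a1, a2, a3, a4, a5⟩ := h.swap₁₂.exists_chain_of_subset h1 h2
      exact ⟨p, q, s, a1, a2, a3, a4, .inr (.inr (.inl a5))⟩
    · rcases h.cmp₃ with h3 | h3
      · obtain ⟨p, q, s, a1, a2, a3, a4, a5⟩ := h.swap₁₂.swap₂₃.exists_chain_of_subset h3 h2
        exact ⟨p, q, s, a1, a2, a3, a4, .inr (.inr (.inr (.inl a5)))⟩
      · obtain ⟨p, q, s, a1, a2, a3, a4, a5⟩ :=
          h.swap₁₂.swap₂₃.swap₁₂.exists_chain_of_subset h3 h1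
        exact ⟨p, q, s, a1, a2, a3, a4, .inr (.inr (.inr (.inr (.inr a5))))⟩

theorem encard_point_edge {R : ℝ} (hM : IsNet M R) {p q : Plane} (hpq : p ≠ q)
    (h : SubdivTri M {p} {p, q} K) : {H | SubdivTri M {p} {p, q} H}.encard = 2 := by
  obtain ⟨τ₀, hτ₀, -, b2, -⟩ := h.face
  obtain ⟨τ₁, τ₂, h₁, h₂, hne, p1, q1, p2, q2, hall⟩ :=
    hM.exists_two_triangles hτ₀ (b2 (by simp)) (b2 (by simp)) hpq
  rw [← encard_pair hne]
  congr 1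
  ext H
  simp only [mem_ofPred_eq, mem_insert_iff, mem_singleton_iff]
  have c2 : ({p, q} : Finset Plane).card = 2 := Finset.card_pair hpq
  constructor
  · intro hH
    obtain ⟨τ, hτ, -, a2, a3⟩ := hH.face
    have l3 := Finset.card_le_card a3
    have hτ3 := hτ.1
    have n1 := hH.swap₂₃.card_ne
    have n2 := hH.swap₁₂.swap₂₃.card_ne
    have n0 := hH.nonempty₃.card_pos
    rw [Finset.card_singleton] at n1
    have hHτ : H = τ := Finset.eq_of_subset_of_card_le a3 (by omega)
    exact hall H (hHτ ▸ hτ) (hHτ ▸ a2 (by simp)) (hHτ ▸ a2 (by simp))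
  · have key : ∀ τ, IsTriangle M τ → p ∈ τ → q ∈ τ → SubdivTri M {p} {p, q} τ := by
      intro τ hτ hp hq
      have hsub : ({p, q} : Finset Plane) ⊆ τ := by simp [Finset.insert_subset_iff, hp, hq]
      have hτ3 := hτ.1
      obtain ⟨s, hs, hsG⟩ := Finset.exists_of_ssubset
        (hsub.ssubset_of_ne fun e => by rw [← e] at hτ3; omega)
      simp only [Finset.mem_insert, Finset.mem_singleton, not_or] at hsG
      have he := hτ.eq_insert hp hq hs hpq (Ne.symm hsG.1) (Ne.symm hsG.2)
      rw [he] at hτ ⊢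
      exact of_chain hpq hτ
    rintro (rfl | rfl)
    exacts [key _ h₁ p1 q1, key _ h₂ p2 q2]

theorem encard_point_face {p q s : Plane} (hpq : p ≠ q) (hps : p ≠ s) (hqs : q ≠ s)
    (hτ : IsTriangle M {p, q, s}) : {H | SubdivTri M {p} {p, q, s} H}.encard = 2 := by
  have hne : ({p, q} : Finset Plane) ≠ {p, s} := by
    intro e
    have : q ∈ ({p, s} : Finset Plane) := e ▸ (by simp)
    simp [hpq.symm, hqs] at this
  rw [← encard_pair hne]
  congr 1
  ext H
  simp only [mem_ofPred_eq, mem_insert_iff, mem_singleton_iff]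
  have hcomm : ({p, s, q} : Finset Plane) = {p, q, s} := by ext x; simp; tauto
  constructor
  · intro hH
    have hsub := subset_of_isTriangle hτ hH
    have hp : p ∈ H := by
      rcases hH.cmp₂ with h1 | h1
      · exact h1 (by simp)
      · rcases Finset.subset_singleton_iff.1 h1 with e | e
        · exact absurd e hH.nonempty₃.ne_empty
        · exact absurd e.symm hH.ne₂
    have hfil : H = ({p, q, s} : Finset Plane).filter (· ∈ H) := by
      ext x; rw [Finset.mem_filter]; exact ⟨fun h => ⟨hsub h, h⟩, fun h => h.2⟩
    by_cases hq : q ∈ H <;> by_cases hs : s ∈ H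
    · exact absurd (Finset.Subset.antisymm hsub (by simp [Finset.insert_subset_iff, hp, hq, hs]))
        hH.ne₃.symm
    · left; rw [hfil]; simp [Finset.filter_insert, Finset.filter_singleton, hp, hq, hs]
    · right; rw [hfil]; simp [Finset.filter_insert, Finset.filter_singleton, hp, hq, hs]
    · refine absurd ?_ hH.ne₂
      rw [hfil]; simp [Finset.filter_insert, Finset.filter_singleton, hp, hq, hs]
  · rintro (rfl | rfl)
    · exact (of_chain hpq hτ).swap₂₃
    · rw [← hcomm] at hτ ⊢
      exact (of_chain hps hτ).swap₂₃

theorem encard_edge_face {p q s : Plane} (hpq : p ≠ q)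
    (hτ : IsTriangle M {p, q, s}) : {H | SubdivTri M {p, q} {p, q, s} H}.encard = 2 := by
  have hne : ({p} : Finset Plane) ≠ {q} := fun e => hpq (Finset.singleton_inj.1 e)
  rw [← encard_pair hne]
  congr 1
  ext H
  simp only [mem_ofPred_eq, mem_insert_iff, mem_singleton_iff]
  constructor
  · intro hH
    have hsub := subset_of_isTriangle hτ hH
    have hsub' : H ⊆ {p, q} := by
      rcases hH.cmp₂ with h1 | h1
      · have n1 := hH.swap₂₃.card_ne
        have n2 := hH.swap₁₂.swap₂₃.card_ne
        rw [Finset.card_pair hpq] at n1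
        have l1 := Finset.card_le_card h1
        have l2 := Finset.card_le_card hsub
        have := hτ.1
        rw [Finset.card_pair hpq] at l1
        omega
      · exact h1
    have hfil : H = ({p, q} : Finset Plane).filter (· ∈ H) := by
      ext x; rw [Finset.mem_filter]; exact ⟨fun h => ⟨hsub' h, h⟩, fun h => h.2⟩
    by_cases hp : p ∈ H <;> by_cases hq : q ∈ H
    · exact absurd (Finset.Subset.antisymm hsub' (by simp [Finset.insert_subset_iff, hp, hq]))
        hH.ne₂.symm
    · left; rw [hfil]; simp [Finset.filter_insert, Finset.filter_singleton, hp, hq]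
    · right; rw [hfil]; simp [Finset.filter_insert, Finset.filter_singleton, hp, hq]
    · refine absurd ?_ hH.nonempty₃.ne_empty
      rw [hfil]; simp [Finset.filter_insert, Finset.filter_singleton, hp, hq]
  · rintro (rfl | rfl)
    · exact (of_chain hpq hτ).swap₁₂.swap₂₃
    · have e1 : ({p, q} : Finset Plane) = {q, p} := Finset.pair_comm _ _
      have e2 : ({p, q, s} : Finset Plane) = {q, p, s} := by ext x; simp; tauto
      rw [e2] at hτ
      rw [e1, e2]
      exact (of_chain hpq.symm hτ).swap₁₂.swap₂₃

/-- A chain of length two misses one dimension: a vertex and an edge extend by the two triangles on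
the edge, a vertex and a triangle by two edges, an edge and a triangle by two end points. -/
theorem encard_eq_two {R : ℝ} (hM : IsNet M R) (h : SubdivTri M F G K) :
    {H | SubdivTri M F G H}.encard = 2 := by
  have hsw : ∀ {F G : Finset Plane}, {H | SubdivTri M F G H} = {H | SubdivTri M G F H} :=
    fun {F G} => by ext H; exact ⟨swap₁₂, swap₁₂⟩
  obtain ⟨p, q, s, hpq, hps, hqs, hτ, hc⟩ := h.exists_chain
  rcases hc with ⟨rfl, rfl, -⟩ | ⟨rfl, -, rfl⟩ | ⟨rfl, rfl, -⟩ | ⟨rfl, -, rfl⟩ | ⟨-, rfl, rfl⟩ |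
    ⟨-, rfl, rfl⟩
  · exact encard_point_edge hM hpq h
  · exact encard_point_face hpq hps hqs hτ
  · rw [hsw]; exact encard_point_edge hM hpq h.swap₁₂
  · rw [hsw]; exact encard_point_face hpq hps hqs hτ
  · exact encard_edge_face hpq hτ
  · rw [hsw]; exact encard_edge_face hpq hτ

end SubdivTri
end

/-! ### The canonical choice of a face, and the fat triangulation of a net. -/

/-- `F` is a face of least cardinality among those with the largest coordinate in the barycentric
subdivision. -/
def IsTopFace (κ : Plane → ℝ) (F : Finset Plane) : Prop :=
  (∀ G, subdivCoord κ G ≤ subdivCoord κ F) ∧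
    ∀ G, (∀ H, subdivCoord κ H ≤ subdivCoord κ G) → F.card ≤ G.card

open scoped Classical in
/-- The face chosen by `IsTopFace`. -/
noncomputable def topFace (κ : Plane → ℝ) : Finset Plane :=
  if h : ∃ F, IsTopFace κ F then h.choose else ∅

theorem centroid_single (p : Plane) : centroid {p} = p := by simp [centroid]

namespace IsNet

variable {M : Set Plane} {R : ℝ}

section

variable [DecidableEq Plane]

theorem exists_sorted (hM : IsNet M R) (y : Plane) : ∃ p q s, p ≠ q ∧ p ≠ s ∧ q ≠ s ∧
    IsTriangle M {p, q, s} ∧ delaunayCoord M y q ≤ delaunayCoord M y p ∧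
    delaunayCoord M y s ≤ delaunayCoord M y q ∧ 0 ≤ delaunayCoord M y s ∧
    (∀ x, x ≠ p → x ≠ q → x ≠ s → delaunayCoord M y x = 0) ∧
    delaunayCoord M y p + delaunayCoord M y q + delaunayCoord M y s = 1 ∧
    y = delaunayCoord M y p • p + delaunayCoord M y q • q + delaunayCoord M y s • s := by
  obtain ⟨τ, hτ, hsub⟩ := hM.exists_isTriangle_support_subset y
  have h := hM.isDelaunayCoord y
  set κ := delaunayCoord M y
  have key : ∀ p q s, p ≠ q → p ≠ s → q ≠ s → τ = {p, q, s} → κ q ≤ κ p → κ s ≤ κ q →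
      ∃ p q s, p ≠ q ∧ p ≠ s ∧ q ≠ s ∧
        IsTriangle M {p, q, s} ∧ κ q ≤ κ p ∧ κ s ≤ κ q ∧ 0 ≤ κ s ∧
        (∀ x, x ≠ p → x ≠ q → x ≠ s → κ x = 0) ∧ κ p + κ q + κ s = 1 ∧
        y = κ p • p + κ q • q + κ s • s := by
    rintro p q s hpq hps hqs rfl h1 h2
    refine ⟨p, q, s, hpq, hps, hqs, hτ, h1, h2, h.nonneg s, ?_, ?_, ?_⟩
    · intro x e1 e2 e3
      by_contra hx
      have := hsub (Finsupp.mem_support_iff.2 hx)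
      simp [e1, e2, e3] at this
    · rw [← h.sum, Finsupp.sum_of_support_subset κ hsub _ (by simp),
        Finset.sum_insert (by simp [hpq, hps]), Finset.sum_pair hqs, add_assoc]
    · conv_lhs => rw [← h.eq, Finsupp.sum_of_support_subset κ hsub _ (by simp),
        Finset.sum_insert (by simp [hpq, hps]), Finset.sum_pair hqs, ← add_assoc]
  obtain ⟨p, q, s, hpq, hps, hqs, rfl⟩ := Finset.card_eq_three.1 hτ.1
  rcases le_total (κ p) (κ q) with h1 | h1 <;> rcases le_total (κ q) (κ s) with h2 | h2 <;>
    rcases le_total (κ p) (κ s) with h3 | h3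
  · exact key s q p hqs.symm hps.symm hpq.symm (by ext x; simp; tauto) h2 h1
  · exact key s q p hqs.symm hps.symm hpq.symm (by ext x; simp; tauto) h2 h1
  · exact key q s p hqs hpq.symm hps.symm (by ext x; simp; tauto) h2 h3
  · exact key q p s hpq.symm hqs hps (by ext x; simp; tauto) h1 h3
  · exact key s p q hps.symm hqs.symm hpq (by ext x; simp; tauto) h3 h1
  · exact key p s q hps hpq hqs.symm (by ext x; simp; tauto) h3 h2
  · exact key p q s hpq hps hqs rfl h1 h2
  · exact key p q s hpq hps hqs rfl h1 h2

theorem centroid_pair {p q : Plane} (hpq : p ≠ q) :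
    centroid {p, q} = (1 / 2 : ℝ) • p + (1 / 2 : ℝ) • q := by
  rw [centroid, Finset.card_pair hpq, Finset.sum_pair hpq, smul_add]; norm_num

theorem centroid_triple {p q s : Plane} (hpq : p ≠ q) (hps : p ≠ s) (hqs : q ≠ s) :
    centroid {p, q, s} = (1 / 3 : ℝ) • p + (1 / 3 : ℝ) • q + (1 / 3 : ℝ) • s := by
  rw [centroid, Finset.card_eq_three.2 ⟨p, q, s, hpq, hps, hqs, rfl⟩,
    Finset.sum_insert (by simp [hpq, hps]), Finset.sum_pair hqs, smul_add, smul_add]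
  norm_num [add_assoc]

/-- Expanding the centroids gives the Delaunay weights `a + b/2 + c/3 ≥ b/2 + c/3 ≥ c/3`, to which
`subdivCoord_sorted` applies. -/
theorem subdivCoord_chain (hM : IsNet M R) {p q s : Plane} (hpq : p ≠ q) (hps : p ≠ s)
    (hqs : q ≠ s) (hτ : IsTriangle M {p, q, s}) {a b c : ℝ} (ha : 0 ≤ a) (hb : 0 ≤ b) (hc : 0 ≤ c)
    (hsum : a + b + c = 1) {y : Plane}
    (hy : y = a • centroid {p} + b • centroid {p, q} + c • centroid {p, q, s}) :
    subdivCoord (delaunayCoord M y) {p} = a ∧ subdivCoord (delaunayCoord M y) {p, q} = b ∧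
      subdivCoord (delaunayCoord M y) {p, q, s} = c ∧
      ∀ F, F ≠ {p} → F ≠ {p, q} → F ≠ {p, q, s} → subdivCoord (delaunayCoord M y) F = 0 := by
  obtain ⟨d, hd⟩ := hτ.mem_nearest
  let f : Plane → ℝ := fun x =>
    if x = p then a + b / 2 + c / 3 else if x = q then b / 2 + c / 3 else c / 3
  have fp : f p = a + b / 2 + c / 3 := by simp [f]
  have fq : f q = b / 2 + c / 3 := by simp [f, hpq.symm]
  have fs : f s = c / 3 := by simp [f, hps.symm, hqs.symm]
  have hsum' : ∀ {V : Type} [AddCommMonoid V] (g : Plane → V),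
      ∑ x ∈ ({p, q, s} : Finset Plane), g x = g p + g q + g s := fun g => by
    rw [Finset.sum_insert (by simp [hpq, hps]), Finset.sum_pair hqs, ← add_assoc]
  have h := hM.delaunayCoord_sum (f := f) hd
    (fun x _ => by simp only [f]; split_ifs <;> positivity)
    (by rw [hsum', fp, fq, fs]; linarith)
  have hy' : ∑ x ∈ ({p, q, s} : Finset Plane), f x • x = y := by
    rw [hsum', fp, fq, fs, hy, centroid_single, centroid_pair hpq, centroid_triple hpq hps hqs]
    module
  rw [hy'] at h
  have hval : ∀ x ∈ ({p, q, s} : Finset Plane), delaunayCoord M y x = f x := fun x hx => by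
    rw [h, Finsupp.indicator_of_mem hx]
  have vp := (hval p (by simp)).trans fp
  have vq := (hval q (by simp)).trans fq
  have vs := (hval s (by simp)).trans fs
  obtain ⟨h1, h2, h3, h4⟩ := subdivCoord_sorted (κ := delaunayCoord M y) hpq hps hqs
    (by rw [vp, vq]; linarith) (by rw [vs, vq]; linarith) (by rw [vs]; positivity)
    (fun x e1 e2 e3 => by rw [h, Finsupp.indicator_of_notMem (by simp [e1, e2, e3])])
  refine ⟨?_, ?_, ?_, h4⟩
  · rw [h1, vp, vq]; ring
  · rw [h2, vq, vs]; ring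
  · rw [h3, vs]; ring

theorem exists_subdivCoord_chain (hM : IsNet M R) (y : Plane) :
    ∃ p q s, p ≠ q ∧ p ≠ s ∧ q ≠ s ∧ IsTriangle M {p, q, s} ∧ ∃ a b c : ℝ, 0 ≤ a ∧ 0 ≤ b ∧ 0 ≤ c ∧
      a + b + c = 1 ∧ y = a • centroid {p} + b • centroid {p, q} + c • centroid {p, q, s} := by
  obtain ⟨p, q, s, hpq, hps, hqs, hτ, h1, h2, h3, -, hs, hy⟩ := hM.exists_sorted y
  refine ⟨p, q, s, hpq, hps, hqs, hτ, delaunayCoord M y p - delaunayCoord M y q,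
    2 * (delaunayCoord M y q - delaunayCoord M y s), 3 * delaunayCoord M y s, by linarith,
    by linarith, by linarith, by linarith, ?_⟩
  rw [centroid_single, centroid_pair hpq, centroid_triple hpq hps hqs]
  conv_lhs => rw [hy]
  module

theorem subdivCoord_subdivTri (hM : IsNet M R) {F G H : Finset Plane} (h : SubdivTri M F G H)
    {u v w : ℝ} (hu : 0 ≤ u) (hv : 0 ≤ v) (hw : 0 ≤ w) (hsum : u + v + w = 1) :
    subdivCoord (delaunayCoord M (u • centroid F + v • centroid G + w • centroid H)) F = u ∧
      ∀ K, K ≠ F → K ≠ G → K ≠ H →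
        subdivCoord (delaunayCoord M (u • centroid F + v • centroid G + w • centroid H)) K = 0 := by
  obtain ⟨p, q, s, hpq, hps, hqs, hτ, hc⟩ := h.exists_chain
  rcases hc with ⟨rfl, rfl, rfl⟩ | ⟨rfl, rfl, rfl⟩ | ⟨rfl, rfl, rfl⟩ | ⟨rfl, rfl, rfl⟩ |
    ⟨rfl, rfl, rfl⟩ | ⟨rfl, rfl, rfl⟩
  · obtain ⟨h1, -, -, h4⟩ := hM.subdivCoord_chain hpq hps hqs hτ hu hv hw hsum rfl
    exact ⟨h1, fun K a b c => h4 K a b c⟩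
  · obtain ⟨h1, -, -, h4⟩ := hM.subdivCoord_chain hpq hps hqs hτ hu hw hv (by linarith)
      (add_right_comm _ _ _)
    exact ⟨h1, fun K a b c => h4 K a c b⟩
  · obtain ⟨-, h1, -, h4⟩ := hM.subdivCoord_chain hpq hps hqs hτ hv hu hw (by linarith)
      (congrArg (· + _) (add_comm _ _))
    exact ⟨h1, fun K a b c => h4 K b a c⟩
  · obtain ⟨-, -, h1, h4⟩ := hM.subdivCoord_chain hpq hps hqs hτ hv hw hu (by linarith)
      (show u • centroid {p, q, s} + v • centroid {p} + w • centroid {p, q} = _ by abel)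
    exact ⟨h1, fun K a b c => h4 K b c a⟩
  · obtain ⟨-, h1, -, h4⟩ := hM.subdivCoord_chain hpq hps hqs hτ hw hu hv (by linarith)
      (show u • centroid {p, q} + v • centroid {p, q, s} + w • centroid {p} = _ by abel)
    exact ⟨h1, fun K a b c => h4 K c a b⟩
  · obtain ⟨-, -, h1, h4⟩ := hM.subdivCoord_chain hpq hps hqs hτ hw hv hu (by linarith)
      (show u • centroid {p, q, s} + v • centroid {p, q} + w • centroid {p} = _ by abel)
    exact ⟨h1, fun K a b c => h4 K c b a⟩

end

theorem exists_isTopFace (hM : IsNet M R) (y : Plane) :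
    ∃ F, IsTopFace (delaunayCoord M y) F := by
  classical
  obtain ⟨p, q, s, hpq, hps, hqs, hτ, a, b, c, ha, hb, hc, hsum, hy⟩ :=
    hM.exists_subdivCoord_chain y
  obtain ⟨h1, h2, h3, h4⟩ := hM.subdivCoord_chain hpq hps hqs hτ ha hb hc hsum hy
  have hmax : ∃ F, ∀ G, subdivCoord (delaunayCoord M y) G ≤ subdivCoord (delaunayCoord M y) F := by
    obtain ⟨F, hF, hFm⟩ := Finset.exists_max_image ({{p}, {p, q}, {p, q, s}} : Finset (Finset Plane))
      (subdivCoord (delaunayCoord M y)) ⟨{p}, by simp⟩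
    refine ⟨F, fun G => ?_⟩
    by_cases hG : G ∈ ({{p}, {p, q}, {p, q, s}} : Finset (Finset Plane))
    · exact hFm G hG
    · simp only [Finset.mem_insert, Finset.mem_singleton, not_or] at hG
      rw [h4 G hG.1 hG.2.1 hG.2.2]
      exact ha.trans (h1 ▸ hFm {p} (by simp))
  obtain ⟨F, hF, hmin⟩ := WellFounded.has_min (measure (Finset.card (α := Plane))).wf
    {F | ∀ G, subdivCoord (delaunayCoord M y) G ≤ subdivCoord (delaunayCoord M y) F} hmax
  exact ⟨F, hF, fun G hG => not_lt.1 (hmin G hG)⟩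

theorem isTopFace_topFace (hM : IsNet M R) (y : Plane) :
    IsTopFace (delaunayCoord M y) (topFace (delaunayCoord M y)) := by
  rw [topFace, dif_pos (hM.exists_isTopFace y)]
  exact (hM.exists_isTopFace y).choose_spec

/-- Faces of maximal coordinate have positive coordinate, so they belong to one chain and are told
apart by cardinality. This uniqueness makes the choice canonical, as translation equivariance
requires. -/
theorem eq_topFace (hM : IsNet M R) {y : Plane} {F : Finset Plane}
    (h : IsTopFace (delaunayCoord M y) F) : F = topFace (delaunayCoord M y) := by
  classical
  have h' := hM.isTopFace_topFace y
  have hcard := le_antisymm (h.2 _ h'.1) (h'.2 _ h.1)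
  obtain ⟨p, q, s, hpq, hps, hqs, hτ, a, b, c, ha, hb, hc, hsum, hy⟩ :=
    hM.exists_subdivCoord_chain y
  obtain ⟨h1, h2, h3, h4⟩ := hM.subdivCoord_chain hpq hps hqs hτ ha hb hc hsum hy
  have key : ∀ G, IsTopFace (delaunayCoord M y) G → G = {p} ∨ G = {p, q} ∨ G = {p, q, s} := by
    intro G hG
    by_contra hcon
    push Not at hcon
    have h0 := h4 G hcon.1 hcon.2.1 hcon.2.2
    have g1 := hG.1 {p}
    have g2 := hG.1 {p, q}
    have g3 := hG.1 {p, q, s}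
    rw [h0] at g1 g2 g3
    linarith
  have c2 : ({p, q} : Finset Plane).card = 2 := Finset.card_pair hpq
  have c3 := hτ.1
  rcases key F h with e | e | e <;> rcases key _ h' with e' | e' | e' <;> rw [e, e'] at hcard ⊢ <;>
    simp [c2, c3] at hcard

theorem topFace_nonempty (hM : IsNet M R) (y : Plane) : (topFace (delaunayCoord M y)).Nonempty := by
  classical
  by_contra hcon
  rw [Finset.not_nonempty_iff_eq_empty] at hcon
  have h' := (hM.isTopFace_topFace y).1
  rw [hcon] at h'
  obtain ⟨p, q, s, hpq, hps, hqs, hτ, a, b, c, ha, hb, hc, hsum, hy⟩ :=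
    hM.exists_subdivCoord_chain y
  obtain ⟨h1, h2, h3, h4⟩ := hM.subdivCoord_chain hpq hps hqs hτ ha hb hc hsum hy
  have h0 : subdivCoord (delaunayCoord M y) ∅ = 0 := by simp [subdivCoord]
  have g1 := h' {p}
  have g2 := h' {p, q}
  have g3 := h' {p, q, s}
  linarith

theorem delaunayCoord_le_one (hM : IsNet M R) (y p : Plane) : delaunayCoord M y p ≤ 1 := by
  have h := hM.isDelaunayCoord y
  by_cases hp : p ∈ (delaunayCoord M y).support
  · rw [← h.sum]
    exact Finset.single_le_sum (f := fun p => delaunayCoord M y p) (fun p _ => h.nonneg p) hp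
  · rw [Finsupp.notMem_support_iff.1 hp]; exact zero_le_one

end IsNet

theorem IsTriangle.dist_le {M : Set Plane} {R : ℝ} (hM : IsNet M R) {τ : Finset Plane}
    (hτ : IsTriangle M τ) {p q : Plane} (hp : p ∈ τ) (hq : q ∈ τ) : dist p q ≤ 4 * R := by
  obtain ⟨c, hc⟩ := hτ.mem_nearest
  linarith [dist_triangle_left p q c, hM.dist_le_of_mem_nearest (hc p hp),
    hM.dist_le_of_mem_nearest (hc q hq)]

theorem centroid_mem {F : Finset Plane} (hF : F.Nonempty) {s : Set Plane} (hs : Convex ℝ s)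
    (hFs : ∀ p ∈ F, p ∈ s) : centroid F ∈ s := by
  rw [centroid, Finset.smul_sum]
  have hc : (F.card : ℝ) ≠ 0 := by exact_mod_cast hF.card_pos.ne'
  exact hs.sum_mem (fun _ _ => by positivity) (by simp [hc]) hFs

namespace SubdivTri

variable {M : Set Plane} {R : ℝ} {F G H : Finset Plane}

theorem dist_centroid_le (hM : IsNet M R) (h : SubdivTri M F G H) :
    dist (centroid F) (centroid G) ≤ 4 * R := by
  obtain ⟨τ, hτ, h1, h2, -⟩ := h.face
  obtain ⟨c, hc⟩ := hτ.mem_nearest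
  have key : ∀ {K : Finset Plane}, K.Nonempty → K ⊆ τ → centroid K ∈ Metric.closedBall c (2 * R) :=
    fun hK hKτ => centroid_mem hK (convex_closedBall _ _) fun p hp => by
      rw [Metric.mem_closedBall, dist_comm]
      exact hM.dist_le_of_mem_nearest (hc p (hKτ hp))
  have k1 := key h.nonempty₁ h1
  have k2 := key h.nonempty₂ h2
  rw [Metric.mem_closedBall] at k1 k2
  linarith [dist_triangle_right (centroid F) (centroid G) c]

/-- Fix a point of `F`. Every adjacent face has at most three vertices, all among the at most `21 ^
2 = 441` net points within `4 * R` of it; the count is independent of `R`. -/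
theorem encard_le (hM : IsNet M R) (F : Finset Plane) :
    {G | ∃ H, SubdivTri M F G H}.encard ≤ ((441 ^ 3 : ℕ) : ℕ∞) := by
  classical
  rcases F.eq_empty_or_nonempty with rfl | ⟨p, hp⟩
  · have : {G | ∃ H, SubdivTri M ∅ G H} = ∅ := by
      ext G
      simp only [mem_ofPred_eq, mem_empty_iff_false, iff_false]
      rintro ⟨H, hH⟩
      exact hH.nonempty₁.ne_empty rfl
    rw [this, encard_empty]; exact zero_le
  have hR := hM.pos
  set S := M ∩ Metric.closedBall p (4 * R)
  have hS : S.encard ≤ ((441 : ℕ) : ℕ∞) := by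
    have := hM.encard_inter_closedBall_le p (ρ := 4 * R) (C := 10)
      (by rw [show 2 * (4 * R) / R = 8 by field_simp; norm_num]; norm_num)
    exact this.trans (by norm_num)
  have hsub : {G | ∃ H, SubdivTri M F G H} ⊆
      (fun a : Plane × Plane × Plane => ({a.1, a.2.1, a.2.2} : Finset Plane)) ''
        (S ×ˢ (S ×ˢ S)) := by
    rintro G ⟨H, h⟩
    obtain ⟨τ, hτ, h1, h2, -⟩ := h.face
    have hG : ∀ x ∈ G, x ∈ S := fun x hx => by
      obtain ⟨c, hc⟩ := hτ.mem_nearest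
      exact ⟨(hc x (h2 hx)).1, hτ.dist_le hM (h2 hx) (h1 hp)⟩
    obtain ⟨g1, g3⟩ := h.swap₁₂.card_mem
    have : ∃ a b c, G = {a, b, c} := by
      interval_cases hcard : G.card
      · obtain ⟨a, rfl⟩ := Finset.card_eq_one.1 hcard
        exact ⟨a, a, a, by simp⟩
      · obtain ⟨a, b, -, rfl⟩ := Finset.card_eq_two.1 hcard
        exact ⟨a, b, b, by simp⟩
      · obtain ⟨a, b, c, -, -, -, rfl⟩ := Finset.card_eq_three.1 hcard
        exact ⟨a, b, c, rfl⟩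
    obtain ⟨a, b, c, rfl⟩ := this
    exact ⟨(a, b, c), ⟨hG a (by simp), hG b (by simp), hG c (by simp)⟩, rfl⟩
  refine (encard_le_encard hsub).trans ((encard_image_le _ _).trans ?_)
  rw [encard_prod, encard_prod]
  calc S.encard * (S.encard * S.encard) ≤ ((441 : ℕ) : ℕ∞) * (((441 : ℕ) : ℕ∞) * ((441 : ℕ) : ℕ∞)) := by
        gcongr
    _ = ((441 ^ 3 : ℕ) : ℕ∞) := by norm_num

end SubdivTri

/-- The barycentric subdivision of the Delaunay triangulation of a net. -/
noncomputable def IsNet.triangulation {M : Set Plane} {R : ℝ} (hM : IsNet M R) {E : ℕ}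
    (hE : 441 ^ 3 ≤ E) : FatTriangulation (Finset Plane) (24 / R) E where
  b := centroid
  Λ F y := subdivCoord (delaunayCoord M y) F
  lab y := topFace (delaunayCoord M y)
  Tri := SubdivTri M
  -- Cardinalities `1, 2, 3` are distinct modulo `3`.
  rank F := Fin.ofNat 3 F.card
  swap₁₂ h := h.swap₁₂
  swap₂₃ h := h.swap₂₃
  rank_ne {F G H} h he := by
    have h1 := h.card_mem
    have h2 := h.swap₁₂.card_mem
    have h3 := h.card_ne
    have := congrArg Fin.val he
    simp only [Fin.ofNat] at this
    omega
  cover y := by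
    classical
    obtain ⟨p, q, s, hpq, -, -, hτ, a, b, c, ha, hb, hc, hsum, hy⟩ :=
      hM.exists_subdivCoord_chain y
    exact ⟨_, _, _, SubdivTri.of_chain hpq hτ, a, b, c, ha, hb, hc, hsum, hy⟩
  coord_self h _ _ _ hu hv hw hs := by
    classical exact (hM.subdivCoord_subdivTri h hu hv hw hs).1
  coord_other h _ _ _ hu hv hw hs := by
    classical exact (hM.subdivCoord_subdivTri h hu hv hw hs).2
  lip F x y := by
    have h := abs_subdivCoord_sub_le (F := F) (hM.delaunayCoord_le_one x)
      (hM.delaunayCoord_le_one y) fun p => hM.abs_delaunayCoord_sub_le p x y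
    calc _ ≤ _ := h
      _ = _ := by ring
  lab_max y F := (hM.isTopFace_topFace y).1 F
  flag := fun ⟨_, h1⟩ ⟨_, h2⟩ ⟨_, h3⟩ => h1.flag h2 h3
  two := fun ⟨_, h⟩ => by classical exact h.encard_eq_two hM
  deg F := (SubdivTri.encard_le hM F).trans (by exact_mod_cast hE)
  -- With scale `24 / R` the permitted length `100 / L` is `25 * R / 6`, slightly more than `4 * R`.
  side h := (h.dist_centroid_le hM).trans (by
    have := hM.pos
    rw [div_div_eq_mul_div]; linarith)

/-! ### Locality and equivariance of the chosen vertex. -/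

/-- The vertex of the subdivided Delaunay triangulation which is chosen at a point. -/
noncomputable def netVertex (M : Set Plane) (y : Plane) : Plane :=
  centroid (topFace (delaunayCoord M y))

/-- An empty circle around `c` has radius at most `2 * R`, so it is decided by the net within `4 *
R` of `y`. -/
theorem nearest_subset_of_inter_eq {M M' : Set Plane} {R : ℝ} (hM : IsNet M R) {y c : Plane}
    (h : M ∩ Metric.closedBall y (4 * R) = M' ∩ Metric.closedBall y (4 * R))
    (hc : dist y c ≤ 2 * R) : nearest M c ⊆ nearest M' c := by
  have hball : ∀ q, dist c q ≤ 2 * R → q ∈ Metric.closedBall y (4 * R) := fun q hq => by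
    rw [Metric.mem_closedBall]
    linarith [dist_triangle_right q y c, dist_comm q c]
  intro p hp
  have hpd := hM.dist_le_of_mem_nearest hp
  refine ⟨(h ▸ ⟨hp.1, hball p hpd⟩ : p ∈ M' ∩ Metric.closedBall y (4 * R)).1, fun q hq => ?_⟩
  rcases le_total (dist c q) (2 * R) with hd | hd
  · exact hp.2 q (h.symm ▸ ⟨hq, hball q hd⟩ : q ∈ M ∩ Metric.closedBall y (4 * R)).1
  · exact hpd.trans hd

theorem netVertex_congr {M M' : Set Plane} {R : ℝ} (hM : IsNet M R) (hM' : IsNet M' R) {y : Plane}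
    (h : M ∩ Metric.closedBall y (4 * R) = M' ∩ Metric.closedBall y (4 * R)) :
    netVertex M y = netVertex M' y := by
  have hd : delaunayCoord M' y = delaunayCoord M y := by
    have h0 := hM.isDelaunayCoord y
    obtain ⟨c, hc, hsup⟩ := hM.exists_support_subset y
    exact hM'.delaunayCoord_eq ⟨h0.nonneg, h0.sum, h0.eq, c, fun p hp =>
      nearest_subset_of_inter_eq hM h hc (hsup p hp)⟩
  rw [netVertex, netVertex, hd]

section Translate

variable {M M' : Set Plane} {R : ℝ} {v : Plane}

theorem delaunayCoord_translate (hM : IsNet M R) (hM' : IsNet M' R) (h : ∀ p, p ∈ M' ↔ p - v ∈ M)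
    (y p : Plane) : delaunayCoord M' (y + v) p = delaunayCoord M y (p - v) := by
  classical
  have h0 := hM.isDelaunayCoord y
  obtain ⟨c, hc⟩ := h0.supp
  set κ := delaunayCoord M y with hκ
  have hinj : Function.Injective fun p : Plane => p + v := add_left_injective v
  have key := hM'.delaunayCoord_sum (c := c + v) (s := κ.support.image fun p => p + v)
    (f := fun p => κ (p - v))
    (fun p hp => by
      obtain ⟨r, hr, rfl⟩ := Finset.mem_image.1 hp
      refine ⟨(h _).2 (by simpa using (hc r hr).1), fun q hq => ?_⟩
      have := (hc r hr).2 _ ((h q).1 hq)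
      rw [dist_add_right]
      calc _ ≤ _ := this
        _ = dist (c + v) ((q - v) + v) := (dist_add_right _ _ _).symm
        _ = _ := by rw [sub_add_cancel])
    (fun p _ => h0.nonneg _)
    (by
      rw [Finset.sum_image fun a _ b _ e => hinj e]
      simp only [add_sub_cancel_right]
      exact h0.sum)
  have hy : ∑ p ∈ κ.support.image (fun p => p + v), κ (p - v) • p = y + v := by
    rw [Finset.sum_image fun a _ b _ e => hinj e]
    simp only [add_sub_cancel_right, smul_add, Finset.sum_add_distrib, ← Finset.sum_smul]
    rw [show ∑ p ∈ κ.support, κ p = 1 from h0.sum, one_smul]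
    exact congrArg (· + v) h0.eq
  rw [hy] at key
  rw [key, Finsupp.indicator_apply]
  split_ifs with hp
  · rfl
  · symm
    by_contra hne
    exact hp (Finset.mem_image.2 ⟨p - v, Finsupp.mem_support_iff.2 hne, sub_add_cancel _ _⟩)

theorem subdivCoord_translate {κ κ' : Plane → ℝ} (h : ∀ p, κ' (p + v) = κ p) (F : Finset Plane) :
    subdivCoord κ' (F.map (Equiv.addRight v).toEmbedding) = subdivCoord κ F := by
  rw [subdivCoord, subdivCoord]
  have hiff : (F.map (Equiv.addRight v).toEmbedding).Nonempty ∧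
      (F.map (Equiv.addRight v).toEmbedding).card ≤ 3 ↔ F.Nonempty ∧ F.card ≤ 3 := by
    rw [Finset.card_map, Finset.map_nonempty]
  split_ifs with h1 h2 h2
  · rw [Finset.card_map, Finset.inf'_map]
    have e1 : κ' ∘ (Equiv.addRight v).toEmbedding = κ := funext h
    have e2 : ⨆ q : {q // q ∉ F.map (Equiv.addRight v).toEmbedding}, κ' q =
        ⨆ q : {q // q ∉ F}, κ q :=
      (Equiv.iSup_congr ((Equiv.addRight v).subtypeEquiv fun q => by simp) fun q => h q).symm
    rw [e2]
    simp only [e1]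
  · exact absurd (hiff.1 h1) h2
  · exact absurd (hiff.2 h2) h1
  · rfl

theorem centroid_map {F : Finset Plane} (hF : F.Nonempty) :
    centroid (F.map (Equiv.addRight v).toEmbedding) = centroid F + v := by
  have hc : (F.card : ℝ) ≠ 0 := by exact_mod_cast hF.card_pos.ne'
  simp only [centroid, Finset.card_map, Finset.sum_map, Equiv.coe_toEmbedding, Equiv.coe_addRight,
    Finset.sum_add_distrib, Finset.sum_const, smul_add]
  rw [← Nat.cast_smul_eq_nsmul ℝ, smul_smul, inv_mul_cancel₀ hc, one_smul]

/-- Translation carries a top face to a top face, and top faces are unique. -/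
theorem netVertex_translate (hM : IsNet M R) (hM' : IsNet M' R) (h : ∀ p, p ∈ M' ↔ p - v ∈ M)
    (y : Plane) : netVertex M' (y + v) = netVertex M y + v := by
  rw [netVertex, netVertex, ← centroid_map (hM.topFace_nonempty y)]
  congr 1
  symm
  apply hM'.eq_topFace
  have ht := hM.isTopFace_topFace y
  have hco : ∀ F, subdivCoord (delaunayCoord M' (y + v)) (F.map (Equiv.addRight v).toEmbedding) =
      subdivCoord (delaunayCoord M y) F := subdivCoord_translate fun p => by
    rw [delaunayCoord_translate hM hM' h, add_sub_cancel_right]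
  have hsurj : ∀ G : Finset Plane, ∃ F : Finset Plane,
      F.map (Equiv.addRight v).toEmbedding = G := fun G =>
    ⟨G.map (Equiv.addRight v).symm.toEmbedding, by
      ext p; simp⟩
  refine ⟨fun G => ?_, fun G hG => ?_⟩ <;> obtain ⟨F, rfl⟩ := hsurj G
  · rw [hco, hco]; exact ht.1 F
  · rw [Finset.card_map, Finset.card_map]
    refine ht.2 F fun H => ?_
    rw [← hco, ← hco]
    exact hG _

end Translate

/-! ### Clopen markers for a free action. -/

section Dynamics

variable {X : Type*} [TopologicalSpace X] [AddAction (ℤ × ℤ) X] [ContinuousConstVAdd (ℤ × ℤ) X]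

theorem exists_isClopen_disjoint [CompactSpace X] [T2Space X] [TotallyDisconnectedSpace X]
    {F : Set (ℤ × ℤ)} (hF : F.Finite) (x : X) (hx : ∀ n ∈ F, n +ᵥ x ≠ x) :
    ∃ U, IsClopen U ∧ x ∈ U ∧ ∀ n ∈ F, ∀ y ∈ U, n +ᵥ y ∉ U := by
  have h : ∀ n ∈ F, ∃ V ∈ 𝓝 x, ∀ y ∈ V, n +ᵥ y ∉ V := by
    intro n hn
    obtain ⟨A, B, hA, hB, hxA, hxB, hAB⟩ := t2_separation (hx n hn)
    refine ⟨B ∩ (fun y => n +ᵥ y) ⁻¹' A, inter_mem (hB.mem_nhds hxB)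
      ((continuous_const_vadd n).continuousAt (hA.mem_nhds hxA)), fun y hy hy' => ?_⟩
    exact disjoint_left.1 hAB hy.2 hy'.1
  choose! V hV hV' using h
  obtain ⟨W, hWV, hW, hxW⟩ := mem_nhds_iff.1 ((biInter_mem hF).2 hV)
  obtain ⟨U, hU, hxU, hUW⟩ := compact_exists_isClopen_in_isOpen hW hxW
  have hUV : ∀ n ∈ F, U ⊆ V n := fun n hn y hy => mem_iInter₂.1 (hWV (hUW hy)) n hn
  exact ⟨U, hU, hxU, fun n hn y hy hy' => hV' n hn y (hUV n hn hy) (hUV n hn hy')⟩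

/-- A free action has a locally constant colouring which distinguishes nearby points of each
orbit. -/
theorem exists_colouring [CompactSpace X] [T2Space X] [TotallyDisconnectedSpace X]
    (hfree : ∀ (n : ℤ × ℤ) (x : X), n +ᵥ x = x → n = 0) {F : Set (ℤ × ℤ)} (hF : F.Finite)
    (h0 : 0 ∉ F) :
    ∃ (N : ℕ) (κ : X → ℕ), IsLocallyConstant κ ∧ (∀ x, κ x < N) ∧
      ∀ n ∈ F, ∀ x, κ (n +ᵥ x) ≠ κ x := by
  choose U hU hxU hdis using fun x : X => exists_isClopen_disjoint hF x
    fun n hn e => h0 (hfree n x e ▸ hn)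
  obtain ⟨t, ht⟩ := isCompact_univ.elim_finite_subcover U (fun x => (hU x).isOpen)
    fun x _ => mem_iUnion.2 ⟨x, hxU x⟩
  -- The colour of a point is its membership pattern in the finite clopen cover. Some `U i` contains
  -- `x`, and then it does not contain `n +ᵥ x`, so the patterns differ.
  let f : X → t → Prop := fun x i => x ∈ U i
  have hf : IsLocallyConstant f := by
    rw [IsLocallyConstant.iff_eventually_eq]
    intro x
    have : ∀ i : t, ∀ᶠ y in 𝓝 x, (y ∈ U i ↔ x ∈ U i) := by
      intro i
      by_cases hx : x ∈ U i
      · filter_upwards [(hU i).isOpen.mem_nhds hx] with y hy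
        simp [hx, hy]
      · filter_upwards [(hU i).compl.isOpen.mem_nhds hx] with y hy
        simpa [hx] using hy
    filter_upwards [eventually_all.2 this] with y hy
    exact funext fun i => propext (hy i)
  obtain ⟨N, ⟨e⟩⟩ := Finite.exists_equiv_fin (t → Prop)
  refine ⟨N, fun x => e (f x), hf.comp fun a => (e a : ℕ), fun x => (e (f x)).2, ?_⟩
  intro n hn x he
  have he' : f (n +ᵥ x) = f x := e.injective (Fin.ext he)
  obtain ⟨i, hi, hxi⟩ := mem_iUnion₂.1 (ht (mem_univ x))
  have h1 : (n +ᵥ x ∈ U i) = (x ∈ U i) := congrFun he' ⟨i, hi⟩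
  exact hdis i n hn x hxi (h1 ▸ hxi)

/-- A maximal `F`-independent set built greedily by colour: at each stage add all points of the next
colour with no `F`-neighbour chosen so far. Points of one colour never conflict, and each stage is
clopen. -/
theorem exists_marker {F : Set (ℤ × ℤ)} (hF : F.Finite) (hneg : ∀ n ∈ F, -n ∈ F) {κ : X → ℕ}
    (hκ : IsLocallyConstant κ) (hκF : ∀ n ∈ F, ∀ x, κ (n +ᵥ x) ≠ κ x) (N : ℕ) :
    ∃ C : Set X, IsClopen C ∧ (∀ x ∈ C, ∀ n ∈ F, n +ᵥ x ∉ C) ∧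
      ∀ x, κ x < N → x ∈ C ∨ ∃ n ∈ F, n +ᵥ x ∈ C := by
  induction N with
  | zero => exact ⟨∅, isClopen_empty, by simp, by simp⟩
  | succ N ih =>
    obtain ⟨C, hC, hind, hcov⟩ := ih
    set D : Set X := {x | κ x = N} ∩ ⋂ n ∈ F, (fun x => n +ᵥ x) ⁻¹' Cᶜ with hD
    have hDc : IsClopen D := (hκ.isClopen_fiber N).inter
      (hF.isClopen_biInter fun n _ => hC.compl.preimage (continuous_const_vadd n))
    have hmem : ∀ x ∈ D, κ x = N ∧ ∀ n ∈ F, n +ᵥ x ∉ C := fun x hx =>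
      ⟨hx.1, fun n hn => mem_iInter₂.1 hx.2 n hn⟩
    refine ⟨C ∪ D, hC.union hDc, ?_, ?_⟩
    · rintro x (hx | hx) n hn (hy | hy)
      · exact hind x hx n hn hy
      · exact (hmem _ hy).2 _ (hneg n hn) (by rwa [neg_vadd_vadd])
      · exact (hmem x hx).2 n hn hy
      · exact hκF n hn x ((hmem _ hy).1.trans (hmem x hx).1.symm)
    · intro x hx
      rcases Nat.lt_succ_iff_lt_or_eq.1 hx with h | h
      · rcases hcov x h with h' | ⟨n, hn, h'⟩
        · exact .inl (.inl h')
        · exact .inr ⟨n, hn, .inl h'⟩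
      · by_cases hex : ∃ n ∈ F, n +ᵥ x ∈ C
        · obtain ⟨n, hn, h'⟩ := hex
          exact .inr ⟨n, hn, .inl h'⟩
        · push Not at hex
          exact .inl (.inr ⟨h, mem_iInter₂.2 hex⟩)

end Dynamics

/-! ### Shifts in general position. -/

/-- The points `n + (s, 0)`. -/
noncomputable def shiftPoint (n : ℤ × ℤ) (s : ℝ) : Plane := latticePoint n + !₂[s, 0]

theorem dist_shiftPoint_latticePoint (n : ℤ × ℤ) {s : ℝ} (hs : 0 ≤ s) :
    dist (shiftPoint n s) (latticePoint n) = s := by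
  rw [dist_eq_norm, shiftPoint, add_sub_cancel_left, EuclideanSpace.norm_eq]
  simp [Fin.sum_univ_two, Real.sqrt_sq, hs]

theorem shiftPoint_add (n m : ℤ × ℤ) (s : ℝ) :
    shiftPoint (m + n) s = shiftPoint n s + latticePoint m := by
  rw [shiftPoint, shiftPoint, latticePoint_add]; abel

theorem dist_sq_shiftPoint (c : Plane) (n : ℤ × ℤ) (s : ℝ) :
    dist c (shiftPoint n s) ^ 2 = (c 0 - n.1 - s) ^ 2 + (c 1 - n.2) ^ 2 := by
  rw [dist_eq_norm, Plane.norm_sq, shiftPoint, latticePoint]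
  simp
  ring

theorem eq_of_equidistant {p q r c c' : Plane} (hpq : p ≠ q) (hpr : p ≠ r) (hqr : q ≠ r)
    (h1 : dist c p = dist c q) (h2 : dist c p = dist c r) (h1' : dist c' p = dist c' q)
    (h2' : dist c' p = dist c' r) : c = c' := by
  by_contra hne
  have hfr : Module.finrank ℝ Plane = 2 := by simp
  rcases EuclideanGeometry.eq_of_dist_eq_of_dist_eq_of_finrank_eq_two hfr hne hpq
    (r₁ := dist c p) (r₂ := dist c' p) (p := r) (dist_comm _ _) (by rw [dist_comm, h1])
    (by rw [dist_comm, h2]) (dist_comm _ _) (by rw [dist_comm, h1']) (by rw [dist_comm, h2'])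
    with h | h
  · exact hpr h.symm
  · exact hqr h.symm

/-- The shift `t` puts the point `n` on a circle through three distinct points. -/
def Cocircular (p q r : Plane) (n : ℤ × ℤ) (t : ℝ) : Prop :=
  p ≠ q ∧ p ≠ r ∧ q ≠ r ∧ ∃ c, dist c p = dist c q ∧ dist c p = dist c r ∧
    dist c p = dist c (shiftPoint n t)

/-- Three distinct points determine the centre of their circle, and a horizontal line meets the
circle in at most two points. -/
theorem finite_cocircular (p q r : Plane) (n : ℤ × ℤ) : {t | Cocircular p q r n t}.Finite := by
  rcases eq_empty_or_nonempty {t | Cocircular p q r n t} with h | ⟨t₀, hpq, hpr, hqr, c, h1, h2, h3⟩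
  · rw [h]; exact finite_empty
  refine Set.Finite.subset (toFinite {t₀, 2 * (c 0 - n.1) - t₀}) ?_
  rintro t ⟨-, -, -, c', h1', h2', h3'⟩
  obtain rfl := eq_of_equidistant hpq hpr hqr h1 h2 h1' h2'
  have he := congrArg (· ^ 2) (h3.symm.trans h3')
  simp only [dist_sq_shiftPoint] at he
  have : (t - t₀) * (t - (2 * (c 0 - n.1) - t₀)) = 0 := by nlinarith
  rcases mul_eq_zero.1 this with h | h
  · left; linarith
  · right; exact sub_eq_zero.1 h

theorem exists_shifts (N : ℕ) : ∃ s : ℕ → ℝ, ∀ k < N, (0 < s k ∧ s k < 1 / 4) ∧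
    ∀ k₁ < k, ∀ k₂ < k, ∀ k₃ < k, ∀ n₁ n₂ n₃ n : ℤ × ℤ,
      ¬ Cocircular (shiftPoint n₁ (s k₁)) (shiftPoint n₂ (s k₂)) (shiftPoint n₃ (s k₃)) n (s k) := by
  induction N with
  | zero => exact ⟨fun _ => 0, by simp⟩
  | succ N ih =>
    obtain ⟨s, hs⟩ := ih
    -- All triples of earlier shifted lattice points together exclude only countably many values,
    -- whose complement is dense.
    have hcount : (⋃ a : (ℕ × ℕ × ℕ) × (ℤ × ℤ) × (ℤ × ℤ) × (ℤ × ℤ) × (ℤ × ℤ),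
        {t | Cocircular (shiftPoint a.2.1 (s a.1.1)) (shiftPoint a.2.2.1 (s a.1.2.1))
          (shiftPoint a.2.2.2.1 (s a.1.2.2)) a.2.2.2.2 t}).Countable :=
      countable_iUnion fun a => (finite_cocircular _ _ _ _).countable
    obtain ⟨t, htB, ht⟩ := (hcount.dense_compl ℝ).exists_mem_open (isOpen_Ioo (a := 0) (b := 1 / 4))
      (nonempty_Ioo.2 (by norm_num))
    refine ⟨Function.update s N t, fun k hk => ?_⟩
    have hold : ∀ j < N, Function.update s N t j = s j := fun j hj =>
      Function.update_of_ne hj.ne _ _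
    rcases Nat.lt_succ_iff_lt_or_eq.1 hk with h | rfl
    · rw [hold k h]
      refine ⟨(hs k h).1, fun k₁ h1 k₂ h2 k₃ h3 => ?_⟩
      rw [hold _ (h1.trans h), hold _ (h2.trans h), hold _ (h3.trans h)]
      exact (hs k h).2 k₁ h1 k₂ h2 k₃ h3
    · rw [Function.update_self]
      refine ⟨ht, fun k₁ h1 k₂ h2 k₃ h3 n₁ n₂ n₃ n hco => ?_⟩
      rw [hold _ h1, hold _ h2, hold _ h3] at hco
      exact htB (mem_iUnion.2 ⟨((k₁, k₂, k₃), n₁, n₂, n₃, n), hco⟩)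

theorem finite_lattice_closedBall (z : Plane) (ρ : ℝ) :
    {n : ℤ × ℤ | dist (latticePoint n) z ≤ ρ}.Finite := by
  obtain ⟨C, hC⟩ := exists_nat_ge ρ
  exact (finite_of_encard_le_coe (encard_lattice_closedBall_le z C)).subset
    fun n hn => le_trans hn hC

/-! ### Equivariant, locally constant nets. -/

section Net

variable {X : Type*} [AddAction (ℤ × ℤ) X]

/-- The net of the point `x`: the markers `C` on its orbit, shifted according to their colour. -/
def markerNet (C : Set X) (κ : X → ℕ) (s : ℕ → ℝ) (x : X) : Set Plane :=
  {p | ∃ n : ℤ × ℤ, (-n) +ᵥ x ∈ C ∧ p = shiftPoint n (s (κ ((-n) +ᵥ x)))}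

variable {C : Set X} {κ : X → ℕ} {s : ℕ → ℝ}

theorem mem_markerNet_vadd (n : ℤ × ℤ) (x : X) (p : Plane) :
    p ∈ markerNet C κ s (n +ᵥ x) ↔ p - latticePoint n ∈ markerNet C κ s x := by
  have key : ∀ m : ℤ × ℤ, -(n + m) +ᵥ (n +ᵥ x) = -m +ᵥ x := fun m => by
    rw [vadd_vadd]; congr 1; abel
  constructor
  · rintro ⟨m, hm, rfl⟩
    obtain ⟨m, rfl⟩ : ∃ m', m = n + m' := ⟨m - n, by abel⟩
    rw [key] at hm
    exact ⟨m, hm, by rw [key, shiftPoint_add, add_sub_cancel_right]⟩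
  · rintro ⟨m, hm, hp⟩
    refine ⟨n + m, by rwa [key], ?_⟩
    rw [key, shiftPoint_add, ← hp, sub_add_cancel]

theorem eventually_markerNet_inter [TopologicalSpace X] [ContinuousConstVAdd (ℤ × ℤ) X]
    (hC : IsClopen C) (hκ : IsLocallyConstant κ) (hs : ∀ x, 0 ≤ s (κ x)) (hs' : ∀ x, s (κ x) ≤ 1)
    (x : X) (y : Plane) (ρ : ℝ) :
    ∀ᶠ x' in 𝓝 x, markerNet C κ s x' ∩ Metric.closedBall y ρ =
      markerNet C κ s x ∩ Metric.closedBall y ρ := by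
  have hcont : ∀ n : ℤ × ℤ, Tendsto (fun x' : X => -n +ᵥ x') (𝓝 x) (𝓝 (-n +ᵥ x)) := fun n =>
    (continuous_const_vadd (-n)).continuousAt
  have h1 : ∀ n : ℤ × ℤ, ∀ᶠ x' in 𝓝 x, (-n +ᵥ x' ∈ C ↔ -n +ᵥ x ∈ C) ∧
      κ (-n +ᵥ x') = κ (-n +ᵥ x) := by
    intro n
    refine Eventually.and ?_ ((hcont n).eventually (hκ.eventually_eq _))
    by_cases hx : -n +ᵥ x ∈ C
    · filter_upwards [(hcont n).eventually (hC.isOpen.mem_nhds hx)] with x' hx'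
      exact iff_of_true hx' hx
    · filter_upwards [(hcont n).eventually (hC.compl.isOpen.mem_nhds hx)] with x' hx'
      exact iff_of_false hx' hx
  have h2 : ∀ᶠ x' in 𝓝 x, ∀ n ∈ {n : ℤ × ℤ | dist (latticePoint n) y ≤ ρ + 1},
      (-n +ᵥ x' ∈ C ↔ -n +ᵥ x ∈ C) ∧ κ (-n +ᵥ x') = κ (-n +ᵥ x) :=
    (eventually_all_finite (finite_lattice_closedBall y (ρ + 1))).2 fun n _ => h1 n
  filter_upwards [h2] with x' hx'
  have hd : ∀ n x, shiftPoint n (s (κ x)) ∈ Metric.closedBall y ρ →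
      dist (latticePoint n) y ≤ ρ + 1 := fun n x hp => by
    have := dist_shiftPoint_latticePoint n (hs x)
    rw [Metric.mem_closedBall] at hp
    linarith [dist_triangle_left (latticePoint n) y (shiftPoint n (s (κ x))), hs' x]
  ext p
  constructor
  · rintro ⟨⟨n, hn, rfl⟩, hp⟩
    obtain ⟨e1, e2⟩ := hx' n (hd n _ hp)
    exact ⟨⟨n, e1.1 hn, by rw [e2]⟩, hp⟩
  · rintro ⟨⟨n, hn, rfl⟩, hp⟩
    obtain ⟨e1, e2⟩ := hx' n (hd n _ hp)
    exact ⟨⟨n, e1.2 hn, by rw [e2]⟩, hp⟩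

/-- Shifts below `1 / 4` change mutual distances by at most `1 / 2`, so the margin of `1` in the
marker distances keeps separation `R`; density needs `2 + (R + 1) + 1 / 4 ≤ 2 * R`, hence `4 ≤ R`.
Points nearest to a common centre are within `4 * R` of each other, so their colours are distinct.
-/
theorem isNet_markerNet {R : ℝ} (hR : 4 ≤ R) {N : ℕ}
    (hs : ∀ k < N, (0 < s k ∧ s k < 1 / 4) ∧
      ∀ k₁ < k, ∀ k₂ < k, ∀ k₃ < k, ∀ n₁ n₂ n₃ n : ℤ × ℤ,
        ¬ Cocircular (shiftPoint n₁ (s k₁)) (shiftPoint n₂ (s k₂)) (shiftPoint n₃ (s k₃)) n (s k))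
    (hN : ∀ x, κ x < N)
    (hκ : ∀ n : ℤ × ℤ, n ≠ 0 → ‖latticePoint n‖ ≤ 4 * R + 1 → ∀ x, κ (n +ᵥ x) ≠ κ x)
    (hind : ∀ x ∈ C, ∀ n : ℤ × ℤ, n ≠ 0 → ‖latticePoint n‖ ≤ R + 1 → n +ᵥ x ∉ C)
    (hcov : ∀ x, ∃ n : ℤ × ℤ, ‖latticePoint n‖ ≤ R + 1 ∧ n +ᵥ x ∈ C) (x : X) :
    IsNet (markerNet C κ s x) R := by
  have hd : ∀ n x, dist (shiftPoint n (s (κ x))) (latticePoint n) ≤ 1 / 4 := fun n x => by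
    obtain ⟨h1, h2⟩ := (hs _ (hN x)).1
    rw [dist_shiftPoint_latticePoint n h1.le]; exact h2.le
  have hdd : ∀ n m x y, dist (latticePoint n) (latticePoint m) ≤
      dist (shiftPoint n (s (κ x))) (shiftPoint m (s (κ y))) + 1 / 2 := fun n m x y => by
    have h1 := hd n x
    have h2 := hd m y
    have := dist_triangle4 (latticePoint n) (shiftPoint n (s (κ x))) (shiftPoint m (s (κ y)))
      (latticePoint m)
    rw [dist_comm (latticePoint n) (shiftPoint n _)] at this
    linarith
  have hsub : ∀ n m : ℤ × ℤ, ‖latticePoint (n - m)‖ = dist (latticePoint n) (latticePoint m) :=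
    fun n m => by rw [dist_eq_norm, sub_eq_add_neg, latticePoint_add, latticePoint_neg, sub_eq_add_neg]
  have horb : ∀ n m : ℤ × ℤ, (n - m) +ᵥ (-n +ᵥ x) = -m +ᵥ x := fun n m => by
    rw [vadd_vadd]; congr 1; abel
  have hcov' : ∀ z, ∃ p ∈ markerNet C κ s x, dist z p ≤ 2 * R := by
    intro z
    obtain ⟨n, hn⟩ := exists_mem_cell z
    have h1 := dist_latticePoint_le_of_mem_cell hn
    obtain ⟨m, hm, hmC⟩ := hcov (-n +ᵥ x)
    have e : m +ᵥ (-n +ᵥ x) = -(n - m) +ᵥ x := by rw [vadd_vadd]; congr 1; abel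
    rw [e] at hmC
    refine ⟨_, ⟨n - m, hmC, rfl⟩, ?_⟩
    have h2 := hd (n - m) (-(n - m) +ᵥ x)
    rw [dist_comm] at h2
    have h3 := hsub n (n - m)
    rw [sub_sub_cancel] at h3
    have := dist_triangle4 z (latticePoint n) (latticePoint (n - m))
      (shiftPoint (n - m) (s (κ (-(n - m) +ᵥ x))))
    linarith
  refine ⟨by linarith, ?_, hcov', ?_⟩
  · rintro p ⟨n, hn, rfl⟩ q ⟨m, hm, rfl⟩ hne
    by_contra hcon
    have hnm : n - m ≠ 0 := fun e => hne (by rw [sub_eq_zero.1 e])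
    refine hind _ hn (n - m) hnm ?_ ((horb n m).symm ▸ hm)
    rw [hsub]
    linarith [hdd n m (-n +ᵥ x) (-m +ᵥ x)]
  · intro c
    by_contra hcon
    rw [not_le] at hcon
    have hfour : ((4 : ℕ) : ℕ∞) ≤ (nearest (markerNet C κ s x) c).encard :=
      Order.add_one_le_of_lt hcon
    obtain ⟨S, hS, hS4⟩ := exists_subset_encard_eq hfour
    have hSf : S.Finite := finite_of_encard_eq_coe hS4
    have hSd : ∀ p ∈ S, dist c p ≤ 2 * R := fun p hp => by
      obtain ⟨q, hq, hq'⟩ := hcov' c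
      exact ((hS hp).2 q hq).trans hq'
    have hSe : ∀ p ∈ S, ∀ q ∈ S, dist c p = dist c q := fun p hp q hq =>
      le_antisymm ((hS hp).2 q (hS hq).1) ((hS hq).2 p (hS hp).1)
    choose! ν hνC hν using fun p (hp : p ∈ S) => (hS hp).1
    -- Of four equidistant points the one with the largest colour has its shift chosen after the
    -- other three, so it cannot be on their circle.
    obtain ⟨p₄, h₄, hmax⟩ := exists_max_image S (fun p => κ (-(ν p) +ᵥ x)) hSf
      (encard_pos.1 (hS4 ▸ by norm_num))
    have hlt : ∀ p ∈ S, p ≠ p₄ → κ (-(ν p) +ᵥ x) < κ (-(ν p₄) +ᵥ x) := by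
      intro p hp hne
      refine lt_of_le_of_ne (hmax p hp) fun he => ?_
      have hnm : ν p₄ - ν p ≠ 0 := fun e => hne (by
        rw [hν p hp, hν p₄ h₄, sub_eq_zero.1 e])
      refine hκ _ hnm ?_ (-(ν p₄) +ᵥ x) (by rw [horb]; exact he)
      rw [hsub]
      have h1 := hdd (ν p₄) (ν p) (-(ν p₄) +ᵥ x) (-(ν p) +ᵥ x)
      rw [← hν p hp, ← hν p₄ h₄] at h1
      linarith [dist_triangle_left p₄ p c, hSd p hp, hSd p₄ h₄]
    have h3 : (S \ {p₄}).encard = 3 := by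
      have := encard_sdiff_singleton_add_one h₄
      rw [hS4] at this
      have h' : (S \ {p₄}).encard + 1 = 3 + 1 := this.trans (by norm_num)
      exact ENat.add_left_injective_of_ne_top ENat.one_ne_top h'
    obtain ⟨p₁, p₂, p₃, h12, h13, h23, he⟩ := encard_eq_three.1 h3
    have hmem : ∀ p ∈ ({p₁, p₂, p₃} : Set Plane), p ∈ S ∧ p ≠ p₄ := fun p hp => by
      rw [← he] at hp; exact hp
    obtain ⟨a1, b1⟩ := hmem p₁ (by simp)
    obtain ⟨a2, b2⟩ := hmem p₂ (by simp)
    obtain ⟨a3, b3⟩ := hmem p₃ (by simp)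
    refine (hs _ (hN (-(ν p₄) +ᵥ x))).2 _ (hlt p₁ a1 b1) _ (hlt p₂ a2 b2) _ (hlt p₃ a3 b3)
      (ν p₁) (ν p₂) (ν p₃) (ν p₄) ?_
    rw [← hν p₁ a1, ← hν p₂ a2, ← hν p₃ a3]
    refine ⟨h12, h13, h23, c, hSe _ a1 _ a2, hSe _ a1 _ a3, ?_⟩
    rw [← hν p₄ h₄]
    exact hSe _ a1 _ h₄

/-- The space carries equivariant, locally constant families of nets of every scale. -/
theorem exists_nets [TopologicalSpace X] [ContinuousConstVAdd (ℤ × ℤ) X] [CompactSpace X]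
    [T2Space X] [TotallyDisconnectedSpace X]
    (hfree : ∀ (n : ℤ × ℤ) (x : X), n +ᵥ x = x → n = 0) {R : ℝ} (hR : 4 ≤ R) :
    ∃ M : X → Set Plane, (∀ x, IsNet (M x) R) ∧
      (∀ n x p, p ∈ M (n +ᵥ x) ↔ p - latticePoint n ∈ M x) ∧
      ∀ x y ρ, ∀ᶠ x' in 𝓝 x, M x' ∩ Metric.closedBall y ρ = M x ∩ Metric.closedBall y ρ := by
  let F : ℝ → Set (ℤ × ℤ) := fun ρ => {n | n ≠ 0 ∧ ‖latticePoint n‖ ≤ ρ}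
  have hF : ∀ ρ, (F ρ).Finite := fun ρ => (finite_lattice_closedBall 0 ρ).subset
    fun n hn => by simpa using hn.2
  have h0 : ∀ ρ, 0 ∉ F ρ := fun ρ h => h.1 rfl
  have hneg : ∀ ρ, ∀ n ∈ F ρ, -n ∈ F ρ := fun ρ n hn =>
    ⟨neg_ne_zero.2 hn.1, by rw [latticePoint_neg, norm_neg]; exact hn.2⟩
  obtain ⟨N, κ, hκ, hN, hκF⟩ := exists_colouring hfree (hF (4 * R + 1)) (h0 _)
  obtain ⟨C, hC, hind, hcov⟩ := exists_marker (hF (R + 1)) (hneg _) hκ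
    (fun n hn => hκF n ⟨hn.1, hn.2.trans (by linarith)⟩) N
  obtain ⟨s, hs⟩ := exists_shifts N
  refine ⟨markerNet C κ s, isNet_markerNet hR hs hN (fun n hn hn' => hκF n ⟨hn, hn'⟩)
    (fun x hx n hn hn' => hind x hx n ⟨hn, hn'⟩) (fun x => ?_), mem_markerNet_vadd,
    eventually_markerNet_inter hC hκ (fun x => (hs _ (hN x)).1.1.le)
      fun x => by linarith [(hs _ (hN x)).1.2]⟩
  rcases hcov x (hN x) with h | ⟨n, hn, h⟩
  · refine ⟨0, ?_, by rwa [zero_vadd]⟩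
    have : latticePoint 0 = 0 := by apply Plane.ext_coord <;> simp
    rw [this, norm_zero]; linarith
  · exact ⟨n, hn.2, h⟩

end Net

/-! ### Lattice assignments and the inductive step. -/

/-- Moving the label of a tile to the corresponding vertex does not change the tiling. -/
theorem FatTriangulation.tiling_vertex {I : Type*} {L : ℝ} {E : ℕ} (𝒯 : FatTriangulation I L E)
    (q : ℤ × ℤ → Plane) :
    tiling (fun n => 𝒯.b (𝒯.label q n)) = tiling (𝒯.label q) := by
  have hb : ∀ n m, 𝒯.b (𝒯.label q n) = 𝒯.b (𝒯.label q m) → 𝒯.label q n = 𝒯.label q m := by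
    intro n m he
    obtain ⟨j, k, h⟩ := vertex_label (𝒯 := 𝒯) (q := q) n
    obtain ⟨j', k', h'⟩ := vertex_label (𝒯 := 𝒯) (q := q) m
    by_contra hne
    have h1 := (at_vertex h).coord₁
    rw [he] at h1
    have h2 := at_vertex h'
    by_cases e1 : 𝒯.label q n = j'
    · rw [e1, h2.coord₂] at h1; norm_num at h1
    by_cases e2 : 𝒯.label q n = k'
    · rw [e2, h2.coord₃] at h1; norm_num at h1
    rw [h2.coord_other hne e1 e2] at h1
    norm_num at h1
  have ht : ∀ n, tile (fun n => 𝒯.b (𝒯.label q n)) (𝒯.b (𝒯.label q n)) =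
      tile (𝒯.label q) (𝒯.label q n) := fun n => by
    ext y
    simp only [mem_tile]
    exact ⟨fun ⟨m, hm, hy⟩ => ⟨m, hb m n hm, hy⟩, fun ⟨m, hm, hy⟩ => ⟨m, by rw [hm], hy⟩⟩
  ext t
  constructor
  · rintro ⟨_, ⟨n, rfl⟩, rfl⟩
    exact ⟨_, ⟨n, rfl⟩, (ht n).symm⟩
  · rintro ⟨_, ⟨n, rfl⟩, rfl⟩
    exact ⟨_, ⟨n, rfl⟩, ht n⟩

/-- An equivariant, locally constant assignment of the lattice points to nearby points of the
plane. -/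
structure LatticeAssignment (X : Type u) [TopologicalSpace X] [AddAction (ℤ × ℤ) X] where
  q : X → ℤ × ℤ → Plane
  D : ℝ
  dist_le : ∀ x n, dist (q x n) (latticePoint n) ≤ D
  equivariant : ∀ x m n, q (m +ᵥ x) (m + n) = q x n + latticePoint m
  locally_constant : ∀ x n, ∀ᶠ x' in 𝓝 x, q x' n = q x n

namespace LatticeAssignment

variable {X : Type u} [TopologicalSpace X] [AddAction (ℤ × ℤ) X]

theorem isRegularFamily (S : LatticeAssignment X) : IsRegularFamily fun x => tiling (S.q x) where
  equivariant x m := by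
    have ht : ∀ n, tile (S.q (m +ᵥ x)) (S.q (m +ᵥ x) (m + n)) =
        translate m (tile (S.q x) (S.q x n)) := by
      intro n
      ext y
      obtain ⟨y, rfl⟩ : ∃ y', y = y' + latticePoint m := ⟨y - latticePoint m, by simp⟩
      have e : y + latticePoint m ∈ translate m (tile (S.q x) (S.q x n)) ↔
          y ∈ tile (S.q x) (S.q x n) := (add_left_injective (latticePoint m)).mem_set_image
      rw [e, S.equivariant, mem_tile, mem_tile]
      constructor
      · rintro ⟨k, hk, hy⟩
        obtain ⟨k, rfl⟩ : ∃ k', k = m + k' := ⟨k - m, by abel⟩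
        rw [S.equivariant, add_left_inj] at hk
        exact ⟨k, hk, (add_mem_cell_iff _ _ _).1 hy⟩
      · rintro ⟨k, hk, hy⟩
        exact ⟨m + k, by rw [S.equivariant, hk], (add_mem_cell_iff _ _ _).2 hy⟩
    ext t
    constructor
    · rintro ⟨_, ⟨n, rfl⟩, rfl⟩
      obtain ⟨n, rfl⟩ : ∃ k', n = m + k' := ⟨n - m, by abel⟩
      exact ⟨_, tile_mem_tiling _ n, (ht n).symm⟩
    · rintro ⟨_, ⟨_, ⟨n, rfl⟩, rfl⟩, rfl⟩
      rw [← ht]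
      exact tile_mem_tiling _ _
  locally_constant := by
    rintro x _ ⟨_, ⟨n, rfl⟩, rfl⟩
    -- The cells of a tile have lattice points within `S.D` of its reference point, so finitely many
    -- values of `q` determine the tile.
    have h : ∀ᶠ x' in 𝓝 x, ∀ m ∈ {m : ℤ × ℤ | dist (latticePoint m) (S.q x n) ≤ S.D},
        S.q x' m = S.q x m :=
      (eventually_all_finite (finite_lattice_closedBall _ _)).2 fun m _ => S.locally_constant x m
    refine ⟨_, h, fun x' hx' => ?_⟩
    have hn : S.q x' n = S.q x n := hx' n (by
      rw [mem_ofPred_eq, dist_comm]; exact S.dist_le x n)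
    refine ⟨_, ⟨n, rfl⟩, ?_⟩
    rw [hn]
    ext y
    simp only [mem_tile]
    constructor
    · rintro ⟨m, hm, hy⟩
      refine ⟨m, ?_, hy⟩
      rw [← hx' m _, hm]
      rw [mem_ofPred_eq, dist_comm, ← hm]
      exact S.dist_le x' m
    · rintro ⟨m, hm, hy⟩
      refine ⟨m, ?_, hy⟩
      rw [hx' m _, hm]
      rw [mem_ofPred_eq, dist_comm, ← hm]
      exact S.dist_le x m

/-- The assignment of each lattice point to itself. -/
def base : LatticeAssignment X where
  q _ n := latticePoint n
  D := 0
  dist_le x n := by simp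
  equivariant x m n := by rw [latticePoint_add, add_comm]
  locally_constant x n := Eventually.of_forall fun _ => rfl

/-- The conditions on each tessellation of the family. -/
structure IsGood (S : LatticeAssignment X) (l E : ℕ) (x : X) : Prop where
  isSimplicial : IsSimplicialTessellation (tiling (S.q x))
  polygonal : ∀ t ∈ tiling (S.q x), IsPolygonalRegion t
  boundedDiam : BoundedDiam (tiling (S.q x))
  capacity : HasCapacity (tiling (S.q x)) (max (l : ℝ) (E : ℝ))
  neighbours_le : ∀ t ∈ tiling (S.q x), (neighbours (tiling (S.q x)) t).encard ≤ (E : ℕ∞)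
  common : ∀ t s : Set Plane, (t, s) ∈ pairs (tiling (S.q x)) →
    (neighbours (tiling (S.q x)) t ∩ neighbours (tiling (S.q x)) s).encard = 2

/-- The conditions on successive tessellations of the family. -/
structure IsRefinement (S S' : LatticeAssignment X) (l : ℕ) (x : X) : Prop where
  separated : IsSeparated (tiling (S'.q x)) ((l : ℝ) + tessDiam (tiling (S.q x)))
  subset : ∀ t ∈ tiling (S.q x), ∃ t' ∈ tiling (S'.q x), t ⊆ t'
  triples_lt : ∀ t₁ t₂ t₃ t₃' : Set Plane, (t₁, t₂, t₃) ∈ triples (tiling (S'.q x)) →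
    (t₁, t₂, t₃') ∈ triples (tiling (S'.q x)) → t₃ ≠ t₃' →
    (N3 (tiling (S.q x)) t₁ t₂ t₃).encard < (N2 (tiling (S.q x)) t₁ t₂ t₃ t₃').encard
  boundary : ∀ t ∈ tiling (S'.q x), ∀ s ∈ tiling (S'.q x),
    (2 : ℕ∞) ^ l * {n : ℤ × ℤ | n ∈ latticeIn t ∧
      Metric.infDist (latticePoint n) tᶜ ≤ (l : ℝ)}.encard ≤ (latticeIn s).encard

variable [ContinuousConstVAdd (ℤ × ℤ) X]

/-- The assignment of each lattice point to a vertex of the subdivided Delaunay triangulation. -/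
noncomputable def netVertices (S : LatticeAssignment X) {R : ℝ} {M : X → Set Plane}
    (hM : ∀ x, IsNet (M x) R)
    (hequiv : ∀ n x p, p ∈ M (n +ᵥ x) ↔ p - latticePoint n ∈ M x)
    (hloc : ∀ x y ρ, ∀ᶠ x' in 𝓝 x, M x' ∩ Metric.closedBall y ρ = M x ∩ Metric.closedBall y ρ) :
    LatticeAssignment X where
  q x n := netVertex (M x) (S.q x n)
  D := S.D + 100 / (24 / R)
  dist_le x n := by
    rw [dist_comm]
    exact FatTriangulation.dist_latticePoint_le_of_label
      (𝒯 := (hM x).triangulation le_rfl) (by have := (hM x).pos; positivity) (S.dist_le x) rfl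
  equivariant x m n := by
    rw [S.equivariant]
    exact netVertex_translate (hM x) (hM _) (hequiv m x) _
  locally_constant x n := by
    filter_upwards [S.locally_constant x n, hloc x (S.q x n) (4 * R)] with x' h1 h2
    rw [h1]
    exact netVertex_congr (hM x') (hM x) h2

/-- The constants `C, N, β, C'` and `K` depend only on `D, l, E`, so `a` can be chosen last and
large. The boundary count is at most `K * (64 * a + 1) ≤ 65 * K * a`, below `a ^ 2` once `a ≥ 65 *
K`. -/
theorem exists_parameters (D : ℝ) (hD : 0 ≤ D) (l m E : ℕ) : ∃ a : ℕ, 1 ≤ a ∧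
    ∃ L : ℝ, 0 < L ∧ L = 1 / (64 * a) ∧ L * (D + 2) ≤ 1 / 100000 ∧
      L * max (m : ℝ) (E : ℝ) ≤ 1 / 8 ∧ L * (l + 2 * (D + 2)) ≤ 1 / 8 ∧
      (∃ C N : ℕ, 402 * (D + 2) ≤ C ∧ ((2 * C + 1) ^ 2) ^ 3 < N ∧ L * (D + 2) * N ≤ 1 / 6000) ∧
      ∃ β : ℝ, ∃ N C : ℕ, 2 * (D + 2) + l + 1 ≤ β ∧ L * β ≤ 1 / 8 ∧ 1 / L ≤ N ∧ 0 < N ∧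
        300 * β + 300 + D ≤ C ∧ L * (2 * a + 2) ≤ 1 / 8 ∧
        2 ^ l * (E * (E * (N + 1)) * (2 * C + 1) ^ 2) ≤ a ^ 2 := by
  obtain ⟨C, hC⟩ := exists_nat_ge (402 * (D + 2))
  set N : ℕ := ((2 * C + 1) ^ 2) ^ 3 + 1 with hN
  set β : ℝ := 2 * (D + 2) + l + 1 with hβ
  obtain ⟨C', hC'⟩ := exists_nat_ge (300 * β + 300 + D)
  set K : ℕ := 2 ^ l * (E * E * (2 * C' + 1) ^ 2) with hK
  obtain ⟨a₀, ha₀⟩ := exists_nat_ge (2000 * (D + 2) + (m + E) + β + 6000 * (D + 2) * N)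
  set a : ℕ := a₀ + 65 * K + 1 with ha
  have ha1 : 1 ≤ a := by omega
  have haR : (1 : ℝ) ≤ a := by exact_mod_cast ha1
  have ha₀' : (a₀ : ℝ) ≤ a := by exact_mod_cast (by omega : a₀ ≤ a)
  have p1 : 0 ≤ 6000 * (D + 2) * N := by positivity
  have p2 : 0 ≤ β := by positivity
  have p3 : (0 : ℝ) ≤ m + E := by positivity
  have hmul : ∀ t ε : ℝ, t ≤ 64 * a * ε → 1 / (64 * (a : ℝ)) * t ≤ ε := fun t ε h => by
    rw [one_div_mul_eq_div, div_le_iff₀ (by positivity)]; linarith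
  refine ⟨a, ha1, 1 / (64 * a), by positivity, rfl, hmul _ _ (by linarith), hmul _ _ ?_,
    hmul _ _ (by linarith), ⟨C, N, hC, by omega, ?_⟩, β, 64 * a, C', le_rfl,
    hmul _ _ (by linarith), ?_, by omega, hC', hmul _ _ (by linarith), ?_⟩
  · refine max_le ?_ ?_
    · have : (0 : ℝ) ≤ E := by positivity
      linarith
    · have : (0 : ℝ) ≤ m := by positivity
      linarith
  · rw [mul_assoc]
    exact hmul _ _ (by linarith)
  · rw [one_div_one_div]; push_cast; exact le_rfl
  · calc 2 ^ l * (E * (E * (64 * a + 1)) * (2 * C' + 1) ^ 2) = K * (64 * a + 1) := by rw [hK]; ring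
      _ ≤ K * (65 * a) := by gcongr; omega
      _ = 65 * K * a := by ring
      _ ≤ a * a := by gcongr; omega
      _ = a ^ 2 := by ring

theorem exists_refinement [CompactSpace X] [T2Space X] [TotallyDisconnectedSpace X]
    (hfree : ∀ (n : ℤ × ℤ) (x : X), n +ᵥ x = x → n = 0) {E : ℕ} (hE : 441 ^ 3 ≤ E)
    (S : LatticeAssignment X) (hS : 0 ≤ S.D) (l m : ℕ) :
    ∃ S' : LatticeAssignment X, 0 ≤ S'.D ∧ ∀ x, S'.IsGood m E x ∧ S.IsRefinement S' l x := by
  obtain ⟨a, ha, L, hL, hLa, h1, h2, h3, ⟨C, N, h4, h5, h6⟩, β, N', C', h7, h8, h9, h10, h11, h12,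
    h13⟩ := exists_parameters S.D hS l m E
  have haR : (1 : ℝ) ≤ a := by exact_mod_cast ha
  -- This scale makes the Lipschitz constant `24 / R` equal to `L = 1 / (64 * a)`.
  obtain ⟨M, hM, hequiv, hloc⟩ := exists_nets hfree (R := 24 * (64 * a)) (by linarith)
  have hLR : 24 / (24 * (64 * (a : ℝ))) = L := by rw [hLa]; field_simp
  let S' := S.netVertices hM hequiv hloc
  have hS' : 0 ≤ S'.D := by
    change 0 ≤ S.D + 100 / _
    positivity
  refine ⟨S', hS', fun x => ?_⟩
  obtain ⟨𝒯, h𝒯⟩ : ∃ 𝒯 : FatTriangulation (Finset Plane) L E,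
      S'.q x = fun n => 𝒯.b (𝒯.label (S.q x) n) := by
    subst hLR
    exact ⟨(hM x).triangulation hE, rfl⟩
  have ht : tiling (S'.q x) = tiling (𝒯.label (S.q x)) := by rw [h𝒯, 𝒯.tiling_vertex]
  have hq := S.dist_le x
  have hs : L * (S.D + 2) ≤ 1 / 1000 := h1.trans (by norm_num)
  have hfin := FatTriangulation.finite_label (𝒯 := 𝒯) hL hq
  constructor
  · refine ⟨?_, ?_, boundedDiam_tiling_ref (S'.dist_le x), ?_, ?_, ?_⟩ <;> rw [ht]
    · exact FatTriangulation.isSimplicialTessellation hL hq hs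
    · rintro _ ⟨i, -, rfl⟩
      exact isPolygonalRegion_tile (hfin i)
    · exact FatTriangulation.hasCapacity hL hq hs h2
    · exact fun t => FatTriangulation.encard_neighbours_le hL hq hs
    · exact fun t s => FatTriangulation.encard_common_neighbours hL hq hs
  · refine ⟨?_, ?_, ?_, ?_⟩ <;> rw [ht]
    · intro t h s h' hd
      refine le_trans ?_ (FatTriangulation.isSeparated hL hq hs h3 t h s h' hd)
      gcongr
      exact tessDiam_tiling_ref_le hq
    · exact fun t h => tile_ref_subset h
    · exact fun t₁ t₂ t₃ t₃' h h' hne =>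
        FatTriangulation.encard_N3_lt_encard_N2 hL hq h1 h h' hne h4 h5 h6
    · exact fun t h s h' =>
        FatTriangulation.boundary_le_latticeIn hL hq hs h h' h7 h8 h9 h10 h11 h12 h13

end LatticeAssignment

end PlaneTess

theorem theorem5p1 :
    ∃ E₀ : ℕ, 3 ≤ E₀ ∧ ∀ E : ℕ, E₀ ≤ E →
      ∀ (X : Type u) [TopologicalSpace X] [CompactSpace X] [TopologicalSpace.MetrizableSpace X]
        [TotallyDisconnectedSpace X] [PerfectSpace X] [Nonempty X]
        [AddAction (ℤ × ℤ) X] [ContinuousConstVAdd (ℤ × ℤ) X] [AddAction.IsMinimal (ℤ × ℤ) X],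
        (∀ (n : ℤ × ℤ) (x : X), n +ᵥ x = x → n = 0) →
        ∃ T : ℕ → X → Set (Set Plane),
          (∀ l : ℕ, IsRegularFamily (T l)) ∧
          ∀ (l : ℕ) (x : X),
            IsSimplicialTessellation (T l x) ∧
            (∀ t ∈ T l x, IsPolygonalRegion t) ∧
            BoundedDiam (T l x) ∧
            -- 1. capacity
            HasCapacity (T l x) (max (l : ℝ) (E : ℝ)) ∧
            -- 2. separation
            IsSeparated (T (l + 1) x) ((l : ℝ) + tessDiam (T l x)) ∧
            -- 3. number of neighbours
            (∀ t ∈ T l x, (neighbours (T l x) t).encard ≤ (E : ℕ∞)) ∧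
            -- 4. common neighbours
            (∀ t s : Set Plane, (t, s) ∈ pairs (T l x) →
              (neighbours (T l x) t ∩ neighbours (T l x) s).encard = 2) ∧
            -- 5. refinement
            (∀ t ∈ T l x, ∃ t' ∈ T (l + 1) x, t ⊆ t') ∧
            -- 6. triples near a vertex against tiles along an edge
            (∀ t₁ t₂ t₃ t₃' : Set Plane, (t₁, t₂, t₃) ∈ triples (T (l + 1) x) →
              (t₁, t₂, t₃') ∈ triples (T (l + 1) x) → t₃ ≠ t₃' →
              (N3 (T l x) t₁ t₂ t₃).encard < (N2 (T l x) t₁ t₂ t₃ t₃').encard) ∧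
            -- 7. lattice points near the boundary
            (∀ t ∈ T (l + 1) x, ∀ s ∈ T (l + 1) x,
              (2 : ℕ∞) ^ l *
                  {n : ℤ × ℤ | n ∈ latticeIn t ∧
                    Metric.infDist (latticePoint n) tᶜ ≤ (l : ℝ)}.encard
                ≤ (latticeIn s).encard) := by
  refine ⟨441 ^ 3, by norm_num, fun E hE X _ _ _ _ _ _ _ _ _ hfree => ?_⟩
  have : T2Space X := by
    let := TopologicalSpace.metrizableSpaceMetric X
    infer_instance
  -- The unit squares themselves are no simplicial tessellation, since four of them meet at a
  -- corner; level `0` is already a refinement of `base`, and only its goodness is kept.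
  obtain ⟨S₀, hS₀, hgood₀⟩ :=
    LatticeAssignment.exists_refinement hfree hE (.base : LatticeAssignment X) le_rfl 0 0
  choose g hg using fun (S : {S : LatticeAssignment X // 0 ≤ S.D}) (l : ℕ) =>
    LatticeAssignment.exists_refinement hfree hE S.1 S.2 l (l + 1)
  -- The bound `S.D` is uniform in `x`, so a single scale, and hence a single assignment, serves all
  -- points of `X` at each level.
  let f : ℕ → {S : LatticeAssignment X // 0 ≤ S.D} :=
    fun l => Nat.rec ⟨S₀, hS₀⟩ (fun l S => ⟨g S l, (hg S l).1⟩) l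
  have hgood : ∀ l x, (f l).1.IsGood l E x := by
    intro l x
    cases l with
    | zero => exact (hgood₀ x).1
    | succ l => exact ((hg (f l) l).2 x).1
  have href : ∀ l x, (f l).1.IsRefinement (f (l + 1)).1 l x := fun l x => ((hg (f l) l).2 x).2
  exact ⟨fun l x => tiling ((f l).1.q x), fun l => (f l).1.isRegularFamily, fun l x =>
    ⟨(hgood l x).isSimplicial, (hgood l x).polygonal, (hgood l x).boundedDiam,
      (hgood l x).capacity, (href l x).separated, (hgood l x).neighbours_le, (hgood l x).common,
      (href l x).subset, (href l x).triples_lt, (href l x).boundary⟩⟩
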